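/- Let $L>0$, let $c\in L^\infty(0,L)$ and let $D\ge 0$. Consider the equation $$y_t=y_{xx}+c(x)y \ \text{ on } (0,L),\qquad y(t,0)=0,\quad y(t,L)=u_D(t)=u(t-D),\qquad y(0,\cdot)=y_0\in L^2(0,L).$$ Let $A=\partial_{xx}+c(\cdot)\,\mathrm{id}$ with domain $H^2(0,L)\cap H^1_0(0,L)$. Then $A$ has finitely many nonnegative eigenvalues $\lambda_1>\dots>\lambda_n\ge 0$ (possibly $n=0$). Let $e_1,\dots,e_n$ be corresponding eigenfunctions with $\|e_j\|_{L^2(0,L)}=1$, and set $a_j=\frac1L\int_0^L xc(x)e_j(x)\,dx$, $b_j=-\frac1L\int_0^L xe_j(x)\,dx$, $$A_1=\begin{pmatrix}0&0&\cdots&0\\ a_1&\lambda_1&\cdots&0\\ \vdots&\vdots&\ddots&\vdots\\ a_n&0&\cdots&\lambda_n\end{pmatrix},\qquad B_1=\begin{pmatrix}1\\ b_1\\ \vdots\\ b_n\end{pmatrix},\qquad X_1(t)=\begin{pmatrix}u_D(t)\\ w_1(t)\\ \vdots\\ w_n(t)\end{pmatrix},$$ where $w_j(t)=\int_0^L\big(y(t,x)-\frac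 xL u_D(t)\big)e_j(x)\,dx$. Then: 1. There is a row vector $K\in\mathbb R^{1\times(n+1)}$ such that $A_1+e^{-DA_1}B_1K$ has $-1$ as an eigenvalue of algebraic multiplicity $n+1$. 2. Let $K$ be such a vector, let $t_0\ge0$, and consider the closed-loop system in which $u(t)=\int_0^t\alpha(s)\,ds$ with the predictor feedback $$\alpha(t)=0\ \ (t<t_0),\qquad \alpha(t)=KZ_1(t)\ \ (t\ge t_0),\qquad Z_1(t)=X_1(t)+\int_{t-D}^t e^{(t-s-D)A_1}B_1\alpha(s)\,ds$$ (in particular $u_D=0$ on $[0,D+t_0]$). For every $y_0\in L^2(0,L)$ the closed-loop system has exactly one solution $(\alpha,u,y)$ with $\alpha$ locally integrable and $y\in C([0,\infty);L^2(0,L))$, where $y$ solves the equation in the sense of transposition: for all $\varphi\in H^2(0,L)\cap H^1_0(0,L)$ and $t\ge0$, $$\int_0^L (y(t,x)-y_0(x))\varphi(x)\,dx=\int_0^t\Big(\int_0^L y(s,x)\big(\varphi''(x)+c(x)\varphi(x)\big)dx-u_D(s)\varphi'(L)\Big)ds .$$ 3. In the situation of 2, the closed-loop system is exponentially stable in the $H^1$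 norm. There is $\mu>0$, independent of $y_0$, such that for every $t>0$ one has $y(t,\cdot)\in H^1(0,L)$, $y(t,0)=0$, $y(t,L)=u_D(t)$, and: for every $\delta>0$ there is a constant $C_\delta$, independent of $y_0$, with $$\|y(t,\cdot)\|_{H^1(0,L)}\le C_\delta e^{-\mu t}\|y_0\|_{L^2(0,L)}\qquad\text{for all } t\ge\delta\text{ and all }y_0\in L^2(0,L);$$ and there is a constant $C$ with $$\|y(t,\cdot)\|_{H^1(0,L)}\le C e^{-\mu t}\|y_0\|_{H^1(0,L)}\qquad\text{for all } t\ge 0\text{ and all }y_0\in H^1_0(0,L).$$ -/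

import Mathlib

open MeasureTheory Set Filter Topology Matrix

noncomputable section

/-- The Hilbert space `L²(0,L)`. -/
abbrev L2 (L : ℝ) : Type := Lp ℝ 2 (volume.restrict (Ioo (0 : ℝ) L))

/-- `f` is the (absolutely) continuous representative on `[0,L]` of an element of `H¹(0,L)`,
with weak derivative `f' ∈ L²(0,L)`. -/
structure HasWeakDeriv (L : ℝ) (f f' : ℝ → ℝ) : Prop where
  memLp : MemLp f' 2 (volume.restrict (Ioo (0 : ℝ) L))
  eq_integral : ∀ x ∈ Icc (0 : ℝ) L, f x = f 0 + ∫ s in (0 : ℝ)..x, f' s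

/-- The `H¹(0,L)` norm of a function `f` with weak derivative `f'`. -/
def h1Norm (L : ℝ) (f f' : ℝ → ℝ) : ℝ :=
  Real.sqrt ((∫ x in (0 : ℝ)..L, f x ^ 2) + ∫ x in (0 : ℝ)..L, f' x ^ 2)

/-- `φ ∈ H²(0,L) ∩ H¹₀(0,L)`, with first and second weak derivatives `φ'` and `φ''`. -/
structure IsDirichletH2 (L : ℝ) (φ φ' φ'' : ℝ → ℝ) : Prop where
  deriv_one : HasWeakDeriv L φ φ'
  deriv_two : HasWeakDeriv L φ' φ''
  left : φ 0 = 0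
  right : φ L = 0

/-- `e` is an `L²(0,L)`-normalized eigenfunction, for the eigenvalue `lam`, of the operator
`A = ∂ₓₓ + c(x)` with domain `H²(0,L) ∩ H¹₀(0,L)`. -/
def IsEigenfunction (L : ℝ) (c : ℝ → ℝ) (lam : ℝ) (e : ℝ → ℝ) : Prop :=
  (∃ e' e'' : ℝ → ℝ, IsDirichletH2 L e e' e'' ∧
    ∀ᵐ x ∂(volume.restrict (Ioo (0 : ℝ) L)), e'' x + c x * e x = lam * e x) ∧
  ∫ x in (0 : ℝ)..L, e x ^ 2 = 1

/-- `lam 0 > ⋯ > lam (n-1)` is the list of all nonnegative eigenvalues of `A = ∂ₓₓ + c(x)`, and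
`e 0, …, e (n-1)` are corresponding normalized eigenfunctions. -/
structure IsUnstableModes (L : ℝ) (c : ℝ → ℝ) {n : ℕ} (lam : Fin n → ℝ) (e : Fin n → ℝ → ℝ) :
    Prop where
  strictAnti : StrictAnti lam
  nonneg : ∀ j, 0 ≤ lam j
  eigen : ∀ j, IsEigenfunction L c (lam j) (e j)
  complete : ∀ (mu : ℝ) (v : ℝ → ℝ), 0 ≤ mu → IsEigenfunction L c mu v → ∃ j, lam j = mu

/-- Index set of the finite-dimensional state: the control value, then the `n` unstable modes. -/
abbrev Idx (n : ℕ) : Type := Unit ⊕ Fin n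

/-- `a_j = (1/L) ∫₀ᴸ x c(x) e_j(x) dx`. -/
def aCoef (L : ℝ) (c : ℝ → ℝ) {n : ℕ} (e : Fin n → ℝ → ℝ) (j : Fin n) : ℝ :=
  (1 / L) * ∫ x in (0 : ℝ)..L, x * c x * e j x

/-- `b_j = -(1/L) ∫₀ᴸ x e_j(x) dx`. -/
def bCoef (L : ℝ) {n : ℕ} (e : Fin n → ℝ → ℝ) (j : Fin n) : ℝ :=
  -(1 / L) * ∫ x in (0 : ℝ)..L, x * e j x

/-- The matrix `A₁` with first row `0`, first column `(0, a_1, …, a_n)` and remaining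
diagonal block `diag(λ_1, …, λ_n)`. -/
def matA (L : ℝ) (c : ℝ → ℝ) {n : ℕ} (lam : Fin n → ℝ) (e : Fin n → ℝ → ℝ) :
    Matrix (Idx n) (Idx n) ℝ :=
  Matrix.fromBlocks 0 0 (Matrix.of fun j _ => aCoef L c e j) (Matrix.diagonal lam)

/-- The vector `B₁ = (1, b_1, …, b_n)`. -/
def vecB (L : ℝ) {n : ℕ} (e : Fin n → ℝ → ℝ) : Idx n → ℝ :=
  Sum.elim (fun _ => 1) (bCoef L e)

/-- The vector `e^{r A₁} B₁`. -/
def expB (L : ℝ) (c : ℝ → ℝ) {n : ℕ} (lam : Fin n → ℝ) (e : Fin n → ℝ → ℝ) (r : ℝ) : Idx n → ℝ :=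
  NormedSpace.exp (r • matA L c lam e) *ᵥ vecB L e

/-- `K` is a pole-shifting gain: `A₁ + e^{-D A₁} B₁ K` has `-1` as an eigenvalue of (algebraic)
multiplicity `n + 1`. -/
def IsPoleShiftingGain (L : ℝ) (c : ℝ → ℝ) (D : ℝ) {n : ℕ} (lam : Fin n → ℝ)
    (e : Fin n → ℝ → ℝ) (K : Idx n → ℝ) : Prop :=
  (matA L c lam e + Matrix.vecMulVec (expB L c lam e (-D)) K).charpoly =
    (Polynomial.X + 1) ^ (n + 1)

/-- The state `X₁ = (r, w_1, …, w_n)` when the boundary value is `r` and the profile is `v`, where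
`w_j` is the `e_j`-coefficient of `w(x) = v(x) - (x/L) r`. -/
def stateX (L : ℝ) {n : ℕ} (e : Fin n → ℝ → ℝ) (r : ℝ) (v : ℝ → ℝ) : Idx n → ℝ :=
  Sum.elim (fun _ => r) (fun j => ∫ x in (0 : ℝ)..L, (v x - x / L * r) * e j x)

/-- The Artstein transform `Z₁(t) = X₁(t) + ∫_{t-D}^t α(s) e^{(t-s-D)A₁} B₁ ds`, where `X₁(t)` is
computed from `u_D(t) = u(t-D)` and `y(t,·)`. -/
def artsteinZ (L : ℝ) (c : ℝ → ℝ) (D : ℝ) {n : ℕ} (lam : Fin n → ℝ) (e : Fin n → ℝ → ℝ)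
    (α u : ℝ → ℝ) (y : ℝ → L2 L) (t : ℝ) : Idx n → ℝ :=
  stateX L e (u (t - D)) (y t) + ∫ s in (t - D)..t, α s • expB L c lam e (t - s - D)

/-- `y ∈ C([0,∞); L²(0,L))` is a weak solution (in the sense of transposition) of
`y_t = y_xx + c(x) y`, `y(t,0) = 0`, `y(t,L) = v(t)`, `y(0,·) = y₀`. -/
structure IsHeatSolution (L : ℝ) (c : ℝ → ℝ) (v : ℝ → ℝ) (y₀ : L2 L) (y : ℝ → L2 L) : Prop where
  continuousOn : ContinuousOn y (Ici 0)
  initial : y 0 = y₀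
  weak : ∀ φ φ' φ'' : ℝ → ℝ, IsDirichletH2 L φ φ' φ'' → ∀ t : ℝ, 0 ≤ t →
    (∫ x in (0 : ℝ)..L, y t x * φ x) - (∫ x in (0 : ℝ)..L, y₀ x * φ x) =
      ∫ s in (0 : ℝ)..t,
        ((∫ x in (0 : ℝ)..L, y s x * (φ'' x + c x * φ x)) - v s * φ' L)

/-- Closed loop: `y` solves the equation with boundary value `u_D(t) = u(t-D)`, where `u' = α`,
`u = 0` before the time `t₀ ≥ 0` at which the feedback is switched on, and
`α(t) = 0` for `t < t₀`, `α(t) = K Z₁(t)` for `t ≥ t₀`. -/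
structure IsClosedLoop (L : ℝ) (c : ℝ → ℝ) (D t₀ : ℝ) {n : ℕ} (lam : Fin n → ℝ)
    (e : Fin n → ℝ → ℝ) (K : Idx n → ℝ) (y₀ : L2 L) (α u : ℝ → ℝ) (y : ℝ → L2 L) : Prop where
  locallyIntegrable : LocallyIntegrable α volume
  control : ∀ t, u t = ∫ s in (0 : ℝ)..t, α s
  feedback_off : ∀ t, t < t₀ → α t = 0
  feedback_on : ∀ t, t₀ ≤ t → α t = K ⬝ᵥ artsteinZ L c D lam e α u y t
  solution : IsHeatSolution L c (fun t => u (t - D)) y₀ y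

/-- `z ∈ L²(0,L)` belongs to `H¹(0,L)`, has boundary values `0` at `0` and `r` at `L`, and
`‖z‖_{H¹(0,L)} ≤ M`. -/
def H1Bound (L : ℝ) (z : L2 L) (r M : ℝ) : Prop :=
  ∃ f f' : ℝ → ℝ, HasWeakDeriv L f f' ∧ (∀ᵐ x ∂(volume.restrict (Ioo (0 : ℝ) L)), z x = f x) ∧
    f 0 = 0 ∧ f L = r ∧ h1Norm L f f' ≤ M

end

/-!
The proof is spectral. The substitution `w = y - (x/L) u_D` turns the boundary control into a
distributed one, and in a Hilbert basis of eigenfunctions `eᵢ` of `A` (eigenvalues `λᵢ`) the equation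
decouples into the scalar equations `wᵢ' = λᵢ wᵢ + aᵢ u_D + bᵢ α(· - D)`
(`SpectralBasis.coef_eq_of_isHeatSolution`).

*Spectral theory.* With `κ > ‖c‖_∞`, the resolvent `(κ - A)⁻¹` is written as `J T⁻¹ J*`. Here `J`
(`dirichletPrimitive`) is a compact operator on `L²(0,L)` whose range is `H¹₀(0,L)`, and
`T = 1 + J* (κ - c) J` (`formOp`) is bounded and coercive; so the resolvent is a compact symmetric
operator. The spectral theorem gives the Hilbert basis (`exists_hilbertBasis_eigenfunctions`), and
compactness gives the finiteness of the set of eigenvalues above any level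
(`finite_eigenvalues_ge`), hence that of the unstable ones and a gap below `0`
(`exists_spectral_gap`). The form `T` also identifies the square of the `H¹` norm on `H¹₀(0,L)`, up
to constants, with the weighted sum `∑ (κ - λᵢ) wᵢ²` over coefficients
(`SpectralBasis.exists_dirichletPrimitive_eq`, `SpectralBasis.sum_coef_le`).

*Pole placement.* Integration by parts gives `aⱼ + λⱼ bⱼ = -eⱼ'(L)`, which is not zero by uniqueness
for the Cauchy problem at `L` (`deriv_right_ne_zero`); the same uniqueness makes the eigenvalues
simple. Thus `(A₁, B₁)` is controllable, and an explicit partial fraction computation yields the gain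
(`exists_charpoly_eq`); conjugation by `e^{-D A₁}` accounts for the delay.

*Well-posedness.* Artstein's transform `Z₁` satisfies `Z₁' = A₁ Z₁ + α e^{-D A₁} B₁` without delay
(`add_integral_eq_linearState`). Under the feedback this is the linear equation
`Z₁' = (A₁ + e^{-D A₁} B₁ K) Z₁`, whose only solution is a matrix exponential. So `α` is known
explicitly in terms of `y₀`, then `u` is its primitive, and `y` is the unique solution of the heat
equation with an absolutely continuous boundary value.

*Stability.* The closed-loop matrix has `-1` as its only eigenvalue, so that `Z₁`, and with it `α`,
`u_D` and the unstable modes, decay like `e^{-t/2}` (`SpectralBasis.exists_unstable_decay`). For the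
stable modes the scalar equations are solved by Duhamel's formula. The source contributes
`O(e^{-μt} (|aᵢ| + |bᵢ|) / |λᵢ|)`, which is square summable even after multiplication by
`√(κ - λᵢ)`. The weight on the contribution of the initial value is absorbed by `e^{λᵢ t}` when
`t ≥ δ`, or by the assumption `y₀ ∈ H¹₀(0,L)`. Summation gives the `H¹` bound
(`SpectralBasis.exists_H1Bound_of_decay`).
-/

variable {L : ℝ}

/-! ### Absolutely continuous functions and integration by parts -/

/-- Integration by parts for indefinite integrals of integrable functions. -/
theorem integral_mul_add_mul_of_eq_integral {a b : ℝ} (hab : a ≤ b) {f f' g g' : ℝ → ℝ}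
    (hf' : IntervalIntegrable f' volume a b) (hg' : IntervalIntegrable g' volume a b)
    (hf : ∀ x ∈ Icc a b, f x = f a + ∫ s in a..x, f' s)
    (hg : ∀ x ∈ Icc a b, g x = g a + ∫ s in a..x, g' s) :
    ∫ x in a..b, (f' x * g x + f x * g' x) = f b * g b - f a * g a := by
  have ha : a ∈ uIcc a b := left_mem_uIcc
  have key : ∀ {h h' : ℝ → ℝ}, IntervalIntegrable h' volume a b →
      AbsolutelyContinuousOnInterval (fun x => h a + ∫ s in a..x, h' s) a b ∧
      ∀ᵐ x, x ∈ uIcc a b → deriv (fun x => h a + ∫ s in a..x, h' s) x = h' x := by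
    intro h h' hh
    refine ⟨?_, ?_⟩
    · exact (LipschitzOnWith.absolutelyContinuousOnInterval (K := 0)
        (LipschitzWith.const (h a)).lipschitzOnWith).add
        (hh.absolutelyContinuousOnInterval_intervalIntegral ha)
    · filter_upwards [hh.ae_hasDerivAt_integral] with x hx hxm
      exact ((hx hxm a ha).const_add (h a)).deriv
  obtain ⟨f1, f2⟩ := key (h := f) hf'
  obtain ⟨g1, g2⟩ := key (h := g) hg'
  have := f1.integral_deriv_mul_eq_sub g1
  rw [hf b ⟨hab, le_rfl⟩, hg b ⟨hab, le_rfl⟩]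
  simp only [intervalIntegral.integral_same, add_zero] at this
  rw [← this]
  apply intervalIntegral.integral_congr_ae
  filter_upwards [f2, g2] with x hx1 hx2 hxm
  have hxm' : x ∈ uIcc a b := uIoc_subset_uIcc hxm
  have hxI : x ∈ Icc a b := by rwa [uIcc_of_le hab] at hxm'
  rw [hx1 hxm', hx2 hxm', ← hf x hxI, ← hg x hxI]

theorem continuousOn_of_eq_integral {a b : ℝ} (hab : a ≤ b) {f f' : ℝ → ℝ}
    (hf' : IntervalIntegrable f' volume a b)
    (hf : ∀ x ∈ Icc a b, f x = f a + ∫ s in a..x, f' s) : ContinuousOn f (Icc a b) := by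
  have h := intervalIntegral.continuousOn_primitive_interval' hf' (left_mem_uIcc (a := a) (b := b))
  rw [uIcc_of_le hab] at h
  exact (h.const_add (f a)).congr hf

theorem ContinuousOn.memLp_two_Ioo {f : ℝ → ℝ} (hf : ContinuousOn f (Icc 0 L)) :
    MemLp f 2 (volume.restrict (Ioo (0 : ℝ) L)) := by
  have hm : AEStronglyMeasurable f (volume.restrict (Icc (0 : ℝ) L)) :=
    hf.aestronglyMeasurable measurableSet_Icc
  obtain ⟨C, hC⟩ := isCompact_Icc.exists_bound_of_continuousOn hf
  have : MemLp f ⊤ (volume.restrict (Icc (0 : ℝ) L)) :=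
    memLp_top_of_bound hm C ((ae_restrict_iff' measurableSet_Icc).2 (Eventually.of_forall hC))
  exact (this.mono_exponent le_top).mono_measure (Measure.restrict_mono Ioo_subset_Icc_self le_rfl)

theorem MeasureTheory.MemLp.intervalIntegrable_of_two {f : ℝ → ℝ}
    (hf : MemLp f 2 (volume.restrict (Ioo (0 : ℝ) L))) {x y : ℝ} (hx : x ∈ Icc 0 L)
    (hy : y ∈ Icc 0 L) : IntervalIntegrable f volume x y := by
  have h1 : IntegrableOn f (Ioo 0 L) := hf.integrable (by norm_num)
  have h2 : IntegrableOn f (Icc 0 L) := (integrableOn_Icc_iff_integrableOn_Ioo).2 h1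
  rw [intervalIntegrable_iff]
  refine h2.mono_set fun z hz => ?_
  have := uIoc_subset_uIcc hz
  rw [mem_uIcc] at this
  rcases this with h | h
  · exact ⟨hx.1.trans h.1, h.2.trans hy.2⟩
  · exact ⟨hy.1.trans h.1, h.2.trans hx.2⟩

theorem intervalIntegral_eq_integral_Ioo (hL : 0 ≤ L) (f : ℝ → ℝ) :
    ∫ x in (0 : ℝ)..L, f x = ∫ x in Ioo (0 : ℝ) L, f x := by
  rw [intervalIntegral.integral_of_le hL, integral_Ioc_eq_integral_Ioo]

/-- Functions that agree almost everywhere on `(0,L)` have the same integrals over subintervals. -/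
theorem intervalIntegral_congr_of_ae {f g : ℝ → ℝ}
    (h : f =ᵐ[volume.restrict (Ioo (0 : ℝ) L)] g) {x y : ℝ} (hx : x ∈ Icc 0 L) (hy : y ∈ Icc 0 L) :
    ∫ s in x..y, f s = ∫ s in x..y, g s := by
  apply intervalIntegral.integral_congr_ae
  have h1 : ∀ᵐ s ∂(volume : Measure ℝ), s ∈ Icc (0 : ℝ) L → f s = g s := by
    rw [← ae_restrict_iff' measurableSet_Icc, restrict_Ioo_eq_restrict_Icc.symm]
    exact h
  filter_upwards [h1] with s hs hsm
  apply hs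
  have := uIoc_subset_uIcc hsm
  rw [mem_uIcc] at this
  rcases this with h | h
  · exact ⟨hx.1.trans h.1, h.2.trans hy.2⟩
  · exact ⟨hy.1.trans h.1, h.2.trans hx.2⟩

theorem L2_inner_eq (hL : 0 ≤ L) {F G : L2 L} {f g : ℝ → ℝ}
    (hF : F =ᵐ[volume.restrict (Ioo (0 : ℝ) L)] f) (hG : G =ᵐ[volume.restrict (Ioo (0 : ℝ) L)] g) :
    inner ℝ F G = ∫ x in (0 : ℝ)..L, f x * g x := by
  rw [intervalIntegral_eq_integral_Ioo hL, MeasureTheory.L2.inner_def]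
  apply integral_congr_ae
  filter_upwards [hF, hG] with x h1 h2
  rw [h1, h2]
  simp [mul_comm]

theorem L2_norm_sq_eq (hL : 0 ≤ L) {F : L2 L} {f : ℝ → ℝ}
    (hF : F =ᵐ[volume.restrict (Ioo (0 : ℝ) L)] f) :
    ‖F‖ ^ 2 = ∫ x in (0 : ℝ)..L, f x ^ 2 := by
  rw [← real_inner_self_eq_norm_sq, L2_inner_eq hL hF hF]
  simp only [sq]

namespace HasWeakDeriv

variable {f f' g g' : ℝ → ℝ}

theorem intervalIntegrable (h : HasWeakDeriv L f f') (hL : 0 ≤ L) :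
    IntervalIntegrable f' volume 0 L :=
  h.memLp.intervalIntegrable_of_two ⟨le_rfl, hL⟩ ⟨hL, le_rfl⟩

theorem continuousOn (h : HasWeakDeriv L f f') (hL : 0 ≤ L) : ContinuousOn f (Icc 0 L) :=
  continuousOn_of_eq_integral hL (h.intervalIntegrable hL) h.eq_integral

theorem memLp_two (h : HasWeakDeriv L f f') (hL : 0 ≤ L) :
    MemLp f 2 (volume.restrict (Ioo (0 : ℝ) L)) :=
  (h.continuousOn hL).memLp_two_Ioo

theorem integral_eq_sub (h : HasWeakDeriv L f f') (hL : 0 ≤ L) :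
    ∫ x in (0 : ℝ)..L, f' x = f L - f 0 := by
  rw [h.eq_integral L ⟨hL, le_rfl⟩]; ring

theorem integral_mul_add_mul (hf : HasWeakDeriv L f f') (hg : HasWeakDeriv L g g') (hL : 0 ≤ L) :
    ∫ x in (0 : ℝ)..L, (f' x * g x + f x * g' x) = f L * g L - f 0 * g 0 :=
  integral_mul_add_mul_of_eq_integral hL (hf.intervalIntegrable hL) (hg.intervalIntegrable hL)
    hf.eq_integral hg.eq_integral

theorem lincomb (hf : HasWeakDeriv L f f') (hg : HasWeakDeriv L g g') (r s : ℝ) :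
    HasWeakDeriv L (fun x => r * f x + s * g x) (fun x => r * f' x + s * g' x) := by
  refine ⟨(hf.memLp.const_mul r).add (hg.memLp.const_mul s), fun x hx => ?_⟩
  have h0 : (0 : ℝ) ∈ Icc 0 L := ⟨le_rfl, hx.1.trans hx.2⟩
  rw [intervalIntegral.integral_add, intervalIntegral.integral_const_mul,
    intervalIntegral.integral_const_mul, hf.eq_integral x hx, hg.eq_integral x hx]
  · ring
  · exact (hf.memLp.intervalIntegrable_of_two h0 hx).const_mul r
  · exact (hg.memLp.intervalIntegrable_of_two h0 hx).const_mul s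

theorem of_eqOn (hf : HasWeakDeriv L f f') (hfg : EqOn g f (Icc 0 L)) : HasWeakDeriv L g f' := by
  refine ⟨hf.memLp, fun x hx => ?_⟩
  rw [hfg hx, hfg ⟨le_rfl, hx.1.trans hx.2⟩, hf.eq_integral x hx]

theorem of_ae_eq (hf : HasWeakDeriv L f f') (hfg : g' =ᵐ[volume.restrict (Ioo (0 : ℝ) L)] f') :
    HasWeakDeriv L f g' := by
  refine ⟨hf.memLp.ae_eq hfg.symm, fun x hx => ?_⟩
  rw [intervalIntegral_congr_of_ae hfg ⟨le_rfl, hx.1.trans hx.2⟩ hx, ← hf.eq_integral x hx]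

end HasWeakDeriv

theorem hasWeakDeriv_integral {g : ℝ → ℝ} (hg : MemLp g 2 (volume.restrict (Ioo (0 : ℝ) L)))
    (r : ℝ) : HasWeakDeriv L (fun x => r + ∫ s in (0 : ℝ)..x, g s) g :=
  ⟨hg, fun x _ => by simp⟩

theorem hasWeakDeriv_mul_const (r : ℝ) : HasWeakDeriv L (fun x => x * r) (fun _ => r) :=
  ⟨memLp_const r, fun x _ => by simp⟩

theorem IsDirichletH2.lincomb {f f' f'' g g' g'' : ℝ → ℝ} (hf : IsDirichletH2 L f f' f'')
    (hg : IsDirichletH2 L g g' g'') (r s : ℝ) :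
    IsDirichletH2 L (fun x => r * f x + s * g x) (fun x => r * f' x + s * g' x)
      (fun x => r * f'' x + s * g'' x) :=
  ⟨hf.deriv_one.lincomb hg.deriv_one r s, hf.deriv_two.lincomb hg.deriv_two r s,
    by simp [hf.left, hg.left], by simp [hf.right, hg.right]⟩

/-- A continuous function on `[0,L]` that vanishes almost everywhere vanishes. -/
theorem eqOn_zero_of_ae (hL : 0 < L) {f : ℝ → ℝ} (hf : ContinuousOn f (Icc 0 L))
    (h : ∀ᵐ x ∂(volume.restrict (Ioo (0 : ℝ) L)), f x = 0) : ∀ x ∈ Icc 0 L, f x = 0 := by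
  have h' : f =ᵐ[volume.restrict (Icc (0 : ℝ) L)] fun _ => (0 : ℝ) := by
    rw [← restrict_Ioo_eq_restrict_Icc]; exact h
  exact Measure.eqOn_Icc_of_ae_eq volume hL.ne h' hf continuousOn_const

/-- An integrable function on `(0,L)` all of whose integrals `∫₀ˣ` vanish is zero. -/
theorem ae_eq_zero_of_integral_eq_zero (hL : 0 ≤ L) {g : ℝ → ℝ}
    (hg : MemLp g 2 (volume.restrict (Ioo (0 : ℝ) L)))
    (h : ∀ x ∈ Icc 0 L, ∫ s in (0 : ℝ)..x, g s = 0) :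
    ∀ᵐ x ∂(volume.restrict (Ioo (0 : ℝ) L)), g x = 0 := by
  have hi := hg.intervalIntegrable_of_two (left_mem_Icc.2 hL) (right_mem_Icc.2 hL)
  rw [ae_restrict_iff' measurableSet_Ioo]
  filter_upwards [hi.ae_hasDerivAt_integral] with x hx hxm
  have hxI : x ∈ uIcc 0 L := by rw [uIcc_of_le hL]; exact Ioo_subset_Icc_self hxm
  have h1 := hx hxI 0 left_mem_uIcc
  have h2 : HasDerivAt (fun x => ∫ s in (0 : ℝ)..x, g s) 0 x := by
    refine (hasDerivAt_const x (0 : ℝ)).congr_of_eventuallyEq ?_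
    filter_upwards [Ioo_mem_nhds hxm.1 hxm.2] with y hy
    exact h y (Ioo_subset_Icc_self hy)
  exact h1.unique h2

/-! ### Primitives as a compact operator on `L²(0,L)` -/

theorem L2_memLp (g : L2 L) : MemLp g 2 (volume.restrict (Ioo (0 : ℝ) L)) := Lp.memLp g

theorem integral_eq_inner_indicator {x y : ℝ} (hx : 0 ≤ x) (hxy : x ≤ y) (hy : y ≤ L) (g : L2 L) :
    ∫ s in x..y, g s = inner ℝ (indicatorConstLp 2 (measurableSet_Ioo (a := x) (b := y))
      (measure_ne_top (volume.restrict (Ioo (0 : ℝ) L)) _) (1 : ℝ)) g := by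
  rw [MeasureTheory.L2.inner_indicatorConstLp_one, Measure.restrict_restrict measurableSet_Ioo,
    inter_eq_left.2 (Ioo_subset_Ioo hx hy), intervalIntegral.integral_of_le hxy,
    integral_Ioc_eq_integral_Ioo]

theorem abs_integral_le_sqrt_mul_norm {x y : ℝ} (hx : 0 ≤ x) (hxy : x ≤ y) (hy : y ≤ L)
    (g : L2 L) : |∫ s in x..y, g s| ≤ Real.sqrt (y - x) * ‖g‖ := by
  rw [integral_eq_inner_indicator hx hxy hy]
  refine (abs_real_inner_le_norm _ _).trans (mul_le_mul_of_nonneg_right ?_ (norm_nonneg _))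
  rw [norm_indicatorConstLp (by norm_num) (by norm_num)]
  have : (volume.restrict (Ioo (0 : ℝ) L)).real (Ioo x y) = y - x := by
    rw [measureReal_restrict_apply measurableSet_Ioo, inter_eq_left.2 (Ioo_subset_Ioo hx hy)]
    simp [hxy]
  rw [this, Real.sqrt_eq_rpow]
  simp

theorem L2_norm_le_of_ae_bound (hL : 0 ≤ L) {F : L2 L} {C : ℝ} (hC : 0 ≤ C)
    (h : ∀ᵐ x ∂(volume.restrict (Ioo (0 : ℝ) L)), |F x| ≤ C) : ‖F‖ ≤ Real.sqrt L * C := by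
  have := Lp.norm_le_of_ae_bound (f := F) hC (by simpa only [Real.norm_eq_abs] using h)
  have h2 : (measureUnivNNReal (volume.restrict (Ioo (0 : ℝ) L)) : ℝ) = L := by
    simp only [measureUnivNNReal, Measure.restrict_apply MeasurableSet.univ, univ_inter,
      Real.volume_Ioo, sub_zero]
    exact ENNReal.toReal_ofReal hL
  refine this.trans (le_of_eq ?_)
  rw [h2, Real.sqrt_eq_rpow]
  simp

theorem memLp_integral (g : L2 L) (hL : 0 ≤ L) :
    MemLp (fun x => ∫ s in (0 : ℝ)..x, g s) 2 (volume.restrict (Ioo (0 : ℝ) L)) := by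
  have := (hasWeakDeriv_integral (L2_memLp g) 0).memLp_two hL
  simpa using this

theorem intervalIntegral_L2_add (f g : L2 L) {x y : ℝ} (hx : x ∈ Icc 0 L) (hy : y ∈ Icc 0 L) :
    ∫ s in x..y, (f + g : L2 L) s = (∫ s in x..y, f s) + ∫ s in x..y, g s := by
  rw [intervalIntegral_congr_of_ae (Lp.coeFn_add f g) hx hy]
  exact intervalIntegral.integral_add ((L2_memLp f).intervalIntegrable_of_two hx hy)
    ((L2_memLp g).intervalIntegrable_of_two hx hy)

theorem intervalIntegral_L2_smul (r : ℝ) (f : L2 L) {x y : ℝ} (hx : x ∈ Icc 0 L)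
    (hy : y ∈ Icc 0 L) : ∫ s in x..y, (r • f : L2 L) s = r * ∫ s in x..y, f s := by
  rw [intervalIntegral_congr_of_ae (Lp.coeFn_smul r f) hx hy, ← intervalIntegral.integral_const_mul]
  rfl

/-- The Volterra operator `g ↦ ∫₀ˣ g` on `L²(0,L)`. -/
noncomputable def volterra (hL : 0 ≤ L) : L2 L →L[ℝ] L2 L :=
  LinearMap.mkContinuous
    { toFun := fun g => (memLp_integral g hL).toLp _
      map_add' := fun f g => by
        rw [← MemLp.toLp_add]
        refine MemLp.toLp_congr _ _ ?_
        filter_upwards [ae_restrict_mem measurableSet_Ioo] with x hx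
        exact intervalIntegral_L2_add f g ⟨le_rfl, hL⟩ (Ioo_subset_Icc_self hx)
      map_smul' := fun r f => by
        rw [← MemLp.toLp_const_smul]
        refine MemLp.toLp_congr _ _ ?_
        filter_upwards [ae_restrict_mem measurableSet_Ioo] with x hx
        exact intervalIntegral_L2_smul r f ⟨le_rfl, hL⟩ (Ioo_subset_Icc_self hx) }
    L fun g => by
      have : ‖(memLp_integral g hL).toLp _‖ ≤ Real.sqrt L * (Real.sqrt L * ‖g‖) := by
        apply L2_norm_le_of_ae_bound hL (by positivity)
        filter_upwards [(memLp_integral g hL).coeFn_toLp, ae_restrict_mem measurableSet_Ioo]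
          with x hx hxm
        rw [hx]
        refine (abs_integral_le_sqrt_mul_norm le_rfl hxm.1.le hxm.2.le g).trans ?_
        gcongr
        linarith [hxm.2]
      rwa [← mul_assoc, Real.mul_self_sqrt hL] at this

theorem coeFn_volterra (hL : 0 ≤ L) (g : L2 L) :
    volterra hL g =ᵐ[volume.restrict (Ioo (0 : ℝ) L)] fun x => ∫ s in (0 : ℝ)..x, g s :=
  (memLp_integral g hL).coeFn_toLp

theorem isCompactOperator_smulRight {E F : Type*} [NormedAddCommGroup E] [NormedSpace ℝ E]
    [NormedAddCommGroup F] [NormedSpace ℝ F] (l : E →L[ℝ] ℝ) (v : F) :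
    IsCompactOperator (l.smulRight v) := by
  have h1 : IsCompactOperator (l : E → ℝ) :=
    isCompactOperator_of_locallyCompactSpace_dom l
  exact h1.clm_comp (ContinuousLinearMap.toSpanSingleton ℝ v)

/-- The Volterra operator composed with sampling on a grid of `N` intervals of equal length: a
finite-rank approximation of the Volterra operator. -/
noncomputable def stepVolterra (L : ℝ) (N : ℕ) : L2 L →L[ℝ] L2 L :=
  ∑ k ∈ Finset.range N,
    (innerSL ℝ (indicatorConstLp 2 (measurableSet_Ioo (a := 0) (b := k * (L / N)))
      (measure_ne_top (volume.restrict (Ioo (0 : ℝ) L)) _) (1 : ℝ))).smulRight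
    (indicatorConstLp 2 (measurableSet_Ico (a := k * (L / N)) (b := (k + 1) * (L / N)))
      (measure_ne_top (volume.restrict (Ioo (0 : ℝ) L)) _) (1 : ℝ))

theorem isCompactOperator_stepVolterra (L : ℝ) (N : ℕ) :
    IsCompactOperator (stepVolterra L N) := by
  unfold stepVolterra
  induction Finset.range N using Finset.induction_on with
  | empty => simpa using isCompactOperator_zero
  | insert a s ha ih =>
    rw [Finset.sum_insert ha]
    exact (isCompactOperator_smulRight _ _).add ih

theorem coeFn_finset_sum_L2 {ι : Type*} (s : Finset ι) (f : ι → L2 L) :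
    (∑ k ∈ s, f k : L2 L) =ᵐ[volume.restrict (Ioo (0 : ℝ) L)] fun x => ∑ k ∈ s, f k x := by
  classical
  induction s using Finset.induction_on with
  | empty =>
    simp only [Finset.sum_empty]
    exact Lp.coeFn_zero ℝ 2 (volume.restrict (Ioo (0 : ℝ) L))
  | insert a s ha ih =>
    rw [Finset.sum_insert ha]
    filter_upwards [ih, Lp.coeFn_add (f a) (∑ k ∈ s, f k)] with x h1 h2
    rw [h2, Finset.sum_insert ha, Pi.add_apply, h1]

theorem norm_volterra_sub_stepVolterra_le (hL : 0 < L) {N : ℕ} (hN : 0 < N) :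
    ‖volterra hL.le - stepVolterra L N‖ ≤ Real.sqrt L * Real.sqrt (L / N) := by
  have hN' : (0 : ℝ) < N := by exact_mod_cast hN
  have hd : 0 < L / N := by positivity
  refine ContinuousLinearMap.opNorm_le_bound _ (by positivity) fun g => ?_
  rw [mul_assoc]
  refine L2_norm_le_of_ae_bound hL.le (by positivity) ?_
  have hstep : (stepVolterra L N g : L2 L) =ᵐ[volume.restrict (Ioo (0 : ℝ) L)]
      fun x => ∑ k ∈ Finset.range N, (∫ s in (0 : ℝ)..(k * (L / N)), g s) *
        (Ico (k * (L / N)) ((k + 1) * (L / N))).indicator (fun _ => (1 : ℝ)) x := by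
    have h1 : stepVolterra L N g = ∑ k ∈ Finset.range N, (∫ s in (0 : ℝ)..(k * (L / N)), g s) •
        indicatorConstLp 2 (measurableSet_Ico (a := k * (L / N)) (b := (k + 1) * (L / N)))
        (measure_ne_top (volume.restrict (Ioo (0 : ℝ) L)) _) (1 : ℝ) := by
      simp only [stepVolterra, _root_.sum_apply, ContinuousLinearMap.smulRight_apply,
        innerSL_apply_apply]
      refine Finset.sum_congr rfl fun k hk => ?_
      rw [integral_eq_inner_indicator le_rfl (by positivity)]
      have : (k : ℝ) ≤ N := by exact_mod_cast (Finset.mem_range.1 hk).le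
      calc (k : ℝ) * (L / N) ≤ N * (L / N) := by gcongr
        _ = L := by field_simp
    rw [h1]
    refine (coeFn_finset_sum_L2 _ _).trans ?_
    have h2 : ∀ᵐ x ∂(volume.restrict (Ioo (0 : ℝ) L)), ∀ k : ℕ,
        (((∫ s in (0 : ℝ)..(k * (L / N)), g s) •
        indicatorConstLp 2 (measurableSet_Ico (a := k * (L / N)) (b := (k + 1) * (L / N)))
        (measure_ne_top (volume.restrict (Ioo (0 : ℝ) L)) _) (1 : ℝ) : L2 L) x) =
        (∫ s in (0 : ℝ)..(k * (L / N)), g s) *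
        (Ico (k * (L / N)) ((k + 1) * (L / N))).indicator (fun _ => (1 : ℝ)) x := by
      rw [ae_all_iff]
      intro k
      filter_upwards [Lp.coeFn_smul (∫ s in (0 : ℝ)..(k * (L / N)), g s) (indicatorConstLp 2
        (measurableSet_Ico (a := k * (L / N)) (b := (k + 1) * (L / N)))
        (measure_ne_top (volume.restrict (Ioo (0 : ℝ) L)) _) (1 : ℝ)),
        indicatorConstLp_coeFn (p := 2) (hs := measurableSet_Ico (a := k * (L / N))
          (b := (k + 1) * (L / N)))
        (hμs := measure_ne_top (volume.restrict (Ioo (0 : ℝ) L)) _) (c := (1 : ℝ))] with x h3 h4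
      rw [h3, Pi.smul_apply, h4, smul_eq_mul]
    filter_upwards [h2] with x hx
    exact Finset.sum_congr rfl fun k _ => hx k
  rw [_root_.sub_apply]
  filter_upwards [Lp.coeFn_sub (volterra hL.le g) (stepVolterra L N g), hstep,
    coeFn_volterra hL.le g, ae_restrict_mem measurableSet_Ioo] with x h1 h2 h3 hx
  rw [h1, Pi.sub_apply, h2, h3]
  -- `m` is the index of the grid interval that contains `x`.
  set m := ⌊x / (L / N)⌋₊ with hm
  have hx0 : 0 ≤ x / (L / N) := div_nonneg hx.1.le hd.le
  have hm1 : (m : ℝ) * (L / N) ≤ x := by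
    rw [← le_div_iff₀ hd]; exact Nat.floor_le hx0
  have hm2 : x < (m + 1) * (L / N) := by
    rw [← div_lt_iff₀ hd]; exact Nat.lt_floor_add_one _
  have hmN : m < N := by
    rw [hm, Nat.floor_lt hx0, div_lt_iff₀ hd]
    calc x < L := hx.2
      _ = N * (L / N) := by field_simp
  rw [Finset.sum_eq_single_of_mem m (Finset.mem_range.2 hmN)]
  · rw [indicator_of_mem (show x ∈ Ico _ _ from ⟨hm1, hm2⟩), mul_one]
    have hmem : (m : ℝ) * (L / N) ∈ Icc 0 L := ⟨by positivity, hm1.trans hx.2.le⟩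
    have hsub := intervalIntegral.integral_interval_sub_left
      ((L2_memLp g).intervalIntegrable_of_two ⟨le_rfl, hL.le⟩ (Ioo_subset_Icc_self hx))
      ((L2_memLp g).intervalIntegrable_of_two ⟨le_rfl, hL.le⟩ hmem)
    rw [hsub]
    refine (abs_integral_le_sqrt_mul_norm hmem.1 hm1 hx.2.le g).trans ?_
    gcongr
    linarith
  · intro k _ hkm
    rw [indicator_of_notMem, mul_zero]
    rintro ⟨hk1, hk2⟩
    apply hkm
    rw [hm, eq_comm, Nat.floor_eq_iff hx0, le_div_iff₀ hd, div_lt_iff₀ hd]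
    exact ⟨hk1, hk2⟩

/-- The Volterra operator is a limit in operator norm of operators of finite rank. -/
theorem isCompactOperator_volterra (hL : 0 < L) : IsCompactOperator (volterra hL.le) := by
  refine isCompactOperator_of_tendsto (l := atTop) (F := fun N : ℕ => stepVolterra L N) ?_
    (Eventually.of_forall fun N => isCompactOperator_stepVolterra L N)
  rw [tendsto_iff_norm_sub_tendsto_zero]
  have h1 : Tendsto (fun N : ℕ => Real.sqrt L * Real.sqrt (L / N)) atTop (𝓝 0) := by
    have : Tendsto (fun N : ℕ => L / (N : ℝ)) atTop (𝓝 0) :=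
      tendsto_const_div_atTop_nhds_zero_nat L
    have h2 := ((Real.continuous_sqrt.tendsto 0).comp this).const_mul (Real.sqrt L)
    simpa using h2
  refine squeeze_zero' (Eventually.of_forall fun _ => norm_nonneg _) ?_ h1
  filter_upwards [eventually_gt_atTop 0] with N hN
  rw [norm_sub_rev]
  exact norm_volterra_sub_stepVolterra_le hL hN

/-! ### The parametrization of `H¹₀(0,L)` by `L²(0,L)` -/

/-- The function `x/L` as an element of `L²(0,L)`. -/
noncomputable def xiL (L : ℝ) : L2 L :=
  MemLp.toLp (fun x => x / L) (ContinuousOn.memLp_two_Ioo (continuousOn_id.div_const L))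

theorem coeFn_xiL (L : ℝ) : xiL L =ᵐ[volume.restrict (Ioo (0 : ℝ) L)] fun x => x / L :=
  MemLp.coeFn_toLp _

/-- The operator `g ↦ ∫₀ˣ g - (x/L) ∫₀ᴸ g`. Its range is `H¹₀(0,L)`, and the weak derivative of its
value at `g` is `g` minus the mean of `g`. -/
noncomputable def dirichletPrimitive (hL : 0 ≤ L) : L2 L →L[ℝ] L2 L :=
  volterra hL - (innerSL ℝ (indicatorConstLp 2 (measurableSet_Ioo (a := 0) (b := L))
      (measure_ne_top (volume.restrict (Ioo (0 : ℝ) L)) _) (1 : ℝ))).smulRight (xiL L)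

theorem isCompactOperator_dirichletPrimitive (hL : 0 < L) :
    IsCompactOperator (dirichletPrimitive hL.le) :=
  (isCompactOperator_volterra hL).sub (isCompactOperator_smulRight _ _)

theorem coeFn_dirichletPrimitive (hL : 0 ≤ L) (g : L2 L) :
    dirichletPrimitive hL g =ᵐ[volume.restrict (Ioo (0 : ℝ) L)]
      fun x => (∫ s in (0 : ℝ)..x, g s) - (∫ s in (0 : ℝ)..L, g s) * (x / L) := by
  have h0 : dirichletPrimitive hL g = volterra hL g - (∫ s in (0 : ℝ)..L, g s) • xiL L := by
    simp only [dirichletPrimitive, _root_.sub_apply,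
      ContinuousLinearMap.smulRight_apply, innerSL_apply_apply]
    rw [integral_eq_inner_indicator le_rfl hL le_rfl]
  rw [h0]
  filter_upwards [Lp.coeFn_sub (volterra hL g) ((∫ s in (0 : ℝ)..L, g s) • xiL L),
    coeFn_volterra hL g, coeFn_xiL L, Lp.coeFn_smul (∫ s in (0 : ℝ)..L, g s) (xiL L)]
    with x h1 h2 h3 h4
  rw [h1, Pi.sub_apply, h2, h4, Pi.smul_apply, h3, smul_eq_mul]

/-- The weak derivative of a value of `dirichletPrimitive`. -/
theorem hasWeakDeriv_dirichletPrimitive (g : L2 L) :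
    HasWeakDeriv L (fun x => (∫ s in (0 : ℝ)..x, g s) - (∫ s in (0 : ℝ)..L, g s) * (x / L))
      (fun x => g x - (∫ s in (0 : ℝ)..L, g s) * (1 / L)) := by
  have := (hasWeakDeriv_integral (L2_memLp g) 0).lincomb (hasWeakDeriv_mul_const (L := L) (1 / L))
    1 (-(∫ s in (0 : ℝ)..L, g s))
  refine (this.of_eqOn fun x _ => ?_).of_ae_eq (Eventually.of_forall fun x => ?_)
  · ring
  · ring

/-- An element of `H¹₀(0,L)` is the `dirichletPrimitive` of its weak derivative. -/
theorem dirichletPrimitive_eq (hL : 0 < L) {φ φ' : ℝ → ℝ} (h : HasWeakDeriv L φ φ') (h0 : φ 0 = 0)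
    (h1 : φ L = 0) {Φ G : L2 L} (hΦ : Φ =ᵐ[volume.restrict (Ioo (0 : ℝ) L)] φ)
    (hG : G =ᵐ[volume.restrict (Ioo (0 : ℝ) L)] φ') : dirichletPrimitive hL.le G = Φ := by
  apply Lp.ext
  filter_upwards [coeFn_dirichletPrimitive hL.le G, hΦ, ae_restrict_mem measurableSet_Ioo]
    with x h2 h3 hx
  have hx' := Ioo_subset_Icc_self hx
  have h0L : (0 : ℝ) ∈ Icc 0 L := ⟨le_rfl, hL.le⟩
  have hLL : L ∈ Icc 0 L := ⟨hL.le, le_rfl⟩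
  rw [h2, h3, intervalIntegral_congr_of_ae hG h0L hx', intervalIntegral_congr_of_ae hG h0L hLL,
    h.integral_eq_sub hL.le, h.eq_integral x hx', h0, h1]
  ring

/-- The Dirichlet problem `φ'' = f`, read through the adjoint of `dirichletPrimitive`: the weak
derivative of a solution is the image of `-f`. -/
theorem adjoint_dirichletPrimitive_neg (hL : 0 < L) {φ φ' φ'' : ℝ → ℝ}
    (h : IsDirichletH2 L φ φ' φ'') {G F : L2 L}
    (hG : G =ᵐ[volume.restrict (Ioo (0 : ℝ) L)] φ')
    (hF : F =ᵐ[volume.restrict (Ioo (0 : ℝ) L)] φ'') :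
    ContinuousLinearMap.adjoint (dirichletPrimitive hL.le) (-F) = G := by
  refine ext_inner_right ℝ fun k => ?_
  have hw := hasWeakDeriv_dirichletPrimitive k
  rw [ContinuousLinearMap.adjoint_inner_left, inner_neg_left,
    L2_inner_eq hL.le hF (coeFn_dirichletPrimitive hL.le k), L2_inner_eq hL.le hG ae_eq_rfl]
  have hibp := h.deriv_two.integral_mul_add_mul hw hL.le
  rw [intervalIntegral.integral_same, intervalIntegral.integral_add] at hibp
  · have h3 : ∫ x in (0 : ℝ)..L, φ' x * (k x - (∫ s in (0 : ℝ)..L, k s) * (1 / L)) =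
        ∫ x in (0 : ℝ)..L, φ' x * k x := by
      have : ∀ x, φ' x * (k x - (∫ s in (0 : ℝ)..L, k s) * (1 / L)) =
          φ' x * k x - φ' x * ((∫ s in (0 : ℝ)..L, k s) * (1 / L)) := fun x => by ring
      simp only [this]
      rw [intervalIntegral.integral_sub, intervalIntegral.integral_mul_const,
        h.deriv_one.integral_eq_sub hL.le, h.left, h.right]
      · simp
      · exact ((L2_memLp k).intervalIntegrable_of_two ⟨le_rfl, hL.le⟩
          ⟨hL.le, le_rfl⟩).continuousOn_mul (by
            rw [uIcc_of_le hL.le]; exact h.deriv_two.continuousOn hL.le)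
      · exact (h.deriv_one.intervalIntegrable hL.le).mul_const _
    rw [h3] at hibp
    have hz : (∫ s in (0 : ℝ)..L, k s) - (∫ s in (0 : ℝ)..L, k s) * (L / L) = 0 := by
      rw [div_self hL.ne']; ring
    rw [hz] at hibp
    simp only [zero_div, mul_zero, sub_zero] at hibp
    linarith
  · exact (h.deriv_two.intervalIntegrable hL.le).mul_continuousOn (by
      rw [uIcc_of_le hL.le]; exact hw.continuousOn hL.le)
  · exact (hw.intervalIntegrable hL.le).continuousOn_mul (by
      rw [uIcc_of_le hL.le]; exact h.deriv_two.continuousOn hL.le)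

/-- Solvability of the Dirichlet problem `φ'' = f`. -/
theorem exists_isDirichletH2 (hL : 0 < L) {f : ℝ → ℝ}
    (hf : MemLp f 2 (volume.restrict (Ioo (0 : ℝ) L))) :
    ∃ φ φ' : ℝ → ℝ, IsDirichletH2 L φ φ' f := by
  have h1 := hasWeakDeriv_integral hf 0
  set p : ℝ → ℝ := fun x => 0 + ∫ s in (0 : ℝ)..x, f s
  set r : ℝ := -((∫ s in (0 : ℝ)..L, p s) / L) with hr
  have h2 : HasWeakDeriv L (fun x => r + ∫ s in (0 : ℝ)..x, f s) f := hasWeakDeriv_integral hf r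
  have h3 := hasWeakDeriv_integral (h2.memLp_two hL.le) 0
  refine ⟨_, _, h3, h2, by simp, ?_⟩
  have h4 : ∀ s, r + ∫ s in (0 : ℝ)..s, f s = r + p s := fun s => by simp [p]
  simp only [h4]
  rw [intervalIntegral.integral_add (by simp)
    ((h1.memLp_two hL.le).intervalIntegrable_of_two ⟨le_rfl, hL.le⟩ ⟨hL.le, le_rfl⟩)]
  simp only [intervalIntegral.integral_const, sub_zero, smul_eq_mul, hr]
  field_simp
  ring

/-! ### The resolvent of `A` -/

/-- Multiplication by a bounded function on `L²(0,L)`. -/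
noncomputable def mulOp {q : ℝ → ℝ} (hq : MemLp q ⊤ (volume.restrict (Ioo (0 : ℝ) L))) :
    L2 L →L[ℝ] L2 L :=
  (ContinuousLinearMap.lsmul ℝ ℝ).holderL (volume.restrict (Ioo (0 : ℝ) L)) ⊤ 2 2 (hq.toLp q)

theorem coeFn_mulOp {q : ℝ → ℝ} (hq : MemLp q ⊤ (volume.restrict (Ioo (0 : ℝ) L))) (g : L2 L) :
    mulOp hq g =ᵐ[volume.restrict (Ioo (0 : ℝ) L)] fun x => q x * g x := by
  have h := (ContinuousLinearMap.lsmul ℝ ℝ).coeFn_holder (r := 2) (hq.toLp q) g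
  filter_upwards [h, hq.coeFn_toLp] with x h1 h2
  refine h1.trans ?_
  simp [h2]

theorem inner_mulOp_left (hL : 0 ≤ L) {q : ℝ → ℝ}
    (hq : MemLp q ⊤ (volume.restrict (Ioo (0 : ℝ) L))) (f g : L2 L) :
    inner ℝ (mulOp hq f) g = inner ℝ f (mulOp hq g) := by
  rw [L2_inner_eq hL (coeFn_mulOp hq f) ae_eq_rfl, L2_inner_eq hL ae_eq_rfl (coeFn_mulOp hq g)]
  congr 1; ext x; ring

/-- A constant `κ` with `κ - c ≥ 1`. -/
noncomputable def shift (L : ℝ) (c : ℝ → ℝ) : ℝ :=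
  (eLpNorm c ⊤ (volume.restrict (Ioo (0 : ℝ) L))).toReal + 1

theorem ae_abs_le_shift {c : ℝ → ℝ} (hc : MemLp c ⊤ (volume.restrict (Ioo (0 : ℝ) L))) :
     ∀ᵐ x ∂(volume.restrict (Ioo (0 : ℝ) L)), |c x| ≤ shift L c - 1 := by
  have h := ae_le_eLpNormEssSup (f := c) (μ := volume.restrict (Ioo (0 : ℝ) L))
  rw [← eLpNorm_exponent_top] at h
  filter_upwards [h] with x hx
  have h2 := ENNReal.toReal_mono hc.2.ne hx
  simpa [shift] using h2

theorem memLp_shift_sub {c : ℝ → ℝ} (hc : MemLp c ⊤ (volume.restrict (Ioo (0 : ℝ) L))) :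
     MemLp (fun x => shift L c - c x) ⊤ (volume.restrict (Ioo (0 : ℝ) L)) :=
  (memLp_const _).sub hc

section Resolvent

variable {c : ℝ → ℝ} (hL : 0 < L) (hc : MemLp c ⊤ (volume.restrict (Ioo (0 : ℝ) L)))

/-- Multiplication by `κ - c`. -/
noncomputable def potOp : L2 L →L[ℝ] L2 L := mulOp (memLp_shift_sub hc)

theorem coeFn_potOp (g : L2 L) :
    potOp hc g =ᵐ[volume.restrict (Ioo (0 : ℝ) L)] fun x => (shift L c - c x) * g x :=
  coeFn_mulOp _ g

theorem norm_sq_le_inner_potOp (g : L2 L) : ‖g‖ ^ 2 ≤ inner ℝ (potOp hc g) g := by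
  rw [← real_inner_self_eq_norm_sq, MeasureTheory.L2.inner_def, MeasureTheory.L2.inner_def]
  refine integral_mono_ae (MeasureTheory.L2.integrable_inner _ _)
    (MeasureTheory.L2.integrable_inner _ _) ?_
  filter_upwards [coeFn_potOp hc g, ae_abs_le_shift hc] with x h1 h2
  simp only [RCLike.inner_apply, conj_trivial]
  have h3 := (abs_le.1 h2).2
  rw [h1]
  nlinarith [mul_self_nonneg (g x)]

/-- The bounded form of `κ - A` on derivatives: for `φ = dirichletPrimitive g`, the quadratic form
`⟪formOp g, g⟫ = ∫ g² + ∫ (κ - c) φ²` is the energy of `φ` when `g = φ'`. -/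
noncomputable def formOp : L2 L →L[ℝ] L2 L :=
  1 + (ContinuousLinearMap.adjoint (dirichletPrimitive hL.le)) ∘L potOp hc ∘L
    dirichletPrimitive hL.le

theorem inner_formOp (g k : L2 L) : inner ℝ (formOp hL hc g) k =
    inner ℝ g k + inner ℝ (potOp hc (dirichletPrimitive hL.le g)) (dirichletPrimitive hL.le k) := by
  simp [formOp, inner_add_left, ContinuousLinearMap.adjoint_inner_left]

theorem inner_formOp_comm (g k : L2 L) :
    inner ℝ (formOp hL hc g) k = inner ℝ g (formOp hL hc k) := by
  rw [real_inner_comm (formOp hL hc k) g, inner_formOp, inner_formOp, potOp,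
    inner_mulOp_left hL.le, real_inner_comm, real_inner_comm
    (mulOp _ ((dirichletPrimitive hL.le) k))]

theorem norm_sq_add_norm_sq_le_inner_formOp (g : L2 L) :
    ‖g‖ ^ 2 + ‖dirichletPrimitive hL.le g‖ ^ 2 ≤ inner ℝ (formOp hL hc g) g := by
  rw [inner_formOp, real_inner_self_eq_norm_sq]
  linarith [norm_sq_le_inner_potOp hc (dirichletPrimitive hL.le g)]

/-- Invertibility of `formOp`, by coercivity. -/
theorem isUnit_formOp : IsUnit (formOp hL hc) := by
  refine ContinuousLinearMap.isUnit_of_forall_le_norm_inner_map _ (c := 1) one_pos fun g => ?_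
  have h := norm_sq_add_norm_sq_le_inner_formOp hL hc g
  rw [Real.norm_eq_abs]
  have := le_abs_self (inner ℝ (formOp hL hc g) g)
  simp only [NNReal.coe_one, mul_one]
  nlinarith [sq_nonneg ‖dirichletPrimitive hL.le g‖]

/-- The resolvent `(κ - A)⁻¹`. -/
noncomputable def resolventOp : L2 L →L[ℝ] L2 L :=
  dirichletPrimitive hL.le ∘L (Ring.inverse (formOp hL hc)) ∘L
    ContinuousLinearMap.adjoint (dirichletPrimitive hL.le)

theorem formOp_inverse_apply (g : L2 L) : formOp hL hc (Ring.inverse (formOp hL hc) g) = g := by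
  have := Ring.mul_inverse_cancel _ (isUnit_formOp hL hc)
  exact congrArg (fun S : L2 L →L[ℝ] L2 L => S g) this

theorem inverse_formOp_apply (g : L2 L) : Ring.inverse (formOp hL hc) (formOp hL hc g) = g := by
  have := Ring.inverse_mul_cancel _ (isUnit_formOp hL hc)
  exact congrArg (fun S : L2 L →L[ℝ] L2 L => S g) this

theorem inner_resolventOp (f k : L2 L) : inner ℝ (resolventOp hL hc f) k =
    inner ℝ (Ring.inverse (formOp hL hc) (ContinuousLinearMap.adjoint (dirichletPrimitive hL.le) f))
      (ContinuousLinearMap.adjoint (dirichletPrimitive hL.le) k) := by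
  simp [resolventOp, ContinuousLinearMap.adjoint_inner_right]

theorem isSymmetric_resolventOp : (resolventOp hL hc).IsSymmetric := by
  intro f k
  have h1 := inner_resolventOp hL hc f k
  have h2 := inner_resolventOp hL hc k f
  simp only [ContinuousLinearMap.coe_coe]
  rw [real_inner_comm (resolventOp hL hc k) f, h1, h2]
  set u := ContinuousLinearMap.adjoint (dirichletPrimitive hL.le) f
  set v := ContinuousLinearMap.adjoint (dirichletPrimitive hL.le) k
  rw [← formOp_inverse_apply hL hc v, inverse_formOp_apply, ← inner_formOp_comm,
    formOp_inverse_apply, real_inner_comm]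

theorem inner_resolventOp_self_nonneg (f : L2 L) : 0 ≤ inner ℝ (resolventOp hL hc f) f := by
  rw [inner_resolventOp]
  set u := ContinuousLinearMap.adjoint (dirichletPrimitive hL.le) f
  have h := norm_sq_add_norm_sq_le_inner_formOp hL hc (Ring.inverse (formOp hL hc) u)
  rw [formOp_inverse_apply, real_inner_comm] at h
  exact le_trans (by positivity) h

theorem isCompactOperator_resolventOp : IsCompactOperator (resolventOp hL hc) :=
  (isCompactOperator_dirichletPrimitive hL).comp_clm _

/-- A solution of `(κ - A) φ = f` is the resolvent of `f`. -/
theorem resolventOp_eq {φ φ' φ'' : ℝ → ℝ} (h : IsDirichletH2 L φ φ' φ'') {f Φ : L2 L}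
    (hΦ : Φ =ᵐ[volume.restrict (Ioo (0 : ℝ) L)] φ)
    (hf : ∀ᵐ x ∂(volume.restrict (Ioo (0 : ℝ) L)), φ'' x = (shift L c - c x) * φ x - f x) :
    resolventOp hL hc f = Φ := by
  have hG := (h.deriv_one.memLp).coeFn_toLp
  set G := h.deriv_one.memLp.toLp φ'
  have hJ := dirichletPrimitive_eq hL h.deriv_one h.left h.right hΦ hG
  have hF : (potOp hc Φ - f : L2 L) =ᵐ[volume.restrict (Ioo (0 : ℝ) L)] φ'' := by
    filter_upwards [Lp.coeFn_sub (potOp hc Φ) f, coeFn_potOp hc Φ, hΦ, hf] with x h1 h2 h3 h4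
    rw [h1, Pi.sub_apply, h2, h3, h4]
  have hA := adjoint_dirichletPrimitive_neg hL h hG hF
  have hB : formOp hL hc G = ContinuousLinearMap.adjoint (dirichletPrimitive hL.le) f := by
    rw [neg_sub, map_sub] at hA
    simp only [formOp, _root_.add_apply, one_apply_eq_self,
      ContinuousLinearMap.comp_apply, hJ]
    nth_rewrite 1 [← hA]
    abel
  simp only [resolventOp, ContinuousLinearMap.comp_apply]
  rw [← hB, inverse_formOp_apply, hJ]

/-- Values of the resolvent solve `(κ - A) φ = f`. -/
theorem exists_resolventOp_rep (f : L2 L) : ∃ φ φ' φ'' : ℝ → ℝ, IsDirichletH2 L φ φ' φ'' ∧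
    resolventOp hL hc f =ᵐ[volume.restrict (Ioo (0 : ℝ) L)] φ ∧
    ∀ᵐ x ∂(volume.restrict (Ioo (0 : ℝ) L)), φ'' x = (shift L c - c x) * φ x - f x := by
  set T := resolventOp hL hc f with hT
  have hF := L2_memLp (potOp hc T - f)
  obtain ⟨φ, φ', h⟩ := exists_isDirichletH2 hL hF
  have hφ := (h.deriv_one.memLp_two hL.le).coeFn_toLp
  set Φ := (h.deriv_one.memLp_two hL.le).toLp φ
  have hG := h.deriv_one.memLp.coeFn_toLp
  set G := h.deriv_one.memLp.toLp φ'
  have hJ := dirichletPrimitive_eq hL h.deriv_one h.left h.right hφ hG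
  have hA := adjoint_dirichletPrimitive_neg hL h hG ae_eq_rfl
  -- Both `T` and `Φ` solve `φ'' = (κ - c) T - f`.
  have hTΦ : T = Φ := by
    rw [← hJ, ← hA]
    set g := Ring.inverse (formOp hL hc)
      (ContinuousLinearMap.adjoint (dirichletPrimitive hL.le) f) with hg
    have h1 : T = dirichletPrimitive hL.le g := by
      simp only [hT, resolventOp, ContinuousLinearMap.comp_apply, hg]
    have h2 : formOp hL hc g = ContinuousLinearMap.adjoint (dirichletPrimitive hL.le) f :=
      formOp_inverse_apply hL hc _
    rw [h1]
    congr 1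
    simp only [formOp, _root_.add_apply, one_apply_eq_self,
      ContinuousLinearMap.comp_apply] at h2
    rw [neg_sub, map_sub, ← h2]
    abel
  refine ⟨φ, φ', _, h, hTΦ ▸ hφ, ?_⟩
  filter_upwards [Lp.coeFn_sub (potOp hc T) f, coeFn_potOp hc T, hφ] with x h1 h2 h3
  rw [h1, Pi.sub_apply, h2, hTΦ, h3]

theorem resolventOp_injective {f : L2 L} (hf : resolventOp hL hc f = 0) : f = 0 := by
  obtain ⟨φ, φ', φ'', h, h1, h2⟩ := exists_resolventOp_rep hL hc f
  have hφ : ∀ x ∈ Icc 0 L, φ x = 0 := by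
    refine eqOn_zero_of_ae hL (h.deriv_one.continuousOn hL.le) ?_
    rw [hf] at h1
    filter_upwards [h1, Lp.coeFn_zero ℝ 2 (volume.restrict (Ioo (0 : ℝ) L))] with x h3 h4
    rw [← h3, h4]; rfl
  have step : ∀ {p p' : ℝ → ℝ}, HasWeakDeriv L p p' → (∀ x ∈ Icc 0 L, p x = 0) →
      ∀ᵐ x ∂(volume.restrict (Ioo (0 : ℝ) L)), p' x = 0 := by
    intro p p' hp hz
    refine ae_eq_zero_of_integral_eq_zero hL.le hp.memLp fun x hx => ?_
    have := hp.eq_integral x hx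
    rw [hz x hx, hz 0 ⟨le_rfl, hL.le⟩] at this
    linarith
  have h3 := step h.deriv_two
    (eqOn_zero_of_ae hL (h.deriv_two.continuousOn hL.le) (step h.deriv_one hφ))
  apply Lp.ext
  filter_upwards [h3, h2, Lp.coeFn_zero ℝ 2 (volume.restrict (Ioo (0 : ℝ) L)),
    ae_restrict_mem measurableSet_Ioo] with x h4 h5 h6 hx
  rw [h6, Pi.zero_apply]
  rw [h4, hφ x (Ioo_subset_Icc_self hx)] at h5
  linarith

end Resolvent

/-! ### Uniqueness for the Cauchy problem at `x = L` -/

/-- A solution of a second order linear equation with zero Cauchy data at `L` vanishes. -/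
theorem eqOn_zero_of_cauchy_right (hL : 0 < L) {φ φ' φ'' : ℝ → ℝ} (h1 : HasWeakDeriv L φ φ')
    (h2 : HasWeakDeriv L φ' φ'') (hφ : φ L = 0) (hφ' : φ' L = 0) {M : ℝ} (hM : 0 ≤ M)
    (hb : ∀ᵐ x ∂(volume.restrict (Ioo (0 : ℝ) L)), |φ'' x| ≤ M * |φ x|) :
    ∀ x ∈ Icc 0 L, φ x = 0 := by
  have hc1 := h1.continuousOn hL.le
  have hc2 := h2.continuousOn hL.le
  have hLL : L ∈ Icc 0 L := ⟨hL.le, le_rfl⟩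
  have h0L : (0 : ℝ) ∈ Icc 0 L := ⟨le_rfl, hL.le⟩
  -- `k` extends `|φ| + |φ'|` continuously to the line.
  set k : ℝ → ℝ := IccExtend hL.le (domRestrict (Icc 0 L) fun x => |φ x| + |φ' x|) with hk
  have hkc : Continuous k := by
    refine Continuous.Icc_extend' ?_
    rw [← continuousOn_iff_continuous_domRestrict]
    exact hc1.abs.add hc2.abs
  have hkeq : ∀ x ∈ Icc 0 L, k x = |φ x| + |φ' x| := fun x hx => by
    rw [hk, IccExtend_of_mem _ _ hx]; rfl
  have hk0 : ∀ x, 0 ≤ k x := fun x =>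
    add_nonneg (abs_nonneg _) (abs_nonneg _)
  have hki : ∀ x y, IntervalIntegrable k volume x y := fun x y => hkc.intervalIntegrable x y
  have hprim : ∀ {p p' : ℝ → ℝ}, HasWeakDeriv L p p' → p L = 0 → ∀ x ∈ Icc 0 L,
      |p x| ≤ ∫ s in x..L, |p' s| := by
    intro p p' hp hpL x hx
    have e1 := hp.eq_integral x hx
    have e2 := hp.eq_integral L hLL
    have e3 := intervalIntegral.integral_add_adjacent_intervals
      (hp.memLp.intervalIntegrable_of_two h0L hx) (hp.memLp.intervalIntegrable_of_two hx hLL)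
    have e4 : p x = -∫ s in x..L, p' s := by linarith
    rw [e4, abs_neg]
    exact intervalIntegral.abs_integral_le_integral_abs hx.2
  have hbound : ∀ x ∈ Icc 0 L, k x ≤ (1 + M) * ∫ s in x..L, k s := by
    intro x hx
    have hsub : ∀ s ∈ Icc x L, s ∈ Icc 0 L := fun s hs => ⟨hx.1.trans hs.1, hs.2⟩
    have b1 : |φ x| ≤ ∫ s in x..L, k s := by
      refine (hprim h1 hφ x hx).trans (intervalIntegral.integral_mono_on hx.2
        (h1.memLp.intervalIntegrable_of_two hx hLL).abs (hki _ _) fun s hs => ?_)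
      rw [hkeq s (hsub s hs)]
      linarith [abs_nonneg (φ s)]
    have b2 : |φ' x| ≤ M * ∫ s in x..L, k s := by
      rw [← intervalIntegral.integral_const_mul]
      refine (hprim h2 hφ' x hx).trans ?_
      refine intervalIntegral.integral_mono_ae_restrict hx.2
        (h2.memLp.intervalIntegrable_of_two hx hLL).abs ((hki _ _).const_mul M) ?_
      have hb' : ∀ᵐ s ∂(volume.restrict (Icc (0 : ℝ) L)), |φ'' s| ≤ M * |φ s| := by
        rw [← restrict_Ioo_eq_restrict_Icc]; exact hb
      filter_upwards [ae_restrict_of_ae_restrict_of_subset (fun s hs => hsub s hs) hb',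
        ae_restrict_mem measurableSet_Icc] with s hs hsm
      refine hs.trans (mul_le_mul_of_nonneg_left ?_ hM)
      rw [hkeq s (hsub s hsm)]
      linarith [abs_nonneg (φ' s)]
    rw [hkeq x hx]
    linarith
  -- Grönwall's inequality for `s ↦ ∫ k` over `[L - s, L]`.
  have hF : ∀ s, HasDerivAt (fun s => ∫ r in (L - s)..L, k r) (k (L - s)) s := by
    intro s
    have d1 : HasDerivAt (fun y => ∫ r in y..L, k r) (-k (L - s)) (L - s) :=
      intervalIntegral.integral_hasDerivAt_left (hki _ _)
        (hkc.stronglyMeasurableAtFilter _ _) hkc.continuousAt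
    have d2 := d1.comp_const_sub L s
    simpa using d2
  have hz := eq_zero_of_abs_deriv_le_mul_abs_self_of_eq_zero_right (a := 0) (b := L) (K := 1 + M)
    (f := fun s => ∫ r in (L - s)..L, k r) (f' := fun s => k (L - s))
    (fun s _ => (hF s).continuousAt.continuousWithinAt) (fun s _ => (hF s).hasDerivWithinAt)
    (by simp) (fun s hs => by
      have hm : L - s ∈ Icc 0 L := ⟨by linarith [hs.2], by linarith [hs.1]⟩
      rw [Real.norm_eq_abs, Real.norm_eq_abs, abs_of_nonneg (hk0 _), abs_of_nonneg
        (intervalIntegral.integral_nonneg hm.2 fun r _ => hk0 r)]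
      exact hbound _ hm)
  intro x hx
  have h3 := hz (L - x) ⟨by linarith [hx.2], by linarith [hx.1]⟩
  simp only [sub_sub_cancel] at h3
  have h4 := hbound x hx
  rw [h3, mul_zero, hkeq x hx] at h4
  exact abs_eq_zero.1 (le_antisymm (by linarith [abs_nonneg (φ' x)]) (abs_nonneg _))

/-! ### Eigenfunctions -/

open Classical in
/-- The class in `L²(0,L)` of a square integrable function (and `0` for other functions). -/
noncomputable def toL2 (L : ℝ) (f : ℝ → ℝ) : L2 L :=
  if h : MemLp f 2 (volume.restrict (Ioo (0 : ℝ) L)) then h.toLp f else 0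

theorem coeFn_toL2 {f : ℝ → ℝ} (h : MemLp f 2 (volume.restrict (Ioo (0 : ℝ) L))) :
    toL2 L f =ᵐ[volume.restrict (Ioo (0 : ℝ) L)] f := by
  rw [toL2, dif_pos h]; exact h.coeFn_toLp

namespace IsEigenfunction

variable {c e : ℝ → ℝ} {lam : ℝ}

theorem continuousOn (h : IsEigenfunction L c lam e) (hL : 0 < L) : ContinuousOn e (Icc 0 L) := by
  obtain ⟨⟨e', e'', h, -⟩, -⟩ := h
  exact h.deriv_one.continuousOn hL.le

theorem coeFn (h : IsEigenfunction L c lam e) (hL : 0 < L) :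
    toL2 L e =ᵐ[volume.restrict (Ioo (0 : ℝ) L)] e :=
  coeFn_toL2 (h.continuousOn hL).memLp_two_Ioo

theorem norm_toL2 (h : IsEigenfunction L c lam e) (hL : 0 < L) : ‖toL2 L e‖ = 1 := by
  have h1 := L2_norm_sq_eq hL.le (h.coeFn hL)
  rw [h.2] at h1
  nlinarith [norm_nonneg (toL2 L e)]

theorem smul_resolventOp (h : IsEigenfunction L c lam e) (hL : 0 < L)
    (hc : MemLp c ⊤ (volume.restrict (Ioo (0 : ℝ) L))) :
    (shift L c - lam) • resolventOp hL hc (toL2 L e) = toL2 L e := by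
  obtain ⟨⟨e', e'', h1, h2⟩, -⟩ := id h
  rw [← map_smul]
  refine resolventOp_eq hL hc h1 (h.coeFn hL) ?_
  filter_upwards [h2, Lp.coeFn_smul (shift L c - lam) (toL2 L e), h.coeFn hL] with x h3 h4 h5
  rw [h4, Pi.smul_apply, h5, smul_eq_mul]
  linarith

theorem lt_shift (h : IsEigenfunction L c lam e) (hL : 0 < L)
    (hc : MemLp c ⊤ (volume.restrict (Ioo (0 : ℝ) L))) : 0 < shift L c - lam := by
  have h1 := h.smul_resolventOp hL hc
  have h2 := inner_resolventOp_self_nonneg hL hc (toL2 L e)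
  have h3 : (shift L c - lam) * inner ℝ (resolventOp hL hc (toL2 L e)) (toL2 L e) = 1 := by
    rw [← real_inner_smul_left, h1, real_inner_self_eq_norm_sq, h.norm_toL2 hL, one_pow]
  by_contra hneg
  nlinarith

theorem resolventOp_apply (h : IsEigenfunction L c lam e) (hL : 0 < L)
    (hc : MemLp c ⊤ (volume.restrict (Ioo (0 : ℝ) L))) :
    resolventOp hL hc (toL2 L e) = (shift L c - lam)⁻¹ • toL2 L e := by
  have h1 := h.lt_shift hL hc
  nth_rewrite 2 [← h.smul_resolventOp hL hc]
  rw [smul_smul, inv_mul_cancel₀ h1.ne', one_smul]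

theorem inner_eq_zero {e₂ : ℝ → ℝ} {lam₂ : ℝ} (h : IsEigenfunction L c lam e)
    (h₂ : IsEigenfunction L c lam₂ e₂) (hL : 0 < L)
    (hc : MemLp c ⊤ (volume.restrict (Ioo (0 : ℝ) L))) (hne : lam ≠ lam₂) :
    inner ℝ (toL2 L e) (toL2 L e₂) = 0 := by
  have h1 : inner ℝ (resolventOp hL hc (toL2 L e)) (toL2 L e₂) =
    inner ℝ (toL2 L e) (resolventOp hL hc (toL2 L e₂)) := isSymmetric_resolventOp hL hc _ _
  rw [h.resolventOp_apply hL hc, h₂.resolventOp_apply hL hc, real_inner_smul_left,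
    real_inner_smul_right] at h1
  have h3 : (shift L c - lam)⁻¹ - (shift L c - lam₂)⁻¹ ≠ 0 := by
    rw [sub_ne_zero]
    intro h4
    exact hne (by linarith [inv_injective h4])
  have h4 : ((shift L c - lam)⁻¹ - (shift L c - lam₂)⁻¹) *
      inner ℝ (toL2 L e) (toL2 L e₂) = 0 := by rw [sub_mul, h1, sub_self]
  exact (mul_eq_zero.1 h4).resolve_left h3

end IsEigenfunction

section

variable {c : ℝ → ℝ}

theorem exists_abs_deriv_two_le (hc : MemLp c ⊤ (volume.restrict (Ioo (0 : ℝ) L))) (lam : ℝ) :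
    ∃ M, 0 ≤ M ∧ ∀ φ φ'' : ℝ → ℝ,
      (∀ᵐ x ∂(volume.restrict (Ioo (0 : ℝ) L)), φ'' x + c x * φ x = lam * φ x) →
      ∀ᵐ x ∂(volume.restrict (Ioo (0 : ℝ) L)), |φ'' x| ≤ M * |φ x| := by
  refine ⟨|lam| + |shift L c - 1|, by positivity, fun φ φ'' h => ?_⟩
  filter_upwards [h, ae_abs_le_shift hc] with x h1 h2
  have h3 : φ'' x = (lam - c x) * φ x := by linarith
  rw [h3, abs_mul]
  refine mul_le_mul_of_nonneg_right ((abs_sub _ _).trans ?_) (abs_nonneg _)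
  linarith [le_abs_self (shift L c - 1)]

/-- The outward derivative of an eigenfunction at `L` does not vanish: this is what makes the
unstable modes controllable from the boundary. -/
theorem deriv_right_ne_zero (hL : 0 < L) (hc : MemLp c ⊤ (volume.restrict (Ioo (0 : ℝ) L)))
    {lam : ℝ} {e e' e'' : ℝ → ℝ} (h : IsDirichletH2 L e e' e'')
    (he : ∀ᵐ x ∂(volume.restrict (Ioo (0 : ℝ) L)), e'' x + c x * e x = lam * e x)
    (hn : ∫ x in (0 : ℝ)..L, e x ^ 2 = 1) : e' L ≠ 0 := by
  intro h0
  obtain ⟨M, hM, hb⟩ := exists_abs_deriv_two_le hc lam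
  have hz := eqOn_zero_of_cauchy_right hL h.deriv_one h.deriv_two h.right h0 hM (hb _ _ he)
  have : ∫ x in (0 : ℝ)..L, e x ^ 2 = ∫ x in (0 : ℝ)..L, (0 : ℝ) := by
    refine intervalIntegral.integral_congr fun x hx => ?_
    rw [uIcc_of_le hL.le] at hx
    simp [hz x hx]
  rw [hn] at this
  simp at this

/-- The eigenvalues of `A` are simple. -/
theorem IsEigenfunction.eq_smul (hL : 0 < L)
    (hc : MemLp c ⊤ (volume.restrict (Ioo (0 : ℝ) L))) {lam : ℝ} {e f : ℝ → ℝ}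
    (he : IsEigenfunction L c lam e) (hf : IsEigenfunction L c lam f) :
    ∃ r : ℝ, toL2 L f = r • toL2 L e := by
  obtain ⟨⟨e', e'', he1, he2⟩, he3⟩ := id he
  obtain ⟨⟨f', f'', hf1, hf2⟩, hf3⟩ := id hf
  have hne := deriv_right_ne_zero hL hc he1 he2 he3
  obtain ⟨M, hM, hb⟩ := exists_abs_deriv_two_le hc lam
  set r := f' L / e' L with hr
  have hl := hf1.lincomb he1 1 (-r)
  have hz := eqOn_zero_of_cauchy_right hL hl.deriv_one hl.deriv_two hl.right
    (by simp only [hr]; field_simp; ring) hM (hb _ _ (by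
      filter_upwards [he2, hf2] with x h1 h2
      linear_combination h2 - r * h1))
  refine ⟨r, Lp.ext ?_⟩
  filter_upwards [hf.coeFn hL, he.coeFn hL, Lp.coeFn_smul r (toL2 L e),
    ae_restrict_mem measurableSet_Ioo] with x h1 h2 h3 hx
  rw [h1, h3, Pi.smul_apply, h2, smul_eq_mul]
  linarith [hz x (Ioo_subset_Icc_self hx)]

/-- Every eigenvector of the resolvent is a multiple of an eigenfunction of `A`. -/
theorem exists_isEigenfunction_of_resolventOp (hL : 0 < L)
    (hc : MemLp c ⊤ (volume.restrict (Ioo (0 : ℝ) L))) {τ : ℝ} {v : L2 L}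
    (hv : resolventOp hL hc v = τ • v) (hv0 : v ≠ 0) :
    ∃ e, IsEigenfunction L c (shift L c - τ⁻¹) e ∧ v = ‖v‖ • toL2 L e := by
  have hτ : τ ≠ 0 := by
    rintro rfl
    exact hv0 (resolventOp_injective hL hc (by rw [hv, zero_smul]))
  have hn : ‖v‖ ≠ 0 := norm_ne_zero_iff.2 hv0
  obtain ⟨φ, φ', φ'', h, h1, h2⟩ := exists_resolventOp_rep hL hc v
  rw [hv] at h1
  set s := (τ * ‖v‖)⁻¹ with hs
  have hl := h.lincomb h s 0
  have hvφ : v =ᵐ[volume.restrict (Ioo (0 : ℝ) L)] fun x => τ⁻¹ * φ x := by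
    filter_upwards [h1, Lp.coeFn_smul τ v] with x h3 h4
    rw [← h3, h4, Pi.smul_apply, smul_eq_mul, inv_mul_cancel_left₀ hτ]
  refine ⟨fun x => s * φ x + 0 * φ x, ⟨⟨_, _, hl, ?_⟩, ?_⟩, ?_⟩
  · filter_upwards [h2, hvφ] with x h3 h4
    rw [h3, h4]
    ring
  · have h3 := L2_norm_sq_eq hL.le hvφ
    have h4 : ∀ x, (s * φ x + 0 * φ x) ^ 2 = (‖v‖⁻¹) ^ 2 * (τ⁻¹ * φ x) ^ 2 := fun x => by
      rw [hs, mul_inv]; ring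
    simp only [h4]
    rw [intervalIntegral.integral_const_mul, ← h3]
    field_simp
  · have h5 := coeFn_toL2 (hl.deriv_one.memLp_two hL.le)
    apply Lp.ext
    filter_upwards [hvφ, h5, Lp.coeFn_smul ‖v‖ (toL2 L fun x => s * φ x + 0 * φ x)]
      with x h6 h7 h8
    rw [h6, h8, Pi.smul_apply, h7, smul_eq_mul, hs]
    field_simp
    ring

/-- Any choice of one normalized eigenfunction for each eigenvalue of `A` is a Hilbert basis of
`L²(0,L)`. -/
theorem exists_hilbertBasis_eigenfunctions (hL : 0 < L)
    (hc : MemLp c ⊤ (volume.restrict (Ioo (0 : ℝ) L)))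
    (e : {μ : ℝ // ∃ v, IsEigenfunction L c μ v} → ℝ → ℝ)
    (he : ∀ i, IsEigenfunction L c i.1 (e i)) :
    ∃ b : HilbertBasis {μ : ℝ // ∃ v, IsEigenfunction L c μ v} ℝ (L2 L),
      ∀ i, b i = toL2 L (e i) := by
  have ho : Orthonormal ℝ fun i => toL2 L (e i) :=
    ⟨fun i => (he i).norm_toL2 hL, fun i j hij =>
      (he i).inner_eq_zero (he j) hL hc fun h => hij (Subtype.ext h)⟩
  have hsp : (Submodule.span ℝ (Set.range fun i => toL2 L (e i)))ᗮ = ⊥ := by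
    rw [eq_bot_iff, ← ContinuousLinearMap.orthogonalComplement_iSup_eigenspaces_eq_bot
      (isCompactOperator_resolventOp hL hc) (isSymmetric_resolventOp hL hc)]
    refine Submodule.orthogonal_le (iSup_le fun τ v hv => ?_)
    rw [Module.End.mem_eigenspace_iff] at hv
    by_cases hv0 : v = 0
    · rw [hv0]; exact Submodule.zero_mem _
    obtain ⟨f, hf, hvf⟩ := exists_isEigenfunction_of_resolventOp hL hc (τ := τ) hv hv0
    obtain ⟨r, hr⟩ := (he ⟨_, f, hf⟩).eq_smul hL hc hf
    rw [hvf, hr]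
    exact Submodule.smul_mem _ _ (Submodule.smul_mem _ _ (Submodule.subset_span ⟨_, rfl⟩))
  exact ⟨HilbertBasis.mkOfOrthogonalEqBot ho hsp, fun i => by simp⟩

/-- Only finitely many eigenvalues of `A` lie above a given level. -/
theorem finite_eigenvalues_ge (hL : 0 < L)
    (hc : MemLp c ⊤ (volume.restrict (Ioo (0 : ℝ) L))) (R : ℝ) :
    {μ : ℝ | R ≤ μ ∧ ∃ v, IsEigenfunction L c μ v}.Finite := by
  by_contra hinf
  have := Set.infinite_coe_iff.2 hinf
  set m := Infinite.natEmbedding {μ : ℝ | R ≤ μ ∧ ∃ v, IsEigenfunction L c μ v}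
  choose f hf using fun k => (m k).2.2
  have hR := ((hf 0).lt_shift hL hc).trans_le (sub_le_sub_left (m 0).2.1 _)
  set u : ℕ → L2 L := fun k => resolventOp hL hc (toL2 L (f k)) with hu
  -- The images of distinct eigenvectors under the resolvent stay at a definite distance.
  have hsep : ∀ k l, k ≠ l → (shift L c - R)⁻¹ ≤ dist (u k) (u l) := by
    intro k l hkl
    have ho : inner ℝ (toL2 L (f k)) (toL2 L (f l)) = 0 :=
      (hf k).inner_eq_zero (hf l) hL hc fun h => hkl (m.injective (Subtype.ext h))
    have h1 : inner ℝ (u k - u l) (toL2 L (f k)) = (shift L c - (m k : ℝ))⁻¹ := by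
      simp only [hu, (hf k).resolventOp_apply hL hc, (hf l).resolventOp_apply hL hc]
      rw [inner_sub_left, real_inner_smul_left, real_inner_smul_left, real_inner_self_eq_norm_sq,
        (hf k).norm_toL2 hL, real_inner_comm, ho]
      simp
    have h2 := real_inner_le_norm (u k - u l) (toL2 L (f k))
    rw [h1, (hf k).norm_toL2 hL, mul_one, ← dist_eq_norm] at h2
    refine le_trans ?_ h2
    exact inv_anti₀ ((hf k).lt_shift hL hc) (sub_le_sub_left (m k).2.1 _)
  have hK := (isCompactOperator_resolventOp hL hc).isCompact_closure_image_closedBall 1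
  have hmem : ∀ k, u k ∈ closure (resolventOp hL hc '' Metric.closedBall 0 1) := fun k =>
    subset_closure ⟨_, by simp [(hf k).norm_toL2 hL], rfl⟩
  obtain ⟨a, -, φ, hφ, hlim⟩ := hK.tendsto_subseq hmem
  obtain ⟨N, hN⟩ := Metric.cauchySeq_iff.1 hlim.cauchySeq _ (inv_pos.2 hR)
  exact absurd (hN N le_rfl (N + 1) (Nat.le_succ N))
    (not_lt.2 (hsep _ _ (hφ (Nat.lt_succ_self N)).ne))

end

/-! ### Sobolev norms in terms of eigenfunction coefficients -/

theorem h1Norm_eq (hL : 0 ≤ L) {f f' : ℝ → ℝ} {F F' : L2 L}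
    (hF : F =ᵐ[volume.restrict (Ioo (0 : ℝ) L)] f)
    (hF' : F' =ᵐ[volume.restrict (Ioo (0 : ℝ) L)] f') :
    h1Norm L f f' = Real.sqrt (‖F‖ ^ 2 + ‖F'‖ ^ 2) := by
  rw [h1Norm, L2_norm_sq_eq hL hF, L2_norm_sq_eq hL hF']

theorem h1Norm_le_add (hL : 0 ≤ L) {f f' : ℝ → ℝ} {F F' : L2 L}
    (hF : F =ᵐ[volume.restrict (Ioo (0 : ℝ) L)] f)
    (hF' : F' =ᵐ[volume.restrict (Ioo (0 : ℝ) L)] f') :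
    h1Norm L f f' ≤ ‖F‖ + ‖F'‖ := by
  rw [h1Norm_eq hL hF hF']
  refine Real.sqrt_le_iff.2 ⟨by positivity, ?_⟩
  nlinarith [norm_nonneg F, norm_nonneg F']

theorem norm_le_h1Norm (hL : 0 ≤ L) {f f' : ℝ → ℝ} {F F' : L2 L}
    (hF : F =ᵐ[volume.restrict (Ioo (0 : ℝ) L)] f)
    (hF' : F' =ᵐ[volume.restrict (Ioo (0 : ℝ) L)] f') :
    ‖F‖ ≤ h1Norm L f f' ∧ ‖F'‖ ≤ h1Norm L f f' := by
  rw [h1Norm_eq hL hF hF']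
  exact ⟨Real.le_sqrt_of_sq_le (by nlinarith [sq_nonneg ‖F'‖]),
    Real.le_sqrt_of_sq_le (by nlinarith [sq_nonneg ‖F‖])⟩

theorem H1Bound.mono {z : L2 L} {r M N : ℝ} (h : H1Bound L z r M) (hMN : M ≤ N) :
    H1Bound L z r N := by
  obtain ⟨f, f', h1, h2, h3, h4, h5⟩ := h
  exact ⟨f, f', h1, h2, h3, h4, h5.trans hMN⟩

/-- The sum of an element of `H¹₀(0,L)`, given by its parameter `g`, and of `r x/L` has boundary value
`r` at `L`, and its `H¹` norm is controlled by `g` and `r`. -/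
theorem exists_H1Bound_dirichletPrimitive (hL : 0 < L) : ∃ C, 0 ≤ C ∧ ∀ (g : L2 L) (r : ℝ),
    H1Bound L (dirichletPrimitive hL.le g + r • xiL L) r (C * (‖g‖ + |r|)) := by
  set o : L2 L := indicatorConstLp 2 (measurableSet_Ioo (a := 0) (b := L))
      (measure_ne_top (volume.restrict (Ioo (0 : ℝ) L)) _) (1 : ℝ) with ho
  have ho1 : o =ᵐ[volume.restrict (Ioo (0 : ℝ) L)] fun _ => (1 : ℝ) := by
    filter_upwards [indicatorConstLp_coeFn (p := 2) (hs := measurableSet_Ioo (a := 0) (b := L))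
        (hμs := measure_ne_top (volume.restrict (Ioo (0 : ℝ) L)) _) (c := (1 : ℝ)),
        ae_restrict_mem measurableSet_Ioo] with x h1 h2
    rw [ho, h1, indicator_of_mem h2]
  set J := dirichletPrimitive hL.le
  refine ⟨‖J‖ + ‖xiL L‖ + 1 + (1 + ‖o‖) * (1 / L * ‖o‖), by positivity, fun g r => ?_⟩
  set m : ℝ := ∫ s in (0 : ℝ)..L, g s with hm
  have hmo : m = inner ℝ o g := integral_eq_inner_indicator le_rfl hL.le le_rfl g
  have hd : HasWeakDeriv L (fun x => ((∫ s in (0 : ℝ)..x, g s) - m * (x / L)) + r * (x / L))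
      (fun x => (g x - m * (1 / L)) + r * (1 / L)) := by
    refine (((hasWeakDeriv_dirichletPrimitive g).lincomb
      (hasWeakDeriv_mul_const (L := L) (1 / L)) 1 r).of_eqOn fun x _ => ?_).of_ae_eq
      (Eventually.of_forall fun x => ?_)
    · simp only [hm]; ring
    · simp only [hm]; ring
  have hF : (J g + r • xiL L : L2 L) =ᵐ[volume.restrict (Ioo (0 : ℝ) L)]
      fun x => ((∫ s in (0 : ℝ)..x, g s) - m * (x / L)) + r * (x / L) := by
    filter_upwards [Lp.coeFn_add (J g) (r • xiL L), coeFn_dirichletPrimitive hL.le g,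
      Lp.coeFn_smul r (xiL L), coeFn_xiL L] with x h1 h2 h3 h4
    rw [h1, Pi.add_apply, h2, h3, Pi.smul_apply, h4, smul_eq_mul]
  have hF' : (g + ((r - m) * (1 / L)) • o : L2 L) =ᵐ[volume.restrict (Ioo (0 : ℝ) L)]
      fun x => (g x - m * (1 / L)) + r * (1 / L) := by
    filter_upwards [Lp.coeFn_add g (((r - m) * (1 / L)) • o),
      Lp.coeFn_smul ((r - m) * (1 / L)) o, ho1] with x h1 h2 h3
    rw [h1, Pi.add_apply, h2, Pi.smul_apply, h3, smul_eq_mul]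
    ring
  refine ⟨_, _, hd, hF, by simp, ?_, ?_⟩
  · rw [div_self hL.ne', hm]; ring
  · refine (h1Norm_le_add hL.le hF hF').trans ?_
    have h1 : ‖J g + r • xiL L‖ ≤ ‖J‖ * ‖g‖ + |r| * ‖xiL L‖ :=
      (norm_add_le _ _).trans (add_le_add (J.le_opNorm g) (by rw [norm_smul, Real.norm_eq_abs]))
    have hm' : |m| ≤ ‖o‖ * ‖g‖ := by rw [hmo]; exact abs_real_inner_le_norm o g
    have h2 : ‖g + ((r - m) * (1 / L)) • o‖ ≤ ‖g‖ + (|r| + ‖o‖ * ‖g‖) * (1 / L * ‖o‖) := by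
      refine (norm_add_le _ _).trans (add_le_add le_rfl ?_)
      rw [norm_smul, Real.norm_eq_abs, abs_mul, abs_of_pos (one_div_pos.2 hL), mul_assoc]
      refine mul_le_mul_of_nonneg_right ((abs_sub _ _).trans (by linarith)) (by positivity)
    have a1 := norm_nonneg g
    have a2 := abs_nonneg r
    have a3 := norm_nonneg J
    have a4 := norm_nonneg (xiL L)
    have a5 := norm_nonneg o
    have a6 : 0 ≤ 1 / L * ‖o‖ := by positivity
    have e1 := mul_nonneg a3 a2
    have e2 := mul_nonneg a4 a1
    have e3 := mul_nonneg a6 a1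
    have e4 := mul_nonneg (mul_nonneg a5 a2) a6
    nlinarith

/-- A Hilbert basis of `L²(0,L)` made of eigenfunctions of `A`. The pointwise representatives `fn`
are part of the data, since the statements about the closed loop are about given functions `e j`. -/
structure SpectralBasis (L : ℝ) (c : ℝ → ℝ) (ι : Type) where
  /-- the Hilbert basis -/
  basis : HilbertBasis ι ℝ (L2 L)
  /-- the eigenvalues -/
  lam : ι → ℝ
  /-- the eigenfunctions -/
  fn : ι → ℝ → ℝ
  eigen : ∀ i, IsEigenfunction L c (lam i) (fn i)
  basis_eq : ∀ i, basis i = toL2 L (fn i)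

namespace SpectralBasis

variable {c : ℝ → ℝ} {ι : Type} (b : SpectralBasis L c ι) (hL : 0 < L)
  (hc : MemLp c ⊤ (volume.restrict (Ioo (0 : ℝ) L)))

theorem shift_sub_pos (hL : 0 < L) (hc : MemLp c ⊤ (volume.restrict (Ioo (0 : ℝ) L))) (i : ι) :
    0 < shift L c - b.lam i := (b.eigen i).lt_shift hL hc

theorem resolventOp_basis (i : ι) :
    resolventOp hL hc (b.basis i) = (shift L c - b.lam i)⁻¹ • b.basis i := by
  rw [b.basis_eq]; exact (b.eigen i).resolventOp_apply hL hc

/-- The weak derivatives `gᵢ` of the eigenfunctions are orthogonal for the energy form. -/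
theorem exists_deriv : ∃ g : ι → L2 L, (∀ i, dirichletPrimitive hL.le (g i) = b.basis i) ∧
    ∀ i k, inner ℝ (formOp hL hc (g i)) k =
      (shift L c - b.lam i) * inner ℝ (b.basis i) (dirichletPrimitive hL.le k) := by
  have : ∀ i, ∃ g : L2 L, dirichletPrimitive hL.le g = b.basis i ∧
      formOp hL hc g = (shift L c - b.lam i) •
        ContinuousLinearMap.adjoint (dirichletPrimitive hL.le) (b.basis i) := by
    intro i
    set g := Ring.inverse (formOp hL hc) ((shift L c - b.lam i) •
        ContinuousLinearMap.adjoint (dirichletPrimitive hL.le) (b.basis i)) with hg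
    refine ⟨g, ?_, formOp_inverse_apply hL hc _⟩
    have h1 : dirichletPrimitive hL.le g =
        (shift L c - b.lam i) • resolventOp hL hc (b.basis i) := by
      simp only [hg, map_smul, resolventOp, ContinuousLinearMap.comp_apply]
    rw [h1, b.basis_eq, (b.eigen i).smul_resolventOp hL hc]
  choose g hg1 hg2 using this
  refine ⟨g, hg1, fun i k => ?_⟩
  rw [hg2, real_inner_smul_left, ContinuousLinearMap.adjoint_inner_left]

theorem inner_formOp_sum {g : ι → L2 L}
    (hg1 : ∀ i, dirichletPrimitive hL.le (g i) = b.basis i)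
    (hg2 : ∀ i k, inner ℝ (formOp hL hc (g i)) k =
      (shift L c - b.lam i) * inner ℝ (b.basis i) (dirichletPrimitive hL.le k))
    (F : Finset ι) (a : ι → ℝ) :
    inner ℝ (formOp hL hc (∑ i ∈ F, a i • g i)) (∑ i ∈ F, a i • g i) =
      ∑ i ∈ F, (shift L c - b.lam i) * a i ^ 2 := by
  rw [map_sum, sum_inner]
  refine Finset.sum_congr rfl fun i hi => ?_
  rw [map_smul, real_inner_smul_left, hg2, map_sum]
  simp only [map_smul, hg1]
  rw [b.basis.orthonormal.inner_right_sum _ hi]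
  ring

/-- Synthesis: a function with finite energy in terms of its coefficients lies in `H¹₀(0,L)`. -/
theorem exists_dirichletPrimitive_eq (hc : MemLp c ⊤ (volume.restrict (Ioo (0 : ℝ) L)))
    {w : L2 L} {M : ℝ}
    (h : ∀ F : Finset ι, ∑ i ∈ F, (shift L c - b.lam i) * inner ℝ (b.basis i) w ^ 2 ≤ M ^ 2)
    (hM : 0 ≤ M) : ∃ g : L2 L, dirichletPrimitive hL.le g = w ∧ ‖g‖ ≤ M := by
  obtain ⟨g, hg1, hg2⟩ := b.exists_deriv hL hc
  set a : ι → ℝ := fun i => inner ℝ (b.basis i) w with ha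
  have hnn : ∀ i, 0 ≤ (shift L c - b.lam i) * a i ^ 2 := fun i =>
    mul_nonneg (b.shift_sub_pos hL hc i).le (sq_nonneg _)
  have hs : Summable fun i => (shift L c - b.lam i) * a i ^ 2 := summable_of_sum_le hnn h
  have hle : ∀ F : Finset ι, ‖∑ i ∈ F, a i • g i‖ ^ 2 ≤
      ∑ i ∈ F, (shift L c - b.lam i) * a i ^ 2 := by
    intro F
    rw [← b.inner_formOp_sum hL hc hg1 hg2]
    have := norm_sq_add_norm_sq_le_inner_formOp hL hc (∑ i ∈ F, a i • g i)
    nlinarith [sq_nonneg ‖dirichletPrimitive hL.le (∑ i ∈ F, a i • g i)‖]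
  have hsg : Summable fun i => a i • g i := by
    rw [summable_iff_vanishing_norm]
    intro ε hε
    obtain ⟨s, hs'⟩ := (summable_iff_vanishing_norm.1 hs) (ε ^ 2) (by positivity)
    refine ⟨s, fun t ht => ?_⟩
    have h1 := hs' t ht
    rw [Real.norm_eq_abs, abs_of_nonneg (Finset.sum_nonneg fun i _ => hnn i)] at h1
    exact lt_of_pow_lt_pow_left₀ 2 hε.le ((hle t).trans_lt h1)
  -- The continuous operator `dirichletPrimitive` maps the series to the expansion of `w`.
  refine ⟨∑' i, a i • g i, ?_, ?_⟩
  · have h1 := hsg.hasSum.mapL (dirichletPrimitive hL.le)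
    simp only [map_smul, hg1] at h1
    have h2 := b.basis.hasSum_repr w
    simp only [HilbertBasis.repr_apply_apply] at h2
    exact h1.unique h2
  · refine le_of_tendsto (hsg.hasSum.norm) (Eventually.of_forall fun F => ?_)
    exact le_of_sq_le_sq ((hle F).trans (h F)) hM

/-- Analysis: the energy of an element of `H¹₀(0,L)` bounds its weighted coefficients. -/
theorem sum_coef_le (hL : 0 < L) (hc : MemLp c ⊤ (volume.restrict (Ioo (0 : ℝ) L)))
    {v v' : ℝ → ℝ} (hv : HasWeakDeriv L v v') (h0 : v 0 = 0) (h1 : v L = 0)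
    {V : L2 L} (hV : V =ᵐ[volume.restrict (Ioo (0 : ℝ) L)] v) (F : Finset ι) :
    ∑ i ∈ F, (shift L c - b.lam i) * inner ℝ (b.basis i) V ^ 2 ≤
      ‖formOp hL hc‖ * h1Norm L v v' ^ 2 := by
  obtain ⟨g, hg1, hg2⟩ := b.exists_deriv hL hc
  have hV' := coeFn_toL2 hv.memLp
  set k := toL2 L v'
  have hJ : dirichletPrimitive hL.le k = V := dirichletPrimitive_eq hL hv h0 h1 hV hV'
  set a : ι → ℝ := fun i => inner ℝ (b.basis i) V with ha
  set p := ∑ i ∈ F, a i • g i with hp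
  have e1 := b.inner_formOp_sum hL hc hg1 hg2 F a
  have e2 : inner ℝ (formOp hL hc p) k = ∑ i ∈ F, (shift L c - b.lam i) * a i ^ 2 := by
    rw [hp, map_sum, sum_inner]
    refine Finset.sum_congr rfl fun i _ => ?_
    rw [map_smul, real_inner_smul_left, hg2, hJ]
    ring
  -- Bessel's inequality for the energy form.
  have e3 : 0 ≤ inner ℝ (formOp hL hc (k - p)) (k - p) :=
    le_trans (by positivity) (norm_sq_add_norm_sq_le_inner_formOp hL hc (k - p))
  rw [map_sub, inner_sub_left, inner_sub_right, inner_sub_right, inner_formOp_comm hL hc k p,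
    real_inner_comm (formOp hL hc p) k, e2, e1] at e3
  have e4 : inner ℝ (formOp hL hc k) k ≤ ‖formOp hL hc‖ * h1Norm L v v' ^ 2 := by
    refine (real_inner_le_norm _ _).trans ?_
    have e5 := (norm_le_h1Norm hL.le hV hV').2
    calc ‖formOp hL hc k‖ * ‖k‖ ≤ (‖formOp hL hc‖ * ‖k‖) * ‖k‖ := by
          gcongr; exact ContinuousLinearMap.le_opNorm _ _
      _ = ‖formOp hL hc‖ * ‖k‖ ^ 2 := by ring
      _ ≤ _ := by gcongr
  change ∑ i ∈ F, (shift L c - b.lam i) * a i ^ 2 ≤ _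
  linarith

end SpectralBasis

/-! ### Variation of constants for scalar equations -/

theorem MeasureTheory.LocallyIntegrable.intervalIntegrable_real {η : ℝ → ℝ}
    (hη : LocallyIntegrable η volume) (x y : ℝ) : IntervalIntegrable η volume x y :=
  intervalIntegrable_iff.2 ((hη.integrableOn_isCompact isCompact_uIcc).mono_set uIoc_subset_uIcc)

theorem exp_mul_eq_integral (μ : ℝ) (t x : ℝ) : Real.exp (μ * x) =
    Real.exp (μ * t) + ∫ s in t..x, μ * Real.exp (μ * s) := by
  have h : ∀ s ∈ uIcc t x, HasDerivAt (fun s => Real.exp (μ * s)) (μ * Real.exp (μ * s)) s := by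
    intro s _
    have := ((hasDerivAt_id s).const_mul μ).exp
    simpa [mul_comm] using this
  rw [intervalIntegral.integral_eq_sub_of_hasDerivAt h
    ((by fun_prop : Continuous fun s => μ * Real.exp (μ * s)).intervalIntegrable _ _)]
  ring

/-- Variation of constants: a solution of `z' = μ z + g` in integral form. -/
theorem eq_exp_mul_of_eq_integral {μ z₀ t : ℝ} {z g : ℝ → ℝ} (ht : 0 ≤ t)
    (hz : ContinuousOn z (Icc 0 t)) (hg : IntervalIntegrable g volume 0 t)
    (h : ∀ s ∈ Icc 0 t, z s = z₀ + ∫ r in (0 : ℝ)..s, (μ * z r + g r)) :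
    z t = Real.exp (μ * t) * (z₀ + ∫ s in (0 : ℝ)..t, Real.exp (-μ * s) * g s) := by
  have h0 : z 0 = z₀ := by simpa using h 0 ⟨le_rfl, ht⟩
  have hi : IntervalIntegrable (fun r => μ * z r + g r) volume 0 t :=
    ((hz.intervalIntegrable_of_Icc ht).const_mul μ).add hg
  have key := integral_mul_add_mul_of_eq_integral ht
    (f := fun s => Real.exp (-μ * s)) (f' := fun s => -μ * Real.exp (-μ * s))
    ((by fun_prop : Continuous fun s => -μ * Real.exp (-μ * s)).intervalIntegrable _ _) hi
    (g := z)
    (fun x _ => exp_mul_eq_integral (-μ) 0 x) (fun x hx => by rw [h0]; exact h x hx)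
  have e1 : ∀ s, -μ * Real.exp (-μ * s) * z s + Real.exp (-μ * s) * (μ * z s + g s) =
      Real.exp (-μ * s) * g s := fun s => by ring
  simp only [e1, mul_zero, Real.exp_zero, one_mul, h0] at key
  rw [key, add_sub_cancel, ← mul_assoc, ← Real.exp_add]
  simp

/-- Variation of constants: the explicit formula solves `z' = μ z + g` in integral form. -/
theorem exp_mul_eq_add_integral {μ z₀ t : ℝ} {z g : ℝ → ℝ} (ht : 0 ≤ t)
    (hg : IntervalIntegrable g volume 0 t)
    (hz : ∀ s ∈ Icc 0 t,
      z s = Real.exp (μ * s) * (z₀ + ∫ r in (0 : ℝ)..s, Real.exp (-μ * r) * g r)) :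
    z t = z₀ + ∫ s in (0 : ℝ)..t, (μ * z s + g s) := by
  have hi : IntervalIntegrable (fun r => Real.exp (-μ * r) * g r) volume 0 t :=
    hg.continuousOn_mul (by fun_prop)
  have key := integral_mul_add_mul_of_eq_integral ht
    (f := fun s => Real.exp (μ * s)) (f' := fun s => μ * Real.exp (μ * s))
    (g := fun s => z₀ + ∫ r in (0 : ℝ)..s, Real.exp (-μ * r) * g r)
    ((by fun_prop : Continuous fun s => μ * Real.exp (μ * s)).intervalIntegrable _ _) hi
    (fun x _ => exp_mul_eq_integral μ 0 x) (fun x hx => by simp)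
  have e1 : ∫ s in (0 : ℝ)..t, (μ * z s + g s) =
      ∫ s in (0 : ℝ)..t, (μ * Real.exp (μ * s) *
        (z₀ + ∫ r in (0 : ℝ)..s, Real.exp (-μ * r) * g r) +
        Real.exp (μ * s) * (Real.exp (-μ * s) * g s)) := by
    refine intervalIntegral.integral_congr fun s hs => ?_
    rw [uIcc_of_le ht] at hs
    have e2 : Real.exp (μ * s) * (Real.exp (-μ * s) * g s) = g s := by
      rw [← mul_assoc, ← Real.exp_add]; simp
    simp only [e2]
    rw [hz s hs]
    ring
  rw [e1, key, hz t ⟨ht, le_rfl⟩]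
  simp

/-! ### The heat equation in eigenfunction coordinates -/

/-- The boundary derivative `φ'(L)` as an inner product. -/
theorem inner_xiL_deriv_two (hL : 0 < L) {φ φ' φ'' : ℝ → ℝ} (h : IsDirichletH2 L φ φ' φ'')
    {F : L2 L} (hF : F =ᵐ[volume.restrict (Ioo (0 : ℝ) L)] φ'') :
    inner ℝ (xiL L) F = φ' L := by
  have h1 := h.deriv_two.integral_mul_add_mul (hasWeakDeriv_mul_const (L := L) (1 / L)) hL.le
  have hid : ContinuousOn (fun x : ℝ => x * (1 / L)) (uIcc 0 L) := by fun_prop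
  rw [intervalIntegral.integral_add
    ((h.deriv_two.intervalIntegrable hL.le).mul_continuousOn hid)
    ((h.deriv_one.intervalIntegrable hL.le).mul_const _), intervalIntegral.integral_mul_const,
    h.deriv_one.integral_eq_sub hL.le, h.left, h.right, mul_one_div_cancel hL.ne'] at h1
  rw [L2_inner_eq hL.le (coeFn_xiL L) hF]
  simp only [sub_self, zero_mul, add_zero, mul_one, mul_zero, sub_zero] at h1
  rw [← h1]
  congr 1; ext x; ring

namespace SpectralBasis

variable {c : ℝ → ℝ} {ι : Type} (b : SpectralBasis L c ι)

/-- The `eᵢ`-coefficient of `-x/L`. -/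
noncomputable def coefB (i : ι) : ℝ := -inner ℝ (b.basis i) (xiL L)

/-- The function `x c(x) / L` as an element of `L²(0,L)`. -/
noncomputable def _root_.cxiL (hc : MemLp c ⊤ (volume.restrict (Ioo (0 : ℝ) L))) : L2 L :=
  shift L c • xiL L - potOp hc (xiL L)

/-- The `eᵢ`-coefficient of `x c(x) / L`. -/
noncomputable def coefA (hc : MemLp c ⊤ (volume.restrict (Ioo (0 : ℝ) L))) (i : ι) : ℝ :=
  inner ℝ (b.basis i) (cxiL hc)

theorem _root_.coeFn_cxiL (hc : MemLp c ⊤ (volume.restrict (Ioo (0 : ℝ) L))) :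
    cxiL hc =ᵐ[volume.restrict (Ioo (0 : ℝ) L)] fun x => c x * (x / L) := by
  filter_upwards [Lp.coeFn_sub (shift L c • xiL L) (potOp hc (xiL L)),
    Lp.coeFn_smul (shift L c) (xiL L), coeFn_potOp hc (xiL L), coeFn_xiL L] with x h1 h2 h3 h4
  rw [cxiL, h1, Pi.sub_apply, h2, h3, Pi.smul_apply, h4, smul_eq_mul]
  ring

theorem coeFn_basis (hL : 0 < L) (i : ι) :
    b.basis i =ᵐ[volume.restrict (Ioo (0 : ℝ) L)] b.fn i := by
  rw [b.basis_eq]; exact (b.eigen i).coeFn hL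

theorem coefB_eq (hL : 0 < L) (i : ι) :
    b.coefB i = -(1 / L) * ∫ x in (0 : ℝ)..L, x * b.fn i x := by
  rw [coefB, L2_inner_eq hL.le (b.coeFn_basis hL i) (coeFn_xiL L), neg_mul,
    ← intervalIntegral.integral_const_mul]
  congr 2; ext x; ring

theorem coefA_eq (hL : 0 < L) (hc : MemLp c ⊤ (volume.restrict (Ioo (0 : ℝ) L))) (i : ι) :
    b.coefA hc i = (1 / L) * ∫ x in (0 : ℝ)..L, x * c x * b.fn i x := by
  rw [coefA, L2_inner_eq hL.le (b.coeFn_basis hL i) (coeFn_cxiL hc),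
    ← intervalIntegral.integral_const_mul]
  congr 1; ext x; ring

/-- The combination `aᵢ + λᵢ bᵢ` in terms of `(κ - c) eᵢ - (κ - λᵢ) eᵢ = eᵢ''`. -/
theorem inner_xiL_potOp_basis (hL : 0 < L) (hc : MemLp c ⊤ (volume.restrict (Ioo (0 : ℝ) L)))
    (i : ι) :
    inner ℝ (xiL L) (potOp hc (b.basis i) - (shift L c - b.lam i) • b.basis i) =
      -(b.coefA hc i + b.lam i * b.coefB i) := by
  rw [coefA, coefB, cxiL, inner_sub_right, inner_sub_right,
    real_inner_smul_right, real_inner_smul_right, real_inner_comm (b.basis i) (xiL L),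
    potOp, ← inner_mulOp_left hL.le, real_inner_comm]
  ring

/-- `aᵢ + λᵢ bᵢ = -eᵢ'(L)`. -/
theorem coefA_add_mul_coefB (hL : 0 < L) (hc : MemLp c ⊤ (volume.restrict (Ioo (0 : ℝ) L)))
    (i : ι) {e' e'' : ℝ → ℝ} (h : IsDirichletH2 L (b.fn i) e' e'')
    (he : ∀ᵐ x ∂(volume.restrict (Ioo (0 : ℝ) L)),
      e'' x + c x * b.fn i x = b.lam i * b.fn i x) :
    b.coefA hc i + b.lam i * b.coefB i = -e' L := by
  have hF : (potOp hc (b.basis i) - (shift L c - b.lam i) • b.basis i : L2 L)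
      =ᵐ[volume.restrict (Ioo (0 : ℝ) L)] e'' := by
    filter_upwards [Lp.coeFn_sub (potOp hc (b.basis i)) ((shift L c - b.lam i) • b.basis i),
      coeFn_potOp hc (b.basis i), Lp.coeFn_smul (shift L c - b.lam i) (b.basis i),
      b.coeFn_basis hL i, he] with x h1 h2 h3 h4 h5
    rw [h1, Pi.sub_apply, h2, h3, Pi.smul_apply, h4, smul_eq_mul]
    linarith
  rw [← inner_xiL_deriv_two hL h hF, b.inner_xiL_potOp_basis hL hc, neg_neg]

/-- In eigenfunction coordinates, `w = y - (x/L) v` solves `wᵢ' = λᵢ wᵢ + aᵢ v + bᵢ v'`. -/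
theorem coef_eq_of_isHeatSolution (hL : 0 < L) (hc : MemLp c ⊤ (volume.restrict (Ioo (0 : ℝ) L)))
    {v η : ℝ → ℝ} (hη : LocallyIntegrable η volume)
    (hv : ∀ t, 0 ≤ t → v t = ∫ s in (0 : ℝ)..t, η s) {y₀ : L2 L} {y : ℝ → L2 L}
    (hy : IsHeatSolution L c v y₀ y) (i : ι) {t : ℝ} (ht : 0 ≤ t) :
    inner ℝ (b.basis i) (y t) + b.coefB i * v t = inner ℝ (b.basis i) y₀ +
      ∫ s in (0 : ℝ)..t, (b.lam i * (inner ℝ (b.basis i) (y s) + b.coefB i * v s) +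
        (b.coefA hc i * v s + b.coefB i * η s)) := by
  obtain ⟨⟨e', e'', h1, h2⟩, -⟩ := b.eigen i
  have hw := hy.weak _ _ _ h1 t ht
  have hD := b.coefA_add_mul_coefB hL hc i h1 h2
  have e1 : ∀ s, ∫ x in (0 : ℝ)..L, y s x * b.fn i x = inner ℝ (b.basis i) (y s) := fun s => by
    rw [real_inner_comm, L2_inner_eq hL.le ae_eq_rfl (b.coeFn_basis hL i)]
  have e2 : ∀ s, ∫ x in (0 : ℝ)..L, y s x * (e'' x + c x * b.fn i x) =
      b.lam i * inner ℝ (b.basis i) (y s) := fun s => by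
    rw [← e1, ← intervalIntegral.integral_const_mul]
    refine intervalIntegral_congr_of_ae ?_ ⟨le_rfl, hL.le⟩ ⟨hL.le, le_rfl⟩
    filter_upwards [h2] with x hx
    rw [hx]; ring
  have e3 : ∫ x in (0 : ℝ)..L, y₀ x * b.fn i x = inner ℝ (b.basis i) y₀ := by
    rw [real_inner_comm, L2_inner_eq hL.le ae_eq_rfl (b.coeFn_basis hL i)]
  simp only [e1, e2, e3] at hw
  have hyc : ContinuousOn (fun s => inner ℝ (b.basis i) (y s)) (Icc 0 t) :=
    continuousOn_const.inner (hy.continuousOn.mono Icc_subset_Ici_self)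
  have hvc : ContinuousOn v (Icc 0 t) :=
    (intervalIntegral.continuous_primitive (hη.intervalIntegrable_real) 0).continuousOn.congr
      fun s hs => hv s hs.1
  have i1 := (hyc.intervalIntegrable_of_Icc (μ := volume) ht).const_mul (b.lam i)
  have i2 := (hvc.intervalIntegrable_of_Icc (μ := volume) ht).mul_const (e' L)
  have i3 := (hη.intervalIntegrable_real 0 t).const_mul (b.coefB i)
  have e4 : ∫ s in (0 : ℝ)..t, (b.lam i * (inner ℝ (b.basis i) (y s) + b.coefB i * v s) +
        (b.coefA hc i * v s + b.coefB i * η s)) =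
      (∫ s in (0 : ℝ)..t, (b.lam i * inner ℝ (b.basis i) (y s) - v s * e' L)) +
        b.coefB i * v t := by
    rw [hv t ht, ← intervalIntegral.integral_const_mul,
      ← intervalIntegral.integral_add (i1.sub i2) i3]
    refine intervalIntegral.integral_congr fun s _ => ?_
    linear_combination v s * hD
  rw [e4]
  linarith

end SpectralBasis

/-! ### Well-posedness of the heat equation with given boundary values -/

theorem shift_pos (L : ℝ) (c : ℝ → ℝ) : 0 < shift L c := by
  unfold shift; positivity

theorem continuousOn_of_eq_primitive {v η : ℝ → ℝ} (hη : LocallyIntegrable η volume)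
    (hv : ∀ t, 0 ≤ t → v t = ∫ s in (0 : ℝ)..t, η s) (t : ℝ) : ContinuousOn v (Icc 0 t) :=
  (intervalIntegral.continuous_primitive (hη.intervalIntegrable_real) 0).continuousOn.congr
      fun s hs => hv s hs.1

namespace SpectralBasis

variable {c : ℝ → ℝ} {ι : Type} (b : SpectralBasis L c ι)

theorem coef_eq_exp_of_isHeatSolution
    (hL : 0 < L) (hc : MemLp c ⊤ (volume.restrict (Ioo (0 : ℝ) L)))
    {v η : ℝ → ℝ} (hη : LocallyIntegrable η volume)
    (hv : ∀ t, 0 ≤ t → v t = ∫ s in (0 : ℝ)..t, η s) {y₀ : L2 L} {y : ℝ → L2 L}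
    (hy : IsHeatSolution L c v y₀ y) (i : ι) {t : ℝ} (ht : 0 ≤ t) :
    inner ℝ (b.basis i) (y t) + b.coefB i * v t = Real.exp (b.lam i * t) *
      (inner ℝ (b.basis i) y₀ + ∫ s in (0 : ℝ)..t,
        Real.exp (-b.lam i * s) * (b.coefA hc i * v s + b.coefB i * η s)) := by
  have hvc := continuousOn_of_eq_primitive hη hv t
  have hyc : ContinuousOn (fun s => inner ℝ (b.basis i) (y s)) (Icc 0 t) :=
    continuousOn_const.inner (hy.continuousOn.mono Icc_subset_Ici_self)
  exact eq_exp_mul_of_eq_integral (z := fun t => inner ℝ (b.basis i) (y t) + b.coefB i * v t) ht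
    (hyc.add (continuousOn_const.mul hvc))
    (((hvc.intervalIntegrable_of_Icc ht).const_mul _).add
      ((hη.intervalIntegrable_real 0 t).const_mul _))
    fun s hs => b.coef_eq_of_isHeatSolution hL hc hη hv hy i hs.1

theorem ext_inner {x y : L2 L} (h : ∀ i, inner ℝ (b.basis i) x = inner ℝ (b.basis i) y) :
    x = y := by
  apply b.basis.repr.injective
  ext i
  simp only [HilbertBasis.repr_apply_apply, h]

/-- Uniqueness for the heat equation with given boundary values. -/
theorem isHeatSolution_unique (b : SpectralBasis L c ι)
    (hL : 0 < L) (hc : MemLp c ⊤ (volume.restrict (Ioo (0 : ℝ) L)))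
    {v η : ℝ → ℝ} (hη : LocallyIntegrable η volume)
    (hv : ∀ t, 0 ≤ t → v t = ∫ s in (0 : ℝ)..t, η s) {y₀ : L2 L} {y y₂ : ℝ → L2 L}
    (hy : IsHeatSolution L c v y₀ y) (hy₂ : IsHeatSolution L c v y₀ y₂) {t : ℝ} (ht : 0 ≤ t) :
    y t = y₂ t :=
  b.ext_inner fun i => add_right_cancel
    ((b.coef_eq_exp_of_isHeatSolution hL hc hη hv hy i ht).trans
      (b.coef_eq_exp_of_isHeatSolution hL hc hη hv hy₂ i ht).symm)

theorem summable_inner_sq (x : L2 L) : Summable fun i => inner ℝ (b.basis i) x ^ 2 := by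
  have := b.basis.orthonormal.inner_products_summable x
  simpa using this

theorem exists_of_summable_sq {a : ι → ℝ} (ha : Summable fun i => a i ^ 2) :
    ∃ w : L2 L, ∀ i, inner ℝ (b.basis i) w = a i := by
  have hm : Memℓp a 2 := memℓp_gen (by simpa using ha)
  refine ⟨b.basis.repr.symm ⟨a, hm⟩, fun i => ?_⟩
  rw [← HilbertBasis.repr_apply_apply, LinearIsometryEquiv.apply_symm_apply]

theorem norm_sq_eq_tsum (x : L2 L) : ‖x‖ ^ 2 = ∑' i, inner ℝ (b.basis i) x ^ 2 := by
  rw [← real_inner_self_eq_norm_sq, ← b.basis.tsum_inner_mul_inner x x]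
  congr 1; ext i
  rw [real_inner_comm, sq]

/-- Coefficients of the solution of the heat equation, after subtraction of `(x/L) v`. -/
noncomputable def mildCoef (hc : MemLp c ⊤ (volume.restrict (Ioo (0 : ℝ) L))) (v η : ℝ → ℝ)
    (y₀ : L2 L) (i : ι) (t : ℝ) : ℝ :=
  Real.exp (b.lam i * t) * (inner ℝ (b.basis i) y₀ + ∫ s in (0 : ℝ)..t,
        Real.exp (-b.lam i * s) * (b.coefA hc i * v s + b.coefB i * η s))

/-- On bounded time intervals the coefficients are dominated by a square summable family. -/
theorem exists_mildCoef_bound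
    (hL : 0 < L) (hc : MemLp c ⊤ (volume.restrict (Ioo (0 : ℝ) L)))
    {v η : ℝ → ℝ} (hη : LocallyIntegrable η volume)
    (hv : ∀ t, 0 ≤ t → v t = ∫ s in (0 : ℝ)..t, η s) (y₀ : L2 L) (T : ℝ) :
    ∃ p : ι → ℝ, (Summable fun i => p i ^ 2) ∧
      ∀ i, ∀ t ∈ Icc 0 T, |b.mildCoef hc v η y₀ i t| ≤ p i := by
  set C1 := ∫ s in (0 : ℝ)..T, |v s|
  set C2 := ∫ s in (0 : ℝ)..T, |η s|
  set E := Real.exp (shift L c * T)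
  refine ⟨fun i => E * (|inner ℝ (b.basis i) y₀| + (|b.coefA hc i| * C1 + |b.coefB i| * C2)),
    ?_, ?_⟩
  · have h1 := b.summable_inner_sq y₀
    have h2 := b.summable_inner_sq (cxiL hc)
    have h3 := b.summable_inner_sq (xiL L)
    refine Summable.of_nonneg_of_le (fun i => sq_nonneg _) (fun i => ?_)
      (((h1.add (h2.mul_left (C1 ^ 2))).add (h3.mul_left (C2 ^ 2))).mul_left (3 * E ^ 2))
    rw [mul_pow]
    have e1 : inner ℝ (b.basis i) (cxiL hc) ^ 2 = |b.coefA hc i| ^ 2 := (sq_abs _).symm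
    have e2 : inner ℝ (b.basis i) (xiL L) ^ 2 = |b.coefB i| ^ 2 := by
      rw [coefB, abs_neg, sq_abs]
    rw [e1, e2, ← sq_abs (inner ℝ (b.basis i) y₀)]
    set p := |inner ℝ (b.basis i) y₀|
    set q := |b.coefA hc i| * C1 with hq
    set r := |b.coefB i| * C2 with hr
    have e3 : 3 * E ^ 2 * (p ^ 2 + C1 ^ 2 * |b.coefA hc i| ^ 2 + C2 ^ 2 * |b.coefB i| ^ 2) =
      E ^ 2 * (3 * (p ^ 2 + q ^ 2 + r ^ 2)) := by rw [hq, hr]; ring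
    rw [e3]
    refine mul_le_mul_of_nonneg_left ?_ (sq_nonneg E)
    nlinarith [sq_nonneg (p - q), sq_nonneg (p - r), sq_nonneg (q - r)]
  · intro i t ht
    have hexp : ∀ s ∈ Icc 0 t, Real.exp (b.lam i * (t - s)) ≤ E := by
      intro s hs
      refine Real.exp_le_exp.2 ?_
      have h1 := b.shift_sub_pos hL hc i
      have h2 := shift_pos L c
      have h3 : 0 ≤ t - s := by linarith [hs.2]
      have h4 : t - s ≤ T := by linarith [hs.1, ht.2]
      nlinarith
    have hvi : IntervalIntegrable v volume 0 T :=
      (continuousOn_of_eq_primitive hη hv T).intervalIntegrable_of_Icc (ht.1.trans ht.2)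
    have hηi := hη.intervalIntegrable_real 0 T
    have hsub : uIcc 0 t ⊆ uIcc 0 T := by
      rw [uIcc_of_le ht.1, uIcc_of_le (ht.1.trans ht.2)]; exact Icc_subset_Icc le_rfl ht.2
    have hI : |∫ s in (0 : ℝ)..t, Real.exp (b.lam i * (t - s)) *
        (b.coefA hc i * v s + b.coefB i * η s)| ≤
        E * (|b.coefA hc i| * C1 + |b.coefB i| * C2) := by
      have hbd : IntervalIntegrable (fun s => E * (|b.coefA hc i| * |v s| + |b.coefB i| * |η s|))
          volume 0 T := ((hvi.abs.const_mul _).add (hηi.abs.const_mul _)).const_mul E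
      have h1 := intervalIntegral.norm_integral_le_of_norm_le (μ := volume) ht.1
        (f := fun s => Real.exp (b.lam i * (t - s)) *
        (b.coefA hc i * v s + b.coefB i * η s))
        (g := fun s => E * (|b.coefA hc i| * |v s| + |b.coefB i| * |η s|))
        (Eventually.of_forall fun s hs => by
          rw [Real.norm_eq_abs, abs_mul, abs_of_pos (Real.exp_pos _)]
          refine mul_le_mul (hexp s (Ioc_subset_Icc_self hs)) ?_ (abs_nonneg _) (Real.exp_pos _).le
          rw [← abs_mul, ← abs_mul]
          exact abs_add_le _ _) (hbd.mono_set hsub)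
      rw [Real.norm_eq_abs] at h1
      refine h1.trans ?_
      have h2 : ∫ s in (0 : ℝ)..t, E * (|b.coefA hc i| * |v s| + |b.coefB i| * |η s|) ≤
          ∫ s in (0 : ℝ)..T, E * (|b.coefA hc i| * |v s| + |b.coefB i| * |η s|) := by
        refine intervalIntegral.integral_mono_interval le_rfl ht.1 ht.2
          (Eventually.of_forall fun s => ?_) hbd
        simp only [Pi.zero_apply]; positivity
      refine h2.trans (le_of_eq ?_)
      rw [intervalIntegral.integral_const_mul, intervalIntegral.integral_add
        (hvi.abs.const_mul _) (hηi.abs.const_mul _), intervalIntegral.integral_const_mul,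
        intervalIntegral.integral_const_mul]
    have hsplit : b.mildCoef hc v η y₀ i t = Real.exp (b.lam i * (t - 0)) *
        inner ℝ (b.basis i) y₀ + ∫ s in (0 : ℝ)..t, Real.exp (b.lam i * (t - s)) *
        (b.coefA hc i * v s + b.coefB i * η s) := by
      rw [mildCoef, mul_add, ← intervalIntegral.integral_const_mul, sub_zero]
      congr 2; ext s
      rw [← mul_assoc, ← Real.exp_add]
      congr 2; ring
    rw [hsplit]
    change _ ≤ E * (_ + _)
    rw [mul_add]
    refine (abs_add_le _ _).trans (add_le_add ?_ hI)
    rw [abs_mul, abs_of_pos (Real.exp_pos _)]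
    exact mul_le_mul_of_nonneg_right (hexp 0 ⟨le_rfl, ht.1⟩) (abs_nonneg _)

theorem continuousOn_mildCoef (hc : MemLp c ⊤ (volume.restrict (Ioo (0 : ℝ) L)))
    {v η : ℝ → ℝ} (hη : LocallyIntegrable η volume)
    (hv : ∀ t, 0 ≤ t → v t = ∫ s in (0 : ℝ)..t, η s) (y₀ : L2 L) (i : ι) {T : ℝ} (hT : 0 ≤ T) :
    ContinuousOn (b.mildCoef hc v η y₀ i) (Icc 0 T) := by
  have hvi : IntervalIntegrable v volume 0 T :=
      (continuousOn_of_eq_primitive hη hv T).intervalIntegrable_of_Icc hT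
  have hi : IntervalIntegrable (fun s => Real.exp (-b.lam i * s) *
      (b.coefA hc i * v s + b.coefB i * η s)) volume 0 T :=
    ((hvi.const_mul _).add ((hη.intervalIntegrable_real 0 T).const_mul _)).continuousOn_mul
      (by fun_prop)
  have h := intervalIntegral.continuousOn_primitive_interval' hi left_mem_uIcc
  rw [uIcc_of_le hT] at h
  exact ContinuousOn.mul (by fun_prop) (h.const_add _)

theorem exists_continuousOn_mild
    (hL : 0 < L) (hc : MemLp c ⊤ (volume.restrict (Ioo (0 : ℝ) L)))
    {v η : ℝ → ℝ} (hη : LocallyIntegrable η volume)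
    (hv : ∀ t, 0 ≤ t → v t = ∫ s in (0 : ℝ)..t, η s) (y₀ : L2 L) :
    ∃ w : ℝ → L2 L, ContinuousOn w (Ici 0) ∧
      ∀ i, ∀ t, 0 ≤ t → inner ℝ (b.basis i) (w t) = b.mildCoef hc v η y₀ i t := by
  have hex : ∀ t, ∃ w : L2 L, 0 ≤ t → ∀ i, inner ℝ (b.basis i) w = b.mildCoef hc v η y₀ i t := by
    intro t
    by_cases ht : 0 ≤ t
    · obtain ⟨p, hp, hb⟩ := b.exists_mildCoef_bound hL hc hη hv y₀ t
      obtain ⟨w, hw⟩ := b.exists_of_summable_sq (a := fun i => b.mildCoef hc v η y₀ i t)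
        (Summable.of_nonneg_of_le (fun i => sq_nonneg _)
          (fun i => sq_le_sq' (by linarith [(abs_le.1 (hb i t ⟨ht, le_rfl⟩)).1])
            (abs_le.1 (hb i t ⟨ht, le_rfl⟩)).2) hp)
      exact ⟨w, fun _ => hw⟩
    · exact ⟨0, fun h => absurd h ht⟩
  choose w hw using hex
  refine ⟨w, ?_, fun i t ht => hw t ht i⟩
  intro s hs
  have hs0 : (0 : ℝ) ≤ s := hs
  set T := s + 1 with hT
  have hT0 : 0 ≤ T := by linarith
  obtain ⟨p, hp, hb⟩ := b.exists_mildCoef_bound hL hc hη hv y₀ T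
  -- `‖w t - w s‖²` is a uniformly convergent sum of continuous functions of `t`.
  have hF : ContinuousOn
      (fun t => ∑' i, (b.mildCoef hc v η y₀ i t - b.mildCoef hc v η y₀ i s) ^ 2) (Icc 0 T) := by
    refine continuousOn_tsum (u := fun i => 4 * p i ^ 2)
      (fun i => ((b.continuousOn_mildCoef hc hη hv y₀ i hT0).sub continuousOn_const).pow 2)
      (hp.mul_left 4) fun i t ht => ?_
    have h1 := abs_le.1 (hb i t ht)
    have h2 := abs_le.1 (hb i s ⟨hs, by linarith⟩)
    rw [Real.norm_eq_abs, abs_of_nonneg (sq_nonneg _)]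
    nlinarith
  have hFeq : ∀ t, 0 ≤ t → ‖w t - w s‖ ^ 2 =
      ∑' i, (b.mildCoef hc v η y₀ i t - b.mildCoef hc v η y₀ i s) ^ 2 := by
    intro t ht
    rw [b.norm_sq_eq_tsum]
    simp only [inner_sub_right, hw t ht, hw s hs]
  have h1 : Tendsto (fun t => ‖w t - w s‖ ^ 2) (𝓝[Ici 0] s) (𝓝 0) := by
    have hmem : Icc 0 T ∈ 𝓝[Ici 0] s := by
      rw [← Ici_inter_Iic]
      exact inter_mem_nhdsWithin _ (Iic_mem_nhds (by linarith))
    have h2 := (hF s ⟨hs, by linarith⟩).mono_of_mem_nhdsWithin hmem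
    have h3 : Tendsto _ (𝓝[Ici 0] s) (𝓝 _) := h2
    simp only [sub_self, zero_pow two_ne_zero, tsum_zero] at h3
    refine h3.congr' ?_
    filter_upwards [self_mem_nhdsWithin] with t ht
    exact (hFeq t ht).symm
  rw [ContinuousWithinAt, tendsto_iff_norm_sub_tendsto_zero]
  have h4 := (Real.continuous_sqrt.tendsto 0).comp h1
  simpa [Function.comp_def, Real.sqrt_sq (norm_nonneg _)] using h4

/-- The weak formulation tested with `eᵢ`. -/
theorem mildCoef_eq_add_integral (hc : MemLp c ⊤ (volume.restrict (Ioo (0 : ℝ) L)))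
    {v η : ℝ → ℝ} (hη : LocallyIntegrable η volume)
    (hv : ∀ t, 0 ≤ t → v t = ∫ s in (0 : ℝ)..t, η s) (y₀ : L2 L) (i : ι) {t : ℝ} (ht : 0 ≤ t) :
    b.mildCoef hc v η y₀ i t - b.coefB i * v t = inner ℝ (b.basis i) y₀ +
      b.lam i * (∫ s in (0 : ℝ)..t, (b.mildCoef hc v η y₀ i s - b.coefB i * v s)) +
      (b.coefA hc i + b.lam i * b.coefB i) * ∫ s in (0 : ℝ)..t, v s := by
  have hvi : IntervalIntegrable v volume 0 t :=
    (continuousOn_of_eq_primitive hη hv t).intervalIntegrable_of_Icc ht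
  have hηi := hη.intervalIntegrable_real 0 t
  have hwi : IntervalIntegrable (b.mildCoef hc v η y₀ i) volume 0 t :=
    (b.continuousOn_mildCoef hc hη hv y₀ i ht).intervalIntegrable_of_Icc ht
  have h1 := exp_mul_eq_add_integral (μ := b.lam i) (z := b.mildCoef hc v η y₀ i) ht
    ((hvi.const_mul (b.coefA hc i)).add (hηi.const_mul (b.coefB i))) (fun s _ => rfl)
  rw [intervalIntegral.integral_add (hwi.const_mul _)
    ((hvi.const_mul _).add (hηi.const_mul _)), intervalIntegral.integral_add (hvi.const_mul _)
    (hηi.const_mul _), intervalIntegral.integral_const_mul, intervalIntegral.integral_const_mul,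
    intervalIntegral.integral_const_mul, ← hv t ht] at h1
  rw [intervalIntegral.integral_sub hwi (hvi.const_mul _), intervalIntegral.integral_const_mul, h1]
  ring

/-- Existence for the heat equation with absolutely continuous boundary values. -/
theorem exists_isHeatSolution (b : SpectralBasis L c ι)
    (hL : 0 < L) (hc : MemLp c ⊤ (volume.restrict (Ioo (0 : ℝ) L)))
    {v η : ℝ → ℝ} (hη : LocallyIntegrable η volume)
    (hv : ∀ t, 0 ≤ t → v t = ∫ s in (0 : ℝ)..t, η s) (y₀ : L2 L) :
    ∃ y, IsHeatSolution L c v y₀ y := by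
  obtain ⟨w, hwc, hw⟩ := b.exists_continuousOn_mild hL hc hη hv y₀
  have hvc : ContinuousOn v (Ici 0) :=
    (intervalIntegral.continuous_primitive (hη.intervalIntegrable_real) 0).continuousOn.congr hv
  set y : ℝ → L2 L := fun t => w t + v t • xiL L with hy
  have hyc : ContinuousOn y (Ici 0) := hwc.add (hvc.smul continuousOn_const)
  have hcoef : ∀ i t, 0 ≤ t →
      inner ℝ (b.basis i) (y t) = b.mildCoef hc v η y₀ i t - b.coefB i * v t := by
    intro i t ht
    rw [hy, inner_add_right, hw i t ht, real_inner_smul_right, coefB]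
    ring
  refine ⟨y, hyc, ?_, ?_⟩
  · refine b.ext_inner fun i => ?_
    rw [hcoef i 0 le_rfl, hv 0 le_rfl, mildCoef]
    simp
  intro φ φ' φ'' h t ht
  have hyi : IntervalIntegrable y volume 0 t :=
    (hyc.mono Icc_subset_Ici_self).intervalIntegrable_of_Icc ht
  have hvi : IntervalIntegrable v volume 0 t :=
    (hvc.mono Icc_subset_Ici_self).intervalIntegrable_of_Icc ht
  have hint : ∀ k : L2 L, ∫ s in (0 : ℝ)..t, inner ℝ k (y s) =
      inner ℝ k (∫ s in (0 : ℝ)..t, y s) := fun k =>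
    (innerSL ℝ k).intervalIntegral_comp_comm hyi
  -- Every test function is `φ = T f`. Both sides of the weak formulation are continuous functionals
  -- of `f`, so that it suffices to compare them on the basis vectors.
  set T := resolventOp hL hc with hT
  set Q := potOp hc with hQ
  have hfun : (innerSL ℝ (y t - y₀)) ∘L T =
      (innerSL ℝ (∫ s in (0 : ℝ)..t, y s)) ∘L (shift L c • T - 1) -
        (∫ s in (0 : ℝ)..t, v s) • ((innerSL ℝ (xiL L)) ∘L (Q ∘L T - 1)) := by
    refine ContinuousLinearMap.ext_on
      (Submodule.dense_iff_topologicalClosure_eq_top.2 b.basis.dense_span) ?_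
    rintro _ ⟨i, rfl⟩
    have hρ := (b.shift_sub_pos hL hc i).ne'
    have e1 := b.mildCoef_eq_add_integral hc hη hv y₀ i ht
    rw [← hcoef i t ht] at e1
    have e2 : ∫ s in (0 : ℝ)..t, (b.mildCoef hc v η y₀ i s - b.coefB i * v s) =
        inner ℝ (b.basis i) (∫ s in (0 : ℝ)..t, y s) := by
      rw [← hint]
      refine intervalIntegral.integral_congr fun s hs => ?_
      rw [uIcc_of_le ht] at hs
      exact (hcoef i s hs.1).symm
    rw [e2] at e1
    have e3 := b.inner_xiL_potOp_basis hL hc i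
    rw [inner_sub_right, real_inner_smul_right] at e3
    have e4 : T (b.basis i) = (shift L c - b.lam i)⁻¹ • b.basis i := b.resolventOp_basis hL hc i
    simp only [ContinuousLinearMap.comp_apply, _root_.sub_apply, _root_.smul_apply,
      one_apply_eq_self, innerSL_apply_apply, e4, map_smul, inner_sub_right,
      real_inner_smul_right, inner_sub_left, smul_eq_mul]
    rw [real_inner_comm (b.basis i) (y t), real_inner_comm (b.basis i) y₀,
      real_inner_comm (b.basis i) (∫ s in (0 : ℝ)..t, y s), e1]
    field_simp
    linear_combination (∫ s in (0 : ℝ)..t, v s) * e3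
  have hΦ := coeFn_toL2 (h.deriv_one.memLp_two hL.le)
  set Φ := toL2 L φ
  have hΨ := coeFn_toL2 h.deriv_two.memLp
  set Ψ := toL2 L φ''
  have hTf : T (Q Φ - Ψ) = Φ := by
    refine resolventOp_eq hL hc h hΦ ?_
    filter_upwards [Lp.coeFn_sub (Q Φ) Ψ, coeFn_potOp hc Φ, hΦ, hΨ] with x h1 h2 h3 h4
    rw [h1, Pi.sub_apply, h2, h3, h4]
    ring
  have happ := congrArg (fun S : L2 L →L[ℝ] ℝ => S (Q Φ - Ψ)) hfun
  simp only [ContinuousLinearMap.comp_apply, _root_.sub_apply, _root_.smul_apply,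
      one_apply_eq_self, innerSL_apply_apply, hTf, sub_sub_cancel, smul_eq_mul] at happ
  rw [inner_xiL_deriv_two hL h hΨ, inner_sub_left,
    real_inner_comm _ (∫ s in (0 : ℝ)..t, y s), ← hint] at happ
  have hF : (shift L c • Φ - (Q Φ - Ψ) : L2 L) =ᵐ[volume.restrict (Ioo (0 : ℝ) L)]
      fun x => φ'' x + c x * φ x := by
    filter_upwards [Lp.coeFn_sub (shift L c • Φ) (Q Φ - Ψ), Lp.coeFn_smul (shift L c) Φ,
      Lp.coeFn_sub (Q Φ) Ψ, coeFn_potOp hc Φ, hΦ, hΨ] with x h1 h2 h3 h4 h5 h6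
    rw [h1, Pi.sub_apply, h2, Pi.smul_apply, h3, Pi.sub_apply, h4, h5, h6, smul_eq_mul]
    ring
  rw [← L2_inner_eq hL.le ae_eq_rfl hΦ, ← L2_inner_eq hL.le ae_eq_rfl hΦ, happ]
  have e5 : ∀ s, ∫ x in (0 : ℝ)..L, y s x * (φ'' x + c x * φ x) =
      inner ℝ (shift L c • Φ - (Q Φ - Ψ)) (y s) := fun s => by
    rw [real_inner_comm, L2_inner_eq hL.le ae_eq_rfl hF]
  simp only [e5]
  rw [intervalIntegral.integral_sub _ (hvi.mul_const _), intervalIntegral.integral_mul_const]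
  exact ContinuousOn.intervalIntegrable_of_Icc ht
    (continuousOn_const.inner (hyc.mono Icc_subset_Ici_self))

end SpectralBasis

/-! ### Matrix exponentials -/

section MatrixExp

variable {m : Type*} [Fintype m] [DecidableEq m]

theorem Matrix.hasDerivAt_exp_smul_apply (A : Matrix m m ℝ) (s : ℝ) (i k : m) :
    HasDerivAt (fun s : ℝ => NormedSpace.exp (s • A) i k)
      ((NormedSpace.exp (s • A) * A) i k) s := by
  let _ : NormedRing (Matrix m m ℝ) := Matrix.linftyOpNormedRing
  let _ : NormedAlgebra ℝ (Matrix m m ℝ) := Matrix.linftyOpNormedAlgebra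
  have h := hasDerivAt_exp_smul_const (𝕂 := ℝ) A s
  exact ((Matrix.entryLinearMap ℝ ℝ i k).toContinuousLinearMap.hasFDerivAt).comp_hasDerivAt s h

theorem Matrix.continuous_exp_smul_apply (A : Matrix m m ℝ) (i k : m) :
    Continuous fun s : ℝ => NormedSpace.exp (s • A) i k :=
  continuous_iff_continuousAt.2 fun s => (A.hasDerivAt_exp_smul_apply s i k).continuousAt

theorem Matrix.continuous_exp_smul_mulVec (A : Matrix m m ℝ) (x : m → ℝ) :
    Continuous fun s : ℝ => NormedSpace.exp (s • A) *ᵥ x := by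
  refine continuous_pi fun i => ?_
  simp only [mulVec, dotProduct]
  exact continuous_finsetSum _ fun k _ => (A.continuous_exp_smul_apply i k).mul continuous_const

theorem Matrix.exp_smul_add (A : Matrix m m ℝ) (r s : ℝ) :
    NormedSpace.exp ((r + s) • A) = NormedSpace.exp (r • A) * NormedSpace.exp (s • A) := by
  rw [add_smul]
  exact Matrix.exp_add_of_commute _ _ ((Commute.refl A).smul_left r |>.smul_right s)

theorem Matrix.exp_smul_mulVec_mulVec (A : Matrix m m ℝ) (r s : ℝ) (x : m → ℝ) :
    NormedSpace.exp (r • A) *ᵥ (NormedSpace.exp (s • A) *ᵥ x) =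
      NormedSpace.exp ((r + s) • A) *ᵥ x := by
  rw [mulVec_mulVec, A.exp_smul_add]

theorem Matrix.exp_zero_smul (A : Matrix m m ℝ) : NormedSpace.exp ((0 : ℝ) • A) = 1 := by
  rw [zero_smul, NormedSpace.exp_zero]

/-- On a bounded interval of times, `e^{rA}` is uniformly bounded. -/
theorem Matrix.exists_norm_exp_smul_mulVec_le (A : Matrix m m ℝ) (a b : ℝ) :
    ∃ C, 0 ≤ C ∧ ∀ r ∈ Icc a b, ∀ x : m → ℝ, ‖NormedSpace.exp (r • A) *ᵥ x‖ ≤ C * ‖x‖ := by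
  let _ : NormedRing (Matrix m m ℝ) := Matrix.linftyOpNormedRing
  let _ : NormedAlgebra ℝ (Matrix m m ℝ) := Matrix.linftyOpNormedAlgebra
  have hc : Continuous fun r : ℝ => NormedSpace.exp (r • A) :=
    continuous_iff_continuousAt.2 fun s => (hasDerivAt_exp_smul_const (𝕂 := ℝ) A s).continuousAt
  obtain ⟨C, hC⟩ := isCompact_Icc.exists_bound_of_continuousOn (s := Icc a b) hc.continuousOn
  refine ⟨|C|, abs_nonneg _, fun r hr x => ?_⟩
  exact (Matrix.linfty_opNorm_mulVec _ _).trans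
    (mul_le_mul_of_nonneg_right ((hC r hr).trans (le_abs_self C)) (norm_nonneg _))

/-- If `-1` is the only eigenvalue of `M`, then `e^{tM}` decays like `e^{-t/2}`. -/
theorem Matrix.exists_norm_exp_smul_mulVec_le_of_charpoly {M : Matrix m m ℝ} {N : ℕ}
    (hM : M.charpoly = (Polynomial.X + 1) ^ N) :
    ∃ C, 0 ≤ C ∧ ∀ t : ℝ, 0 ≤ t → ∀ x : m → ℝ,
      ‖NormedSpace.exp (t • M) *ᵥ x‖ ≤ C * Real.exp (-(1 / 2) * t) * ‖x‖ := by
  let _ : NormedRing (Matrix m m ℝ) := Matrix.linftyOpNormedRing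
  let _ : NormedAlgebra ℝ (Matrix m m ℝ) := Matrix.linftyOpNormedAlgebra
  have hnil : (M + 1) ^ N = 0 := by
    have := Matrix.aeval_self_charpoly M
    rw [hM] at this
    simpa using this
  set S := M + 1 with hS
  refine ⟨‖(1 : Matrix m m ℝ)‖ * ∑ k ∈ Finset.range N, 2 ^ k * ‖S ^ k‖, by positivity,
    fun t ht x => ?_⟩
  refine (Matrix.linfty_opNorm_mulVec _ _).trans (mul_le_mul_of_nonneg_right ?_ (norm_nonneg _))
  have h1 : t • M = (-t) • (1 : Matrix m m ℝ) + t • S := by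
    rw [hS, smul_add, neg_smul]; abel
  have hcomm : Commute ((-t) • (1 : Matrix m m ℝ)) (t • S) :=
    ((Commute.one_left S).smul_left (-t)).smul_right t
  have h2 : NormedSpace.exp ((-t) • (1 : Matrix m m ℝ)) = Real.exp (-t) • 1 := by
    have := NormedSpace.algebraMap_exp_comm (𝕂 := ℝ) (𝔸 := Matrix m m ℝ) (-t)
    rw [← Real.exp_eq_exp_ℝ, Algebra.algebraMap_eq_smul_one, Algebra.algebraMap_eq_smul_one] at this
    exact this.symm
  -- The exponential series of the nilpotent matrix `tS` is a finite sum.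
  have h3 : NormedSpace.exp (t • S) =
      ∑ k ∈ Finset.range N, ((k.factorial : ℝ)⁻¹) • (t • S) ^ k := by
    refine (NormedSpace.exp_series_hasSum_exp' (𝕂 := ℝ) (t • S)).unique
      (hasSum_sum_of_ne_finset_zero fun k hk => ?_)
    rw [Finset.mem_range, not_lt] at hk
    rw [smul_pow, pow_eq_zero_of_le hk hnil, smul_zero, smul_zero]
  rw [h1, Matrix.exp_add_of_commute _ _ hcomm, h2, h3]
  have h4 : ‖∑ k ∈ Finset.range N, ((k.factorial : ℝ)⁻¹) • (t • S) ^ k‖ ≤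
      Real.exp (t / 2) * ∑ k ∈ Finset.range N, 2 ^ k * ‖S ^ k‖ := by
    rw [Finset.mul_sum]
    refine norm_sum_le_of_le _ fun k _ => ?_
    rw [smul_pow, norm_smul, norm_smul, ← mul_assoc, ← mul_assoc]
    refine mul_le_mul_of_nonneg_right ?_ (norm_nonneg _)
    have h5 := Real.pow_div_factorial_le_exp (t / 2) (by positivity) k
    rw [norm_inv, norm_pow, Real.norm_eq_abs, Real.norm_eq_abs, abs_of_nonneg ht,
      abs_of_nonneg (by positivity : (0 : ℝ) ≤ k.factorial)]
    calc (k.factorial : ℝ)⁻¹ * t ^ k = (t / 2) ^ k / k.factorial * 2 ^ k := by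
          rw [div_pow]; field_simp
      _ ≤ _ := by gcongr
  rw [smul_mul_assoc, norm_smul, Real.norm_eq_abs, abs_of_pos (Real.exp_pos _)]
  have h6 : Real.exp (-t) * Real.exp (t / 2) = Real.exp (-(1 / 2) * t) := by
    rw [← Real.exp_add]; congr 1; ring
  calc _ ≤ Real.exp (-t) * (‖(1 : Matrix m m ℝ)‖ *
        (Real.exp (t / 2) * ∑ k ∈ Finset.range N, 2 ^ k * ‖S ^ k‖)) := by
        gcongr; exact (norm_mul_le _ _).trans (by gcongr)
    _ = _ := by rw [← h6]; ring

/-- Variation of constants for a linear system in integral form. -/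
theorem Matrix.exp_neg_smul_mulVec_eq (A : Matrix m m ℝ) {X g : ℝ → m → ℝ} {X₀ : m → ℝ} {t : ℝ}
    (ht : 0 ≤ t) (hX : ∀ i, ContinuousOn (fun s => X s i) (Icc 0 t))
    (hg : ∀ i, IntervalIntegrable (fun s => g s i) volume 0 t)
    (h : ∀ s ∈ Icc 0 t, ∀ i, X s i = X₀ i + ∫ r in (0 : ℝ)..s, ((A *ᵥ X r) i + g r i)) (i : m) :
    (NormedSpace.exp ((-t) • A) *ᵥ X t) i =
      X₀ i + ∫ s in (0 : ℝ)..t, (NormedSpace.exp ((-s) • A) *ᵥ g s) i := by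
  have h0 : ∀ k, X 0 k = X₀ k := fun k => by simpa using h 0 ⟨le_rfl, ht⟩ k
  have hAX : ∀ k, IntervalIntegrable (fun r => (A *ᵥ X r) k + g r k) volume 0 t := fun k => by
    refine (ContinuousOn.intervalIntegrable_of_Icc ht ?_).add (hg k)
    simp only [mulVec, dotProduct]
    exact continuousOn_finsetSum _ fun l _ => continuousOn_const.mul (hX l)
  set E : m → ℝ → ℝ := fun k s => NormedSpace.exp ((-s) • A) i k with hE
  set E' : m → ℝ → ℝ := fun k s => -(NormedSpace.exp ((-s) • A) * A) i k with hE'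
  have hd : ∀ k s, HasDerivAt (E k) (E' k s) s := fun k s => by
    have := (A.hasDerivAt_exp_smul_apply (-s) i k).comp s (hasDerivAt_neg s)
    rw [mul_neg_one] at this
    exact this
  have hEc : ∀ k, Continuous (E k) := fun k =>
    continuous_iff_continuousAt.2 fun s => (hd k s).continuousAt
  have hEc' : ∀ k, Continuous (E' k) := fun k => by
    have : E' k = fun s => -∑ l, E l s * A l k := by
      ext s; simp [hE', hE, Matrix.mul_apply]
    rw [this]
    exact (continuous_finsetSum _ fun l _ => (hEc l).mul continuous_const).neg
  have hk : ∀ k, ∫ s in (0 : ℝ)..t, (E' k s * X s k + E k s * ((A *ᵥ X s) k + g s k)) =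
      E k t * X t k - E k 0 * X 0 k := fun k =>
    integral_mul_add_mul_of_eq_integral ht (g := fun s => X s k)
      ((hEc' k).intervalIntegrable _ _) (hAX k)
      (fun x _ => by
        rw [intervalIntegral.integral_eq_sub_of_hasDerivAt (fun s _ => hd k s)
          ((hEc' k).intervalIntegrable _ _)]
        ring)
      (fun x hx => by rw [h0]; exact h x hx k)
  have hki : ∀ k, IntervalIntegrable
      (fun s => E' k s * X s k + E k s * ((A *ᵥ X s) k + g s k)) volume 0 t := fun k =>
    (ContinuousOn.intervalIntegrable_of_Icc ht ((hEc' k).continuousOn.mul (hX k))).add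
      ((hAX k).continuousOn_mul (hEc k).continuousOn)
  have hsum : ∀ s, ∑ k, (E' k s * X s k + E k s * ((A *ᵥ X s) k + g s k)) =
      (NormedSpace.exp ((-s) • A) *ᵥ g s) i := by
    intro s
    have e1 : ∑ k, E' k s * X s k = -((NormedSpace.exp ((-s) • A) * A) *ᵥ X s) i := by
      simp [hE', mulVec, dotProduct]
    have e2 : ∑ k, E k s * (A *ᵥ X s) k = ((NormedSpace.exp ((-s) • A)) *ᵥ (A *ᵥ X s)) i := rfl
    have e3 : ∑ k, E k s * g s k = ((NormedSpace.exp ((-s) • A)) *ᵥ g s) i := rfl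
    simp only [mul_add, Finset.sum_add_distrib]
    rw [e1, e2, e3, mulVec_mulVec]
    ring
  have htot : ∫ s in (0 : ℝ)..t, (NormedSpace.exp ((-s) • A) *ᵥ g s) i =
      ∑ k, (E k t * X t k - E k 0 * X 0 k) := by
    simp only [← hsum, ← hk]
    exact intervalIntegral.integral_finsetSum fun k _ => hki k
  have e4 : ∑ k, E k t * X t k = (NormedSpace.exp ((-t) • A) *ᵥ X t) i := rfl
  have e5 : ∑ k, E k 0 * X 0 k = X₀ i := by
    have : ∀ k, E k 0 = (1 : Matrix m m ℝ) i k := fun k => by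
      simp [hE]
    simp only [this, h0]
    have := congrFun (one_mulVec X₀) i
    simpa [mulVec, dotProduct] using this
  rw [htot, Finset.sum_sub_distrib, e4, e5]
  ring

end MatrixExp

/-! ### Pole placement -/

section PolePlacement

open Polynomial in
/-- A polynomial of degree at most `n` that vanishes at `n` distinct points is determined by its
coefficient of degree `n`. -/
theorem eq_C_mul_prod_of_eval_eq_zero {n : ℕ} {lam : Fin n → ℝ} (hlam : Function.Injective lam)
    {p : ℝ[X]} (hp : p.natDegree ≤ n) (h : ∀ j, p.eval (lam j) = 0) :
    p = C (p.coeff n) * ∏ j, (X - C (lam j)) := by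
  have hm : (∏ j, (X - C (lam j))).Monic := monic_prod_of_monic _ _ fun j _ => monic_X_sub_C _
  have hd : (∏ j, (X - C (lam j))).natDegree = n := by
    rw [natDegree_prod_of_monic _ _ fun j _ => monic_X_sub_C _]; simp
  rw [← sub_eq_zero]
  refine eq_zero_of_degree_lt_of_eval_index_eq_zero (s := Finset.univ) (v := lam)
    hlam.injOn ?_ fun j _ => ?_
  · rw [Finset.card_univ, Fintype.card_fin]
    rw [degree_lt_iff_coeff_zero]
    intro k hk
    rcases hk.eq_or_lt with rfl | hk
    · rw [coeff_sub, coeff_C_mul]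
      have := hm.coeff_natDegree
      rw [hd] at this
      rw [this]; ring
    · rw [coeff_sub, coeff_C_mul, coeff_eq_zero_of_natDegree_lt (hp.trans_lt hk),
        coeff_eq_zero_of_natDegree_lt (hd.trans_lt hk)]
      ring
  · rw [eval_sub, h, eval_mul, eval_prod, Finset.prod_eq_zero (Finset.mem_univ j) (by simp)]
    simp

variable {n : ℕ} (lam a b : Fin n → ℝ)

/-- The characteristic polynomial of the closed-loop matrix off the spectrum of the diagonal
block. -/
theorem eval_charpoly_fromBlocks_add_vecMulVec (k : Idx n → ℝ) {s : ℝ} (hs : ∀ j, s ≠ lam j) :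
    (Matrix.fromBlocks 0 0 (Matrix.of fun j _ => a j) (Matrix.diagonal lam) +
      Matrix.vecMulVec (Sum.elim (fun _ => 1) b) k : Matrix (Idx n) (Idx n) ℝ).charpoly.eval s =
    (∏ j, (s - lam j)) * (s - k (Sum.inl ()) -
      ∑ j, k (Sum.inr j) * (a j + b j * s) / (s - lam j)) := by
  rw [Matrix.eval_charpoly]
  -- Subtract `b j` times the first row from the row of index `j`.
  set R : Matrix (Idx n) (Idx n) ℝ := Matrix.fromBlocks 1 0 (Matrix.of fun j _ => -b j) 1 with hR
  have hRdet : R.det = 1 := by rw [hR, Matrix.det_fromBlocks_zero₁₂]; simp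
  have hmul : R * (Matrix.scalar (Idx n) s - (Matrix.fromBlocks 0 0 (Matrix.of fun j _ => a j)
      (Matrix.diagonal lam) + Matrix.vecMulVec (Sum.elim (fun _ => 1) b) k)) =
      Matrix.fromBlocks (Matrix.of fun _ _ => s - k (Sum.inl ()))
        (Matrix.of fun _ j => -k (Sum.inr j)) (Matrix.of fun j _ => -(a j + b j * s))
        (Matrix.diagonal fun j => s - lam j) := by
    ext i j
    rcases i with i | i <;> rcases j with j | j
    · simp [hR, Matrix.mul_apply, Matrix.vecMulVec_apply]
    · simp [hR, Matrix.mul_apply, Matrix.vecMulVec_apply, Matrix.diagonal_apply]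
    · simp [hR, Matrix.mul_apply, Matrix.vecMulVec_apply, Matrix.diagonal_apply, Matrix.one_apply]
      ring
    · simp [hR, Matrix.mul_apply, Matrix.vecMulVec_apply, Matrix.diagonal_apply, Matrix.one_apply]
      split_ifs <;> ring
  have hdet : (Matrix.scalar (Idx n) s - (Matrix.fromBlocks 0 0 (Matrix.of fun j _ => a j)
      (Matrix.diagonal lam) + Matrix.vecMulVec (Sum.elim (fun _ => 1) b) k)).det =
      (R * (Matrix.scalar (Idx n) s - (Matrix.fromBlocks 0 0 (Matrix.of fun j _ => a j)
      (Matrix.diagonal lam) + Matrix.vecMulVec (Sum.elim (fun _ => 1) b) k))).det := by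
    rw [Matrix.det_mul, hRdet, one_mul]
  rw [hdet, hmul]
  have hne : ∀ j, s - lam j ≠ 0 := fun j => sub_ne_zero.2 (hs j)
  have hinv : (Matrix.diagonal fun j => s - lam j) *
      (Matrix.diagonal fun j => (s - lam j)⁻¹) = 1 := by
    rw [Matrix.diagonal_mul_diagonal, ← Matrix.diagonal_one]
    congr 1; ext j; exact mul_inv_cancel₀ (hne j)
  let _ : Invertible (Matrix.diagonal fun j => s - lam j) := ⟨_, mul_eq_one_comm.1 hinv, hinv⟩
  have hinvOf : ⅟(Matrix.diagonal fun j => s - lam j) = Matrix.diagonal fun j => (s - lam j)⁻¹ :=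
    invOf_eq_right_inv hinv
  rw [Matrix.det_fromBlocks₂₂, hinvOf, Matrix.det_diagonal, Matrix.det_unique]
  congr 1
  simp only [Matrix.sub_apply, Matrix.of_apply, Matrix.mul_apply, Matrix.diagonal_apply,
    mul_ite, mul_zero, Finset.sum_ite_eq', Finset.mem_univ, if_true]
  congr 1
  refine Finset.sum_congr rfl fun j _ => ?_
  ring

open Polynomial in
/-- Pole placement: with distinct `λⱼ` and `aⱼ + λⱼ bⱼ ≠ 0`, the feedback gain can be chosen so that
the closed-loop matrix has any prescribed characteristic polynomial. -/
theorem exists_charpoly_eq (hlam : Function.Injective lam) (hab : ∀ j, a j + lam j * b j ≠ 0)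
    {p : ℝ[X]} (hp : p.Monic) (hpd : p.natDegree = n + 1) :
    ∃ k : Idx n → ℝ, (Matrix.fromBlocks 0 0 (Matrix.of fun j _ => a j) (Matrix.diagonal lam) +
      Matrix.vecMulVec (Sum.elim (fun _ => 1) b) k : Matrix (Idx n) (Idx n) ℝ).charpoly = p := by
  -- The characteristic polynomial is `q - k₀ ∏ (X - λⱼ) - r`, where `r` collects the gains `κⱼ`. These
  -- are chosen so that `p - q + r` vanishes at every `λⱼ`; being of degree at most `n`, it is then a
  -- multiple of `∏ (X - λⱼ)`, and `k₀` matches that multiple.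
  set κ : Fin n → ℝ := fun j =>
    -(p.eval (lam j)) / ((a j + lam j * b j) * ∏ i ∈ Finset.univ.erase j, (lam j - lam i)) with hκ
  set q : ℝ[X] := X * ∏ j, (X - C (lam j)) with hq
  set r : ℝ[X] := ∑ j, C (κ j) * ((C (a j) + C (b j) * X) *
    ∏ i ∈ Finset.univ.erase j, (X - C (lam i))) with hr
  have hprodm : (∏ j, (X - C (lam j))).Monic := monic_prod_of_monic _ _ fun j _ => monic_X_sub_C _
  have hprodd : (∏ j, (X - C (lam j))).natDegree = n := by
    rw [natDegree_prod_of_monic _ _ fun j _ => monic_X_sub_C _]; simp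
  have hqm : q.Monic := monic_X.mul hprodm
  have hqd : q.natDegree = n + 1 := by
    rw [hq, monic_X.natDegree_mul hprodm, natDegree_X, hprodd, add_comm]
  have hrd : r.natDegree ≤ n := by
    refine natDegree_sum_le_of_forall_le _ _ fun j _ => ?_
    refine (natDegree_C_mul_le _ _).trans (natDegree_mul_le.trans ?_)
    have h1 : (C (a j) + C (b j) * X).natDegree ≤ 1 := by
      rw [add_comm]; exact natDegree_linear_le
    have h2 : (∏ i ∈ Finset.univ.erase j, (X - C (lam i))).natDegree ≤ n - 1 := by
      rw [natDegree_prod_of_monic _ _ fun j _ => monic_X_sub_C _]; simp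
    have := j.pos
    omega
  have hpq : (p - q).natDegree ≤ n := by
    have h1 := degree_sub_lt_left (p := p) (q := q)
      (by rw [degree_eq_natDegree hp.ne_zero, degree_eq_natDegree hqm.ne_zero, hpd, hqd])
      hp.ne_zero (by rw [hp.leadingCoeff, hqm.leadingCoeff])
    rw [degree_eq_natDegree hp.ne_zero, hpd] at h1
    rw [natDegree_le_iff_coeff_eq_zero]
    exact fun k hk => (degree_lt_iff_coeff_zero _ _).1 h1 k hk
  have hev : ∀ j, (p - q + r).eval (lam j) = 0 := by
    intro j
    have h1 : q.eval (lam j) = 0 := by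
      rw [hq, eval_mul, eval_prod, Finset.prod_eq_zero (Finset.mem_univ j) (by simp), mul_zero]
    have h2 : r.eval (lam j) = -p.eval (lam j) := by
      rw [hr, eval_finsetSum, Finset.sum_eq_single j]
      · simp only [eval_mul, eval_C, eval_add, eval_X, eval_prod, eval_sub]
        have h3 : ∏ i ∈ Finset.univ.erase j, (lam j - lam i) ≠ 0 :=
          Finset.prod_ne_zero_iff.2 fun i hi =>
            sub_ne_zero.2 fun h => (Finset.ne_of_mem_erase hi) (hlam h).symm
        have h4 := hab j
        rw [mul_comm (b j) (lam j)]
        simp only [hκ]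
        exact div_mul_cancel₀ _ (mul_ne_zero h4 h3)
      · intro i _ hij
        simp only [eval_mul, eval_prod]
        rw [Finset.prod_eq_zero (Finset.mem_erase.2 ⟨hij.symm, Finset.mem_univ j⟩) (by simp)]
        simp
      · simp
    rw [eval_add, eval_sub, h1, h2]; ring
  have hfac := eq_C_mul_prod_of_eval_eq_zero hlam
    (natDegree_add_le_of_degree_le hpq hrd) hev
  set d := (p - q + r).coeff n
  refine ⟨Sum.elim (fun _ => -d) κ, Polynomial.eq_of_infinite_eval_eq _ _ ?_⟩
  refine (Set.Finite.infinite_compl (Set.finite_range lam)).mono fun s hs => ?_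
  have hs' : ∀ j, s ≠ lam j := fun j h => hs ⟨j, h.symm⟩
  change Polynomial.eval s _ = Polynomial.eval s _
  rw [eval_charpoly_fromBlocks_add_vecMulVec lam a b _ hs']
  have h1 := congrArg (Polynomial.eval s) hfac
  have h2 : r.eval s =
      (∏ j, (s - lam j)) * ∑ j, κ j * (a j + b j * s) / (s - lam j) := by
    rw [hr, eval_finsetSum, Finset.mul_sum]
    refine Finset.sum_congr rfl fun j _ => ?_
    simp only [eval_mul, eval_C, eval_add, eval_X, eval_prod, eval_sub]
    rw [← Finset.mul_prod_erase Finset.univ _ (Finset.mem_univ j)]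
    have := sub_ne_zero.2 (hs' j)
    field_simp
  simp only [eval_add, eval_sub, eval_mul, eval_C, eval_X, eval_prod, hq, h2] at h1
  simp only [Sum.elim_inl, Sum.elim_inr]
  linear_combination -h1

theorem exists_isPoleShiftingGain {L : ℝ} {c : ℝ → ℝ} {e : Fin n → ℝ → ℝ} (D : ℝ)
    (hlam : Function.Injective lam)
    (hab : ∀ j, aCoef L c e j + lam j * bCoef L e j ≠ 0) :
    ∃ K : Idx n → ℝ, IsPoleShiftingGain L c D lam e K := by
  obtain ⟨k, hk⟩ := exists_charpoly_eq lam (aCoef L c e) (bCoef L e) hlam hab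
    (p := (Polynomial.X + 1) ^ (n + 1)) ((Polynomial.monic_X_add_C 1).pow (n + 1))
    (by rw [Polynomial.natDegree_pow, ← Polynomial.C_1, Polynomial.natDegree_X_add_C, mul_one])
  -- Conjugation by `e^{-D A₁}` turns the delayed input vector into `B₁`.
  set A := matA L c lam e with hA
  set P := NormedSpace.exp ((-D) • A)
  set Pinv := NormedSpace.exp (D • A)
  have h1 : P * Pinv = 1 := by
    rw [← A.exp_smul_add, neg_add_cancel, A.exp_zero_smul]
  have h2 : Pinv * P = 1 := by
    rw [← A.exp_smul_add, add_neg_cancel, A.exp_zero_smul]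
  have hcomm : P * A = A * P :=
    ((Commute.refl A).smul_left (-D)).exp_left
  refine ⟨k ᵥ* Pinv, ?_⟩
  rw [IsPoleShiftingGain, ← hk]
  set u : (Matrix (Idx n) (Idx n) ℝ)ˣ := ⟨P, Pinv, h1, h2⟩
  have h3 := Matrix.charpoly_units_conj u (A + Matrix.vecMulVec (vecB L e) k)
  have h4 : (u : Matrix (Idx n) (Idx n) ℝ) * (A + Matrix.vecMulVec (vecB L e) k) *
      ((u⁻¹ : (Matrix (Idx n) (Idx n) ℝ)ˣ) : Matrix (Idx n) (Idx n) ℝ) =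
      A + Matrix.vecMulVec (expB L c lam e (-D)) (k ᵥ* Pinv) := by
    change P * (A + Matrix.vecMulVec (vecB L e) k) * Pinv = _
    rw [mul_add, add_mul, hcomm, mul_assoc, h1, mul_one, Matrix.mul_vecMulVec,
      Matrix.vecMulVec_mul]
    rfl
  rw [← Matrix.coe_units_inv, h4] at h3
  exact h3

end PolePlacement

/-! ### The predictor for a linear system with input delay -/

section Predictor

variable {m : Type*} [Fintype m] [DecidableEq m]

theorem intervalIntegral_smul_eq_zero_of_lt {E : Type*} [NormedAddCommGroup E] [NormedSpace ℝ E]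
    {α : ℝ → ℝ} {t₀ : ℝ} (hα : ∀ t, t < t₀ → α t = 0) (f : ℝ → E) {a b : ℝ} (ha : a ≤ t₀)
    (hb : b ≤ t₀) : ∫ s in a..b, α s • f s = 0 := by
  refine intervalIntegral.integral_zero_ae ?_
  filter_upwards [compl_mem_ae_iff.2 (measure_singleton (μ := volume) t₀)] with s hs hsm
  rw [hα s (lt_of_le_of_ne (hsm.2.trans (max_le ha hb)) hs), zero_smul]

theorem locallyIntegrable_comp_sub {α : ℝ → ℝ} (hα : LocallyIntegrable α volume) (D : ℝ) :
    LocallyIntegrable (fun s => α (s - D)) volume := by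
  have h := locallyIntegrable_map_homeomorph (Homeomorph.subRight D) (f := α) (μ := volume)
  have h2 : Measure.map (Homeomorph.subRight D) (volume : Measure ℝ) = volume :=
    (measurePreserving_sub_right volume D).map_eq
  rw [h2] at h
  exact h.1 hα

/-- The solution at time `t` of `Z' = A Z + α B`, `Z(0) = X₀`. -/
noncomputable def linearState (A : Matrix m m ℝ) (B X₀ : m → ℝ) (α : ℝ → ℝ) (t : ℝ) : m → ℝ :=
  NormedSpace.exp (t • A) *ᵥ
    (X₀ + ∫ s in (0 : ℝ)..t, α s • (NormedSpace.exp ((-s) • A) *ᵥ B))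

theorem intervalIntegrable_smul_exp_mulVec {α : ℝ → ℝ} (hα : LocallyIntegrable α volume)
    (A : Matrix m m ℝ) (B : m → ℝ) (a b : ℝ) :
    IntervalIntegrable (fun s => α s • (NormedSpace.exp ((-s) • A) *ᵥ B)) volume a b :=
  (hα.intervalIntegrable_real a b).smul_continuousOn
    ((A.continuous_exp_smul_mulVec B).comp continuous_neg).continuousOn

theorem Matrix.continuous_exp_smul_mulVec_comp (A : Matrix m m ℝ) {x : ℝ → m → ℝ}
    (hx : Continuous x) : Continuous fun s : ℝ => NormedSpace.exp (s • A) *ᵥ x s := by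
  refine continuous_pi fun i => ?_
  simp only [mulVec, dotProduct]
  exact continuous_finsetSum _ fun k _ =>
    (A.continuous_exp_smul_apply i k).mul ((continuous_apply k).comp hx)

theorem Matrix.hasDerivWithinAt_exp_smul_mulVec (A : Matrix m m ℝ) {x : ℝ → m → ℝ} {x' : m → ℝ}
    {S : Set ℝ} {t : ℝ} (hx : HasDerivWithinAt x x' S t) :
    HasDerivWithinAt (fun s : ℝ => NormedSpace.exp (s • A) *ᵥ x s)
      (A *ᵥ (NormedSpace.exp (t • A) *ᵥ x t) + NormedSpace.exp (t • A) *ᵥ x') S t := by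
  have hcomm : A * NormedSpace.exp (t • A) = NormedSpace.exp (t • A) * A :=
    ((Commute.refl A).smul_right t).exp_right
  rw [mulVec_mulVec, hcomm]
  refine hasDerivWithinAt_pi.2 fun i => ?_
  simp only [mulVec, dotProduct, Pi.add_apply, ← Finset.sum_add_distrib]
  exact HasDerivWithinAt.fun_sum fun k _ =>
    (A.hasDerivAt_exp_smul_apply t i k).hasDerivWithinAt.mul (hasDerivWithinAt_pi.1 hx k)

variable {A : Matrix m m ℝ} {B X₀ : m → ℝ} {α : ℝ → ℝ} {t₀ t : ℝ}

theorem continuous_linearState (hα : LocallyIntegrable α volume) (A : Matrix m m ℝ)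
    (B X₀ : m → ℝ) : Continuous (linearState A B X₀ α) :=
  A.continuous_exp_smul_mulVec_comp <| continuous_const.add <|
    intervalIntegral.continuous_primitive (intervalIntegrable_smul_exp_mulVec hα A B) 0

theorem linearState_of_le (hα : ∀ t, t < t₀ → α t = 0) (ht : 0 ≤ t) (htt : t ≤ t₀) :
    linearState A B X₀ α t = NormedSpace.exp (t • A) *ᵥ X₀ := by
  rw [linearState, intervalIntegral_smul_eq_zero_of_lt hα _ (ht.trans htt) htt, add_zero]

theorem hasDerivWithinAt_linearState (hα : LocallyIntegrable α volume)
    (hc : ContinuousWithinAt α (Ici t) t) :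
    HasDerivWithinAt (linearState A B X₀ α)
      (A *ᵥ linearState A B X₀ α t + α t • B) (Ici t) t := by
  have hcont : Continuous fun s : ℝ => NormedSpace.exp ((-s) • A) *ᵥ B :=
    (A.continuous_exp_smul_mulVec B).comp continuous_neg
  have hg : ContinuousWithinAt (fun s => α s • (NormedSpace.exp ((-s) • A) *ᵥ B)) (Ici t) t :=
    hc.smul hcont.continuousWithinAt
  have hmeas : StronglyMeasurableAtFilter (fun s => α s • (NormedSpace.exp ((-s) • A) *ᵥ B))
      (𝓝[>] t) volume :=
    (hα.aestronglyMeasurable.smul hcont.aestronglyMeasurable).stronglyMeasurableAtFilter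
  have h1 := (intervalIntegral.integral_hasDerivWithinAt_right
    (intervalIntegrable_smul_exp_mulVec hα A B 0 t) (s := Ici t) (t := Ioi t) hmeas
    (hg.mono Ioi_subset_Ici_self)).const_add X₀
  have h2 := A.hasDerivWithinAt_exp_smul_mulVec h1
  rwa [mulVec_smul, A.exp_smul_mulVec_mulVec, add_neg_cancel, A.exp_zero_smul, one_mulVec] at h2

/-- The only solution of a linear differential equation on `[t₀, ∞)` is the exponential one. -/
theorem Matrix.eqOn_exp_of_hasDerivWithinAt {M : Matrix m m ℝ} {Z g : ℝ → m → ℝ} {ξ : m → ℝ}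
    (hZ : Continuous Z) (h0 : Z t₀ = ξ)
    (hd : ∀ t, t₀ ≤ t → HasDerivWithinAt Z (A *ᵥ Z t + g t) (Ici t) t)
    (hg : ∀ t, t₀ ≤ t → A *ᵥ (NormedSpace.exp ((t - t₀) • M) *ᵥ ξ) + g t =
      M *ᵥ (NormedSpace.exp ((t - t₀) • M) *ᵥ ξ)) (ht : t₀ ≤ t) :
    Z t = NormedSpace.exp ((t - t₀) • M) *ᵥ ξ := by
  have hGc : Continuous fun s : ℝ => NormedSpace.exp ((s - t₀) • M) *ᵥ ξ :=
    (M.continuous_exp_smul_mulVec ξ).comp (continuous_id.sub continuous_const)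
  have hGd : ∀ s, HasDerivAt (fun s : ℝ => NormedSpace.exp ((s - t₀) • M) *ᵥ ξ)
      (M *ᵥ (NormedSpace.exp ((s - t₀) • M) *ᵥ ξ)) s := by
    intro s
    have h1 := M.hasDerivWithinAt_exp_smul_mulVec (S := univ) (t := s - t₀)
      (hasDerivWithinAt_const (s - t₀) univ ξ)
    rw [mulVec_zero, add_zero, hasDerivWithinAt_univ] at h1
    simpa using h1.comp_sub_const s t₀
  refine ODE_solution_unique (a := t₀) (b := t + 1) (v := fun s x => A *ᵥ x + g s)
    (K := ‖(A.mulVecLin).toContinuousLinearMap‖₊) (fun s => ?_) hZ.continuousOn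
    (fun s hs => hd s hs.1) hGc.continuousOn (fun s hs => ?_) ?_ ⟨ht, by linarith⟩
  · have := (A.mulVecLin).toContinuousLinearMap.lipschitz
    refine LipschitzWith.of_dist_le_mul fun x y => ?_
    rw [dist_add_right]
    exact this.dist_le_mul x y
  · simp only [hg s hs.1]
    exact (hGd s).hasDerivWithinAt
  · rw [h0, sub_self, M.exp_zero_smul, one_mulVec]

/-- Under the feedback `α = K Z` from time `t₀` on, the state evolves by the closed-loop matrix. -/
theorem linearState_eq_of_feedback (ht₀ : 0 ≤ t₀) (hα : LocallyIntegrable α volume)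
    (hoff : ∀ t, t < t₀ → α t = 0) {K : m → ℝ}
    (hon : ∀ t, t₀ ≤ t → α t = K ⬝ᵥ linearState A B X₀ α t) (ht : t₀ ≤ t) :
    linearState A B X₀ α t = NormedSpace.exp ((t - t₀) • (A + Matrix.vecMulVec B K)) *ᵥ
      (NormedSpace.exp (t₀ • A) *ᵥ X₀) := by
  have hZ := continuous_linearState hα A B X₀
  have key : ∀ x : m → ℝ, A *ᵥ x + (K ⬝ᵥ x) • B = (A + Matrix.vecMulVec B K) *ᵥ x := by
    intro x
    rw [add_mulVec, vecMulVec_mulVec]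
    simp
  have hcont : ContinuousOn α (Ici t₀) :=
    (Continuous.dotProduct continuous_const hZ).continuousOn.congr fun s hs => hon s hs
  have hode : ∀ s ∈ Ici t₀, HasDerivWithinAt (linearState A B X₀ α)
      ((A + Matrix.vecMulVec B K) *ᵥ linearState A B X₀ α s + 0) (Ici s) s := by
    intro s hs
    have := hasDerivWithinAt_linearState (A := A) (B := B) (X₀ := X₀) hα
      ((hcont s hs).mono (Ici_subset_Ici.2 hs))
    rwa [hon s hs, key, ← add_zero (_ *ᵥ _)] at this
  exact Matrix.eqOn_exp_of_hasDerivWithinAt (g := fun _ => 0) hZ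
    (linearState_of_le hoff ht₀ le_rfl) hode (fun s _ => add_zero _) ht

/-- Conversely, the explicit closed-loop input produces the explicit closed-loop state, and hence
satisfies the feedback law. -/
theorem linearState_eq_of_eq_exp (ht₀ : 0 ≤ t₀) (hα : LocallyIntegrable α volume)
    (hoff : ∀ t, t < t₀ → α t = 0) {K : m → ℝ}
    (hon : ∀ t, t₀ ≤ t → α t = K ⬝ᵥ (NormedSpace.exp ((t - t₀) • (A + Matrix.vecMulVec B K)) *ᵥ
      (NormedSpace.exp (t₀ • A) *ᵥ X₀))) (ht : t₀ ≤ t) :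
    linearState A B X₀ α t = NormedSpace.exp ((t - t₀) • (A + Matrix.vecMulVec B K)) *ᵥ
      (NormedSpace.exp (t₀ • A) *ᵥ X₀) := by
  have hGc : Continuous fun s : ℝ => NormedSpace.exp ((s - t₀) • (A + Matrix.vecMulVec B K)) *ᵥ
      (NormedSpace.exp (t₀ • A) *ᵥ X₀) :=
    (Matrix.continuous_exp_smul_mulVec _ _).comp (continuous_id.sub continuous_const)
  have hcont : ContinuousOn α (Ici t₀) :=
    (Continuous.dotProduct continuous_const hGc).continuousOn.congr fun s hs => hon s hs
  refine Matrix.eqOn_exp_of_hasDerivWithinAt (g := fun s => α s • B)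
    (continuous_linearState hα A B X₀)
    (linearState_of_le hoff ht₀ le_rfl) (fun s hs => hasDerivWithinAt_linearState hα
      ((hcont s hs).mono (Ici_subset_Ici.2 hs))) (fun s hs => ?_) ht
  rw [hon s hs, add_mulVec, vecMulVec_mulVec]
  simp

/-- Artstein's transform: adding to the state of the delayed system `X' = A X + α(· - D) B` the
inputs that are still on their way gives the state of a system without delay. -/
theorem add_integral_eq_linearState {D : ℝ} {X : ℝ → m → ℝ} (hD : 0 ≤ D)
    (hα : LocallyIntegrable α volume) (hoff : ∀ t, t < 0 → α t = 0) (ht : 0 ≤ t)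
    (hX : ContinuousOn X (Icc 0 t))
    (h : ∀ s ∈ Icc 0 t, ∀ i,
      X s i = X₀ i + ∫ r in (0 : ℝ)..s, ((A *ᵥ X r) i + (α (r - D) • B) i)) :
    X t + ∫ s in (t - D)..t, α s • (NormedSpace.exp ((t - s - D) • A) *ᵥ B) =
      linearState A (NormedSpace.exp ((-D) • A) *ᵥ B) X₀ α t := by
  set B' := NormedSpace.exp ((-D) • A) *ᵥ B with hB'
  have hshift : ∀ r : ℝ, NormedSpace.exp ((r - D) • A) *ᵥ B = NormedSpace.exp (r • A) *ᵥ B' :=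
    fun r => by rw [hB', A.exp_smul_mulVec_mulVec, sub_eq_add_neg]
  have hαD := locallyIntegrable_comp_sub hα D
  have hint := intervalIntegrable_smul_exp_mulVec hα A B'
  have hint' := intervalIntegrable_smul_exp_mulVec hαD A B
  have hVoC : NormedSpace.exp ((-t) • A) *ᵥ X t =
      X₀ + ∫ s in (0 : ℝ)..t, α (s - D) • (NormedSpace.exp ((-s) • A) *ᵥ B) := by
    funext i
    rw [A.exp_neg_smul_mulVec_eq (X := X) ht (fun i => (continuous_apply i).comp_continuousOn hX)
      (fun i => (hαD.intervalIntegrable_real 0 t).mul_const (B i)) h i, Pi.add_apply]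
    congr 1
    have := (ContinuousLinearMap.proj (R := ℝ) (φ := fun _ : m => ℝ) i).intervalIntegral_comp_comm
      (hint' 0 t)
    change (∫ s in (0 : ℝ)..t, (α (s - D) • (NormedSpace.exp ((-s) • A) *ᵥ B)) i) = _ at this
    refine Eq.trans (intervalIntegral.integral_congr fun s _ => ?_) this
    exact congrFun (mulVec_smul _ (α (s - D)) B) i
  -- Inputs issued before time `0` vanish.
  have hsub : ∫ s in (0 : ℝ)..t, α (s - D) • (NormedSpace.exp ((-s) • A) *ᵥ B) =
      ∫ s in (0 : ℝ)..(t - D), α s • (NormedSpace.exp ((-s) • A) *ᵥ B') := by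
    have h1 := intervalIntegral.integral_comp_sub_right (a := 0) (b := t)
      (fun s => α s • (NormedSpace.exp ((-s) • A) *ᵥ B')) D
    rw [zero_sub, ← intervalIntegral.integral_add_adjacent_intervals (hint (-D) 0)
      (hint 0 (t - D)), intervalIntegral_smul_eq_zero_of_lt hoff _ (by linarith) le_rfl,
      zero_add] at h1
    rw [← h1]
    refine intervalIntegral.integral_congr fun s _ => ?_
    rw [← hshift, neg_sub, sub_sub_cancel_left]
  have hker : ∫ s in (t - D)..t, α s • (NormedSpace.exp ((t - s - D) • A) *ᵥ B) =
      NormedSpace.exp (t • A) *ᵥ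
        ∫ s in (t - D)..t, α s • (NormedSpace.exp ((-s) • A) *ᵥ B') := by
    have := ((NormedSpace.exp (t • A)).mulVecLin).toContinuousLinearMap.intervalIntegral_comp_comm
      (hint (t - D) t)
    change (∫ s in (t - D)..t, NormedSpace.exp (t • A) *ᵥ _) = NormedSpace.exp (t • A) *ᵥ _ at this
    rw [← this]
    refine intervalIntegral.integral_congr fun s _ => ?_
    rw [hshift, mulVec_smul, A.exp_smul_mulVec_mulVec t (-s), sub_eq_add_neg]
  have hXt : X t = NormedSpace.exp (t • A) *ᵥ (NormedSpace.exp ((-t) • A) *ᵥ X t) := by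
    rw [A.exp_smul_mulVec_mulVec, add_neg_cancel, A.exp_zero_smul, one_mulVec]
  rw [hXt, hVoC, hsub, hker, ← mulVec_add, add_assoc,
    intervalIntegral.integral_add_adjacent_intervals (hint 0 _) (hint _ _), linearState]

end Predictor

/-! ### The closed-loop system: well-posedness -/

/-- A Hilbert basis of eigenfunctions that contains the given eigenfunctions for the nonnegative
eigenvalues. -/
theorem IsUnstableModes.exists_spectralBasis {c : ℝ → ℝ} {n : ℕ} {lam : Fin n → ℝ}
    {e : Fin n → ℝ → ℝ} (h : IsUnstableModes L c lam e) (hL : 0 < L)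
    (hc : MemLp c ⊤ (volume.restrict (Ioo (0 : ℝ) L))) :
    ∃ (b : SpectralBasis L c {μ // ∃ v, IsEigenfunction L c μ v}) (idx : Fin n → _),
      (∀ i, b.lam i = i.1) ∧ ∀ j, b.lam (idx j) = lam j ∧ b.fn (idx j) = e j := by
  classical
  set fn : {μ // ∃ v, IsEigenfunction L c μ v} → ℝ → ℝ := fun i =>
    if hi : ∃ j, lam j = i.1 then e hi.choose else i.2.choose with hfn
  have hfn1 : ∀ i, IsEigenfunction L c i.1 (fn i) := by
    intro i
    simp only [hfn]
    split_ifs with hi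
    · have := h.eigen hi.choose
      rwa [hi.choose_spec] at this
    · exact i.2.choose_spec
  obtain ⟨B, hB⟩ := exists_hilbertBasis_eigenfunctions hL hc fn hfn1
  refine ⟨⟨B, fun i => i.1, fn, hfn1, hB⟩, fun j => ⟨lam j, e j, h.eigen j⟩, fun i => rfl,
    fun j => ⟨rfl, ?_⟩⟩
  have hi : ∃ k, lam k = lam j := ⟨j, rfl⟩
  simp only [hfn, hi, dif_pos]
  rw [h.strictAnti.injective hi.choose_spec]

section ClosedLoop

variable {ι : Type} {c : ℝ → ℝ} {n : ℕ} {lam : Fin n → ℝ} {e : Fin n → ℝ → ℝ}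

namespace SpectralBasis

theorem stateX_inr (b : SpectralBasis L c ι) (hL : 0 < L) {i : ι} {j : Fin n} (hi : b.fn i = e j)
    (r : ℝ) (y : L2 L) :
    stateX L e r y (Sum.inr j) = inner ℝ (b.basis i) y + b.coefB i * r := by
  have h1 : (y - r • xiL L : L2 L) =ᵐ[volume.restrict (Ioo (0 : ℝ) L)]
      fun x => y x - x / L * r := by
    filter_upwards [Lp.coeFn_sub y (r • xiL L), Lp.coeFn_smul r (xiL L), coeFn_xiL L]
      with x h1 h2 h3
    rw [h1, Pi.sub_apply, h2, Pi.smul_apply, h3, smul_eq_mul, mul_comm]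
  have h2 := L2_inner_eq hL.le h1 (b.coeFn_basis hL i)
  rw [real_inner_comm, inner_sub_right, real_inner_smul_right, hi] at h2
  rw [stateX, Sum.elim_inr, ← h2, coefB]
  ring

theorem coefA_eq_aCoef (b : SpectralBasis L c ι) (hL : 0 < L)
    (hc : MemLp c ⊤ (volume.restrict (Ioo (0 : ℝ) L))) {i : ι} {j : Fin n} (hi : b.fn i = e j) :
    b.coefA hc i = aCoef L c e j := by
  rw [b.coefA_eq hL hc, hi, aCoef]

theorem coefB_eq_bCoef (b : SpectralBasis L c ι) (hL : 0 < L) {i : ι} {j : Fin n}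
    (hi : b.fn i = e j) : b.coefB i = bCoef L e j := by
  rw [b.coefB_eq hL, hi, bCoef]

variable {idx : Fin n → ι}

theorem norm_stateX_zero_le (b : SpectralBasis L c ι) (hL : 0 < L)
    (hidx : ∀ j, b.fn (idx j) = e j) (y₀ : L2 L) : ‖stateX L e 0 y₀‖ ≤ ‖y₀‖ := by
  refine (pi_norm_le_iff_of_nonneg (norm_nonneg _)).2 fun i => ?_
  rcases i with i | j
  · simp [stateX]
  · rw [b.stateX_inr hL (hidx j), mul_zero, add_zero]
    refine (norm_inner_le_norm _ _).trans ?_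
    rw [b.basis.orthonormal.1, one_mul]

/-- The finite-dimensional state of a solution of the heat equation solves a linear system with
input `η = v'`. -/
theorem stateX_eq_of_isHeatSolution (b : SpectralBasis L c ι) (hL : 0 < L)
    (hc : MemLp c ⊤ (volume.restrict (Ioo (0 : ℝ) L)))
    (hidx : ∀ j, b.lam (idx j) = lam j ∧ b.fn (idx j) = e j)
    {v η : ℝ → ℝ} (hη : LocallyIntegrable η volume)
    (hv : ∀ t, 0 ≤ t → v t = ∫ s in (0 : ℝ)..t, η s) {y₀ : L2 L} {y : ℝ → L2 L}
    (hy : IsHeatSolution L c v y₀ y) {t : ℝ} (ht : 0 ≤ t) (i : Idx n) :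
    stateX L e (v t) (y t) i = stateX L e 0 y₀ i + ∫ s in (0 : ℝ)..t,
      ((matA L c lam e *ᵥ stateX L e (v s) (y s)) i + (η s • vecB L e) i) := by
  rcases i with i | j
  · have h1 : ∀ s, (matA L c lam e *ᵥ stateX L e (v s) (y s)) (Sum.inl i) = 0 := fun s => by
      simp [matA, fromBlocks_mulVec]
    simp only [h1]
    simp [stateX, vecB, hv t ht]
  · have h1 : ∀ s, (matA L c lam e *ᵥ stateX L e (v s) (y s)) (Sum.inr j) =
        aCoef L c e j * v s + lam j * stateX L e (v s) (y s) (Sum.inr j) := fun s => by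
      rw [matA, fromBlocks_mulVec, Sum.elim_inr, Pi.add_apply, mulVec_diagonal]
      simp [mulVec, dotProduct, stateX]
    simp only [h1, b.stateX_inr hL (hidx j).2]
    rw [b.coef_eq_of_isHeatSolution hL hc hη hv hy (idx j) ht, mul_zero, add_zero]
    congr 1
    refine intervalIntegral.integral_congr fun s _ => ?_
    rw [(hidx j).1, b.coefA_eq_aCoef hL hc (hidx j).2, b.coefB_eq_bCoef hL (hidx j).2]
    simp only [Pi.smul_apply, vecB, Sum.elim_inr, smul_eq_mul]
    ring

theorem continuousOn_stateX (b : SpectralBasis L c ι) (hL : 0 < L)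
    (hidx : ∀ j, b.fn (idx j) = e j) {v : ℝ → ℝ} {y : ℝ → L2 L} {S : Set ℝ}
    (hv : ContinuousOn v S) (hy : ContinuousOn y S) :
    ContinuousOn (fun t => stateX L e (v t) (y t)) S := by
  refine continuousOn_pi.2 fun i => ?_
  rcases i with i | j
  · exact hv
  · simp only [b.stateX_inr hL (hidx j)]
    exact (continuousOn_const.inner hy).add (continuousOn_const.mul hv)

end SpectralBasis

/-- The delayed control `u(· - D)` is the primitive of the delayed input, as inputs before time `0`
vanish. -/
theorem integral_sub_eq_of_eq_zero_of_neg {α u : ℝ → ℝ} (hα : LocallyIntegrable α volume)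
    (hoff : ∀ t, t < 0 → α t = 0) (hu : ∀ t, u t = ∫ s in (0 : ℝ)..t, α s) {D : ℝ} (hD : 0 ≤ D)
    (t : ℝ) : u (t - D) = ∫ s in (0 : ℝ)..t, α (s - D) := by
  have h0 : ∫ s in (-D)..0, α s = 0 := by
    simpa using intervalIntegral_smul_eq_zero_of_lt hoff (fun _ => (1 : ℝ)) (a := -D) (b := 0)
      (by linarith) le_rfl
  rw [intervalIntegral.integral_comp_sub_right, zero_sub,
    ← intervalIntegral.integral_add_adjacent_intervals (hα.intervalIntegrable_real (-D) 0)
      (hα.intervalIntegrable_real 0 (t - D)), h0, zero_add, hu]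

variable {D t₀ : ℝ} {K : Idx n → ℝ} {y₀ : L2 L} {α u : ℝ → ℝ} {y : ℝ → L2 L} {idx : Fin n → ι}

namespace SpectralBasis

theorem artsteinZ_eq_linearState (b : SpectralBasis L c ι) (hL : 0 < L)
    (hc : MemLp c ⊤ (volume.restrict (Ioo (0 : ℝ) L)))
    (hidx : ∀ j, b.lam (idx j) = lam j ∧ b.fn (idx j) = e j) (hD : 0 ≤ D)
    (hα : LocallyIntegrable α volume) (hoff : ∀ t, t < 0 → α t = 0)
    (hu : ∀ t, u t = ∫ s in (0 : ℝ)..t, α s)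
    (hy : IsHeatSolution L c (fun t => u (t - D)) y₀ y) {t : ℝ} (ht : 0 ≤ t) :
    artsteinZ L c D lam e α u y t =
      linearState (matA L c lam e) (expB L c lam e (-D)) (stateX L e 0 y₀) α t := by
  have hαD := locallyIntegrable_comp_sub hα D
  have hv : ∀ t, 0 ≤ t → u (t - D) = ∫ s in (0 : ℝ)..t, α (s - D) := fun t _ =>
    integral_sub_eq_of_eq_zero_of_neg hα hoff hu hD t
  exact add_integral_eq_linearState (X := fun t => stateX L e (u (t - D)) (y t)) hD hα hoff ht
    (b.continuousOn_stateX hL (fun j => (hidx j).2) (continuousOn_of_eq_primitive hαD hv t)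
      (hy.continuousOn.mono Icc_subset_Ici_self))
    (fun s hs i => b.stateX_eq_of_isHeatSolution hL hc hidx hαD hv hy hs.1 i)

end SpectralBasis

/-- The closed-loop value of Artstein's transform at a time `t ≥ t₀`. -/
noncomputable def closedLoopZ (L : ℝ) (c : ℝ → ℝ) (D t₀ : ℝ) {n : ℕ} (lam : Fin n → ℝ)
    (e : Fin n → ℝ → ℝ) (K : Idx n → ℝ) (y₀ : L2 L) (t : ℝ) : Idx n → ℝ :=
  NormedSpace.exp ((t - t₀) • (matA L c lam e + Matrix.vecMulVec (expB L c lam e (-D)) K)) *ᵥ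
    (NormedSpace.exp (t₀ • matA L c lam e) *ᵥ stateX L e 0 y₀)

namespace IsClosedLoop

theorem eq_zero_of_neg (h : IsClosedLoop L c D t₀ lam e K y₀ α u y) (ht₀ : 0 ≤ t₀) (t : ℝ)
    (ht : t < 0) : α t = 0 :=
  h.feedback_off t (ht.trans_le ht₀)

theorem artsteinZ_eq (h : IsClosedLoop L c D t₀ lam e K y₀ α u y) (b : SpectralBasis L c ι)
    (hL : 0 < L) (hc : MemLp c ⊤ (volume.restrict (Ioo (0 : ℝ) L)))
    (hidx : ∀ j, b.lam (idx j) = lam j ∧ b.fn (idx j) = e j) (hD : 0 ≤ D) (ht₀ : 0 ≤ t₀) {t : ℝ}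
    (ht : 0 ≤ t) : artsteinZ L c D lam e α u y t =
      if t < t₀ then NormedSpace.exp (t • matA L c lam e) *ᵥ stateX L e 0 y₀
      else closedLoopZ L c D t₀ lam e K y₀ t := by
  have hZ := fun (t : ℝ) (ht : 0 ≤ t) => b.artsteinZ_eq_linearState hL hc hidx hD
    h.locallyIntegrable (h.eq_zero_of_neg ht₀) h.control h.solution ht
  rw [hZ t ht]
  split_ifs with htt
  · exact linearState_of_le h.feedback_off ht htt.le
  · refine linearState_eq_of_feedback ht₀ h.locallyIntegrable h.feedback_off (fun s hs => ?_)
      (not_lt.1 htt)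
    rw [h.feedback_on s hs, hZ s (ht₀.trans hs)]

theorem input_eq (h : IsClosedLoop L c D t₀ lam e K y₀ α u y) (b : SpectralBasis L c ι)
    (hL : 0 < L) (hc : MemLp c ⊤ (volume.restrict (Ioo (0 : ℝ) L)))
    (hidx : ∀ j, b.lam (idx j) = lam j ∧ b.fn (idx j) = e j) (hD : 0 ≤ D) (ht₀ : 0 ≤ t₀) (t : ℝ) :
    α t = if t < t₀ then 0 else K ⬝ᵥ closedLoopZ L c D t₀ lam e K y₀ t := by
  split_ifs with htt
  · exact h.feedback_off t htt
  · rw [h.feedback_on t (not_lt.1 htt), h.artsteinZ_eq b hL hc hidx hD ht₀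
      (ht₀.trans (not_lt.1 htt)), if_neg htt]

theorem unique {α₂ u₂ : ℝ → ℝ} {y₂ : ℝ → L2 L} (h : IsClosedLoop L c D t₀ lam e K y₀ α u y)
    (h₂ : IsClosedLoop L c D t₀ lam e K y₀ α₂ u₂ y₂) (b : SpectralBasis L c ι)
    (hL : 0 < L) (hc : MemLp c ⊤ (volume.restrict (Ioo (0 : ℝ) L)))
    (hidx : ∀ j, b.lam (idx j) = lam j ∧ b.fn (idx j) = e j) (hD : 0 ≤ D) (ht₀ : 0 ≤ t₀) :
    α = α₂ ∧ u = u₂ ∧ ∀ t, 0 ≤ t → y t = y₂ t := by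
  have hα : α = α₂ := by
    funext t
    rw [h.input_eq b hL hc hidx hD ht₀, h₂.input_eq b hL hc hidx hD ht₀]
  subst hα
  have hu : u = u₂ := by
    funext t
    rw [h.control, h₂.control]
  subst hu
  exact ⟨rfl, rfl, fun t ht => b.isHeatSolution_unique hL hc
    (locallyIntegrable_comp_sub h.locallyIntegrable D) (fun t _ =>
      integral_sub_eq_of_eq_zero_of_neg h.locallyIntegrable (h.eq_zero_of_neg ht₀) h.control hD t)
    h.solution h₂.solution ht⟩

end IsClosedLoop

theorem SpectralBasis.exists_isClosedLoop (b : SpectralBasis L c ι) (hL : 0 < L)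
    (hc : MemLp c ⊤ (volume.restrict (Ioo (0 : ℝ) L)))
    (hidx : ∀ j, b.lam (idx j) = lam j ∧ b.fn (idx j) = e j) (hD : 0 ≤ D) (ht₀ : 0 ≤ t₀)
    (K : Idx n → ℝ) (y₀ : L2 L) :
    ∃ (α u : ℝ → ℝ) (y : ℝ → L2 L), IsClosedLoop L c D t₀ lam e K y₀ α u y := by
  set f : ℝ → ℝ := fun t => K ⬝ᵥ closedLoopZ L c D t₀ lam e K y₀ t with hf
  have hfc : Continuous f := Continuous.dotProduct continuous_const <|
    (Matrix.continuous_exp_smul_mulVec _ _).comp (continuous_id.sub continuous_const)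
  set α : ℝ → ℝ := (Ici t₀).indicator f with hαdef
  have hoff : ∀ t, t < t₀ → α t = 0 := fun t ht => indicator_of_notMem (not_le.2 ht) f
  have hon : ∀ t, t₀ ≤ t → α t = f t := fun t ht => indicator_of_mem (mem_Ici.2 ht) f
  have hα : LocallyIntegrable α volume := hfc.locallyIntegrable.indicator measurableSet_Ici
  have hneg : ∀ t, t < 0 → α t = 0 := fun t ht => hoff t (ht.trans_le ht₀)
  set u : ℝ → ℝ := fun t => ∫ s in (0 : ℝ)..t, α s with hu
  obtain ⟨y, hy⟩ := b.exists_isHeatSolution hL hc (locallyIntegrable_comp_sub hα D)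
    (fun t _ => integral_sub_eq_of_eq_zero_of_neg hα hneg (fun _ => rfl) hD t) y₀
  refine ⟨α, u, y, hα, fun _ => rfl, hoff, fun t ht => ?_, hy⟩
  rw [b.artsteinZ_eq_linearState hL hc hidx hD hα hneg (fun _ => rfl) hy (ht₀.trans ht),
    linearState_eq_of_eq_exp ht₀ hα hoff hon ht, hon t ht]
  rfl

/-! ### Decay of the unstable modes -/

/-- The delayed input, the delayed control and the unstable modes decay exponentially from time `0`
on; the behaviour before `t₀` is absorbed in the constant. -/
theorem SpectralBasis.exists_unstable_decay (b : SpectralBasis L c ι) (hL : 0 < L)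
    (hc : MemLp c ⊤ (volume.restrict (Ioo (0 : ℝ) L)))
    (hidx : ∀ j, b.lam (idx j) = lam j ∧ b.fn (idx j) = e j) (hD : 0 ≤ D) (ht₀ : 0 ≤ t₀)
    (hK : IsPoleShiftingGain L c D lam e K) :
    ∃ C, 0 ≤ C ∧ ∀ (y₀ : L2 L) (α u : ℝ → ℝ) (y : ℝ → L2 L),
      IsClosedLoop L c D t₀ lam e K y₀ α u y → ∀ t, 0 ≤ t →
        |α (t - D)| ≤ C * Real.exp (-(1 / 2) * t) * ‖y₀‖ ∧
        ‖stateX L e (u (t - D)) (y t)‖ ≤ C * Real.exp (-(1 / 2) * t) * ‖y₀‖ := by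
  obtain ⟨C1, hC1, h1⟩ := Matrix.exists_norm_exp_smul_mulVec_le_of_charpoly hK
  obtain ⟨C2, hC2, h2⟩ := (matA L c lam e).exists_norm_exp_smul_mulVec_le 0 t₀
  obtain ⟨C3, hC3, h3⟩ := (matA L c lam e).exists_norm_exp_smul_mulVec_le (-D) 0
  obtain ⟨CK, hCK, hK'⟩ : ∃ CK, 0 ≤ CK ∧ ∀ x : Idx n → ℝ, |K ⬝ᵥ x| ≤ CK * ‖x‖ := by
    refine ⟨∑ i, |K i|, Finset.sum_nonneg fun i _ => abs_nonneg _, fun x => ?_⟩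
    rw [dotProduct, Finset.sum_mul]
    refine (Finset.abs_sum_le_sum_abs _ _).trans (Finset.sum_le_sum fun i _ => ?_)
    rw [abs_mul]
    exact mul_le_mul_of_nonneg_left (norm_le_pi_norm x i) (abs_nonneg _)
  set E := Real.exp (1 / 2 * t₀) with hE
  have hE1 : 1 ≤ E := Real.one_le_exp (by positivity)
  set CZ := (C1 + 1) * E * C2 with hCZ
  have hCZ0 : 0 ≤ CZ := by positivity
  have hX0 : ∀ y₀ : L2 L, ‖stateX L e 0 y₀‖ ≤ ‖y₀‖ :=
    b.norm_stateX_zero_le hL fun j => (hidx j).2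
  have hcl : ∀ (y₀ : L2 L) (t : ℝ), t₀ ≤ t →
      ‖closedLoopZ L c D t₀ lam e K y₀ t‖ ≤ CZ * Real.exp (-(1 / 2) * t) * ‖y₀‖ := by
    intro y₀ t ht
    have hexp : Real.exp (-(1 / 2) * (t - t₀)) = E * Real.exp (-(1 / 2) * t) := by
      rw [hE, ← Real.exp_add]; congr 1; ring
    have hξ : ‖NormedSpace.exp (t₀ • matA L c lam e) *ᵥ stateX L e 0 y₀‖ ≤ C2 * ‖y₀‖ :=
      (h2 t₀ ⟨ht₀, le_rfl⟩ _).trans (mul_le_mul_of_nonneg_left (hX0 y₀) hC2)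
    calc _ ≤ C1 * Real.exp (-(1 / 2) * (t - t₀)) * _ := h1 (t - t₀) (sub_nonneg.2 ht) _
      _ ≤ C1 * Real.exp (-(1 / 2) * (t - t₀)) * (C2 * ‖y₀‖) :=
          mul_le_mul_of_nonneg_left hξ (by positivity)
      _ = C1 * (E * C2 * Real.exp (-(1 / 2) * t) * ‖y₀‖) := by rw [hexp]; ring
      _ ≤ (C1 + 1) * (E * C2 * Real.exp (-(1 / 2) * t) * ‖y₀‖) :=
          mul_le_mul_of_nonneg_right (by linarith) (by positivity)
      _ = _ := by rw [hCZ]; ring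
  set ED := Real.exp (1 / 2 * D) with hED
  refine ⟨CK * CZ * ED + (CZ + CK * CZ * ED * (C3 * ‖vecB L e‖) * D), by positivity, ?_⟩
  intro y₀ α u y h t ht
  have hα : ∀ s, |α s| ≤ CK * CZ * Real.exp (-(1 / 2) * s) * ‖y₀‖ := by
    intro s
    rw [h.input_eq b hL hc hidx hD ht₀]
    split_ifs with hs
    · rw [abs_zero]; positivity
    · refine (hK' _).trans ?_
      have := mul_le_mul_of_nonneg_left (hcl y₀ s (not_lt.1 hs)) hCK
      linarith
  have hexpD : ∀ s, t - D ≤ s → Real.exp (-(1 / 2) * s) ≤ ED * Real.exp (-(1 / 2) * t) := by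
    intro s hs
    rw [hED, ← Real.exp_add]
    exact Real.exp_le_exp.2 (by linarith)
  have hαD : ∀ s, t - D ≤ s → |α s| ≤ CK * CZ * ED * (Real.exp (-(1 / 2) * t) * ‖y₀‖) := by
    intro s hs
    refine (hα s).trans ?_
    have := mul_le_mul_of_nonneg_left (mul_le_mul_of_nonneg_right (hexpD s hs) (norm_nonneg y₀))
      (mul_nonneg hCK hCZ0)
    linarith
  have hZ : ‖artsteinZ L c D lam e α u y t‖ ≤ CZ * (Real.exp (-(1 / 2) * t) * ‖y₀‖) := by
    rw [h.artsteinZ_eq b hL hc hidx hD ht₀ ht]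
    split_ifs with htt
    · have h5 : 1 ≤ E * Real.exp (-(1 / 2) * t) := by
        rw [hE, ← Real.exp_add]
        exact Real.one_le_exp (by linarith)
      calc _ ≤ C2 * ‖stateX L e 0 y₀‖ := h2 t ⟨ht, htt.le⟩ _
        _ ≤ C2 * ‖y₀‖ := mul_le_mul_of_nonneg_left (hX0 y₀) hC2
        _ = 1 * 1 * (C2 * ‖y₀‖) := by ring
        _ ≤ (C1 + 1) * (E * Real.exp (-(1 / 2) * t)) * (C2 * ‖y₀‖) := by
            gcongr
            linarith
        _ = _ := by rw [hCZ]; ring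
    · have := hcl y₀ t (not_lt.1 htt)
      linarith
  have hint : ‖∫ s in (t - D)..t, α s • expB L c lam e (t - s - D)‖ ≤
      CK * CZ * ED * (Real.exp (-(1 / 2) * t) * ‖y₀‖) * (C3 * ‖vecB L e‖) * |t - (t - D)| := by
    refine intervalIntegral.norm_integral_le_of_norm_le_const fun s hs => ?_
    rw [uIoc_of_le (by linarith)] at hs
    rw [norm_smul, Real.norm_eq_abs]
    exact mul_le_mul (hαD s hs.1.le) (h3 _ ⟨by linarith [hs.2], by linarith [hs.1]⟩ _)
      (norm_nonneg _) (by positivity)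
  rw [sub_sub_cancel, abs_of_nonneg hD] at hint
  -- The state is recovered from Artstein's transform by subtracting the inputs on their way.
  have hX : stateX L e (u (t - D)) (y t) = artsteinZ L c D lam e α u y t -
      ∫ s in (t - D)..t, α s • expB L c lam e (t - s - D) := by
    rw [artsteinZ, add_sub_cancel_right]
  have hP : 0 ≤ Real.exp (-(1 / 2) * t) * ‖y₀‖ := by positivity
  constructor
  · refine (hαD _ le_rfl).trans ?_
    rw [mul_assoc _ (Real.exp (-(1 / 2) * t))]
    refine mul_le_mul_of_nonneg_right ?_ hP
    have : 0 ≤ CZ + CK * CZ * ED * (C3 * ‖vecB L e‖) * D := by positivity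
    linarith
  · rw [hX]
    refine (norm_sub_le _ _).trans ((add_le_add hZ hint).trans ?_)
    have : 0 ≤ CK * CZ * ED * (Real.exp (-(1 / 2) * t) * ‖y₀‖) := by positivity
    linarith

end ClosedLoop

/-! ### Decay of the stable modes -/

/-- The negative part of the spectrum is bounded away from `0`. -/
theorem exists_spectral_gap {c : ℝ → ℝ} (hL : 0 < L)
    (hc : MemLp c ⊤ (volume.restrict (Ioo (0 : ℝ) L))) :
    ∃ μ, 0 < μ ∧ 2 * μ ≤ 1 / 2 ∧
      ∀ (r : ℝ) (v : ℝ → ℝ), IsEigenfunction L c r v → r < 0 → r ≤ -(2 * μ) := by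
  have hfin := (finite_eigenvalues_ge hL hc (-1)).inter_of_left (Iio 0)
  obtain ⟨ε, hε, hball⟩ := Metric.isOpen_iff.1 hfin.isClosed.isOpen_compl (0 : ℝ)
    fun h => absurd h.2 (lt_irrefl (0 : ℝ))
  refine ⟨min (ε / 2) (1 / 4), by positivity, by linarith [min_le_right (ε / 2) (1 / 4)], ?_⟩
  intro r v hv hr
  by_contra! hlt
  have h1 := min_le_left (ε / 2) (1 / 4 : ℝ)
  have h2 := min_le_right (ε / 2) (1 / 4 : ℝ)
  have hmem : r ∈ Metric.ball 0 ε := by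
    rw [Metric.mem_ball, dist_zero_right, Real.norm_eq_abs, abs_lt]
    constructor <;> linarith
  exact hball hmem ⟨⟨by linarith, v, hv⟩, hr⟩

/-- Duhamel's integral for a stable mode driven by an exponentially decaying source. -/
theorem abs_duhamel_le {r μ N t : ℝ} {g : ℝ → ℝ} (hμ : 0 < μ) (hμ2 : 2 * μ ≤ 1 / 2)
    (hr : r ≤ -(2 * μ)) (ht : 0 ≤ t) (hN : 0 ≤ N)
    (hg : ∀ s ∈ Icc 0 t, |g s| ≤ N * Real.exp (-(1 / 2) * s)) :
    |Real.exp (r * t) * ∫ s in (0 : ℝ)..t, Real.exp (-r * s) * g s| ≤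
      2 * N / -r * Real.exp (-μ * t) := by
  have hr0 : 0 < -r := by linarith
  have hderiv : ∀ s ∈ uIcc 0 t, HasDerivAt (fun s => N * Real.exp ((-r / 2) * s) / (-r / 2))
      (N * Real.exp ((-r / 2) * s)) s := by
    intro s _
    have := ((((hasDerivAt_id s).const_mul (-r / 2)).exp).const_mul N).div_const (-r / 2)
    refine this.congr_deriv ?_
    rw [mul_one, ← mul_assoc, mul_div_cancel_right₀ _ (by linarith : -r / 2 ≠ 0)]
    rfl
  have hint := intervalIntegral.integral_eq_sub_of_hasDerivAt hderiv
    (Continuous.intervalIntegrable (by fun_prop) _ _)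
  -- Half of the rate `-r` bounds the source, the other half is integrated.
  have hbound : ‖∫ s in (0 : ℝ)..t, Real.exp (-r * s) * g s‖ ≤
      ∫ s in (0 : ℝ)..t, Real.exp ((-r / 2 - μ) * t) * (N * Real.exp ((-r / 2) * s)) := by
    refine intervalIntegral.norm_integral_le_of_norm_le ht ?_
      (Continuous.intervalIntegrable (by fun_prop) _ _)
    refine Eventually.of_forall fun s hs => ?_
    rw [norm_mul, Real.norm_eq_abs, Real.norm_eq_abs, Real.abs_exp]
    calc _ ≤ Real.exp (-r * s) * (N * Real.exp (-(1 / 2) * s)) :=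
          mul_le_mul_of_nonneg_left (hg s ⟨hs.1.le, hs.2⟩) (Real.exp_pos _).le
      _ = N * Real.exp (-r * s + -(1 / 2) * s) := by rw [Real.exp_add]; ring
      _ ≤ N * Real.exp ((-r / 2 - μ) * t + (-r / 2) * s) := by
          refine mul_le_mul_of_nonneg_left (Real.exp_le_exp.2 ?_) hN
          have h1 : (-r / 2 - μ) * s ≤ (-r / 2 - μ) * t :=
            mul_le_mul_of_nonneg_left hs.2 (by linarith)
          nlinarith [hs.1]
      _ = _ := by rw [Real.exp_add]; ring
  rw [intervalIntegral.integral_const_mul, hint] at hbound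
  rw [abs_mul, Real.abs_exp]
  calc _ ≤ Real.exp (r * t) * (Real.exp ((-r / 2 - μ) * t) *
        (N * Real.exp ((-r / 2) * t) / (-r / 2))) := by
        refine mul_le_mul_of_nonneg_left (hbound.trans ?_) (Real.exp_pos _).le
        refine mul_le_mul_of_nonneg_left (sub_le_self _ ?_) (Real.exp_pos _).le
        positivity
    _ = 2 * N / -r *
          (Real.exp (r * t) * Real.exp ((-r / 2 - μ) * t) * Real.exp ((-r / 2) * t)) := by
        field_simp
    _ = _ := by
        rw [← Real.exp_add, ← Real.exp_add]; congr 2; ring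

/-- The factor `2 / -r` gained in Duhamel's integral compensates the weight `σ - r` of the energy
norm, uniformly over the stable modes. -/
theorem shift_sub_div_sq_le {σ r μ : ℝ} (hσ : 0 ≤ σ) (hμ : 0 < μ) (hr : r ≤ -(2 * μ)) :
    (σ - r) * (2 / -r) ^ 2 ≤ (σ + 2 * μ) / μ ^ 2 := by
  have h1 : 0 < -r := by linarith
  rw [div_pow, mul_div_assoc', div_le_div_iff₀ (by positivity) (by positivity)]
  have h2 : (2 * μ) * (2 * μ) ≤ (-r) * (-r) := mul_self_le_mul_self (by positivity) (by linarith)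
  have h3 : 0 ≤ (-r) * μ * (-r - 2 * μ) := by
    have : 0 ≤ -r - 2 * μ := by linarith
    positivity
  nlinarith [mul_nonneg hσ (sub_nonneg.2 h2)]

namespace SpectralBasis

variable {ι : Type} {c : ℝ → ℝ}

theorem sum_inner_sq_le (b : SpectralBasis L c ι) (F : Finset ι) (x : L2 L) :
    ∑ i ∈ F, inner ℝ (b.basis i) x ^ 2 ≤ ‖x‖ ^ 2 := by
  rw [b.norm_sq_eq_tsum]
  exact (b.summable_inner_sq x).sum_le_tsum F fun i _ => sq_nonneg _

/-- If the boundary values and finitely many modes decay exponentially and the remaining modes are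
stable, then the solution decays in `H¹`. The numbers `g i` bound the contribution of the initial
value to the energy of the stable modes. -/
theorem exists_H1Bound_of_decay (b : SpectralBasis L c ι) (hL : 0 < L)
    (hc : MemLp c ⊤ (volume.restrict (Ioo (0 : ℝ) L))) {μ : ℝ} (hμ : 0 < μ)
    (hμ2 : 2 * μ ≤ 1 / 2) (hgap : ∀ i, b.lam i < 0 → b.lam i ≤ -(2 * μ)) (S : Finset ι)
    (hS : ∀ i, 0 ≤ b.lam i → i ∈ S) :
    ∃ C, 0 ≤ C ∧ ∀ (v η : ℝ → ℝ) (y₀ : L2 L) (y : ℝ → L2 L) (N Q t : ℝ) (g : ι → ℝ),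
      LocallyIntegrable η volume → (∀ t, 0 ≤ t → v t = ∫ s in (0 : ℝ)..t, η s) →
      IsHeatSolution L c v y₀ y → 0 ≤ t → 0 ≤ N → 0 ≤ Q →
      (∀ s ∈ Icc 0 t, |v s| ≤ N * Real.exp (-(1 / 2) * s)) →
      (∀ s ∈ Icc 0 t, |η s| ≤ N * Real.exp (-(1 / 2) * s)) →
      (∀ i ∈ S, 0 ≤ b.lam i →
        |inner ℝ (b.basis i) (y t) + b.coefB i * v t| ≤ N * Real.exp (-(1 / 2) * t)) →
      (∀ i, 0 ≤ g i) →
      (∀ i, b.lam i < 0 → (shift L c - b.lam i) *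
        (Real.exp (b.lam i * t) * inner ℝ (b.basis i) y₀) ^ 2 ≤ Real.exp (-μ * t) ^ 2 * g i) →
      (∀ F : Finset ι, ∑ i ∈ F, g i ≤ Q ^ 2) →
      H1Bound L (y t) (v t) (C * Real.exp (-μ * t) * (Q + N)) := by
  classical
  obtain ⟨C1, hC1, hC1'⟩ := exists_H1Bound_dirichletPrimitive hL
  set σ := shift L c with hσ
  have hσ0 : 0 < σ := shift_pos L c
  set C2 := (σ + 2 * μ) / μ ^ 2 with hC2
  have hC20 : 0 ≤ C2 := by positivity
  set C3 := 4 * C2 * (‖cxiL hc‖ ^ 2 + ‖xiL L‖ ^ 2) + σ * S.card with hC3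
  have hC30 : 0 ≤ C3 := by positivity
  refine ⟨C1 * (C3 + 2), by positivity, ?_⟩
  intro v η y₀ y N Q t g hη hv hy ht hN hQ hvb hηb hunst hg0 hg hgsum
  set E := Real.exp (-μ * t) with hE
  have hE0 : 0 < E := Real.exp_pos _
  have hEt : Real.exp (-(1 / 2) * t) ≤ E := Real.exp_le_exp.2 (by nlinarith)
  set w : ι → ℝ := fun i => inner ℝ (b.basis i) (y t) + b.coefB i * v t with hw
  have hwi : ∀ i, inner ℝ (b.basis i) (y t - v t • xiL L) = w i := by
    intro i
    rw [inner_sub_right, real_inner_smul_right]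
    simp only [hw, coefB]
    ring
  have hmode : ∀ i, (σ - b.lam i) * w i ^ 2 ≤ E ^ 2 * (2 * g i + N ^ 2 *
      (4 * C2 * (b.coefA hc i ^ 2 + b.coefB i ^ 2) + if i ∈ S then σ else 0)) := by
    intro i
    have hρ : 0 < σ - b.lam i := b.shift_sub_pos hL hc i
    rcases le_or_gt 0 (b.lam i) with h0 | h0
    · rw [if_pos (hS i h0)]
      have h1 : w i ^ 2 ≤ (N * E) ^ 2 := sq_le_sq' (by
          have := (abs_le.1 (hunst i (hS i h0) h0)).1
          have h3 := mul_le_mul_of_nonneg_left hEt hN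
          simp only [hw]; linarith) (by
          have := (abs_le.1 (hunst i (hS i h0) h0)).2
          have h3 := mul_le_mul_of_nonneg_left hEt hN
          simp only [hw]; linarith)
      calc _ ≤ σ * (N * E) ^ 2 := mul_le_mul (by linarith) h1 (sq_nonneg _) hσ0.le
        _ = E ^ 2 * (N ^ 2 * σ) := by ring
        _ ≤ _ := by
          refine mul_le_mul_of_nonneg_left ?_ (sq_nonneg _)
          have h2 := hg0 i
          have h3 : 0 ≤ N ^ 2 * (4 * C2 * (b.coefA hc i ^ 2 + b.coefB i ^ 2)) := by positivity
          linarith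
    · have hr := hgap i h0
      set A := |b.coefA hc i| + |b.coefB i| with hA
      have hA0 : 0 ≤ A := by positivity
      have hduh := abs_duhamel_le (g := fun s => b.coefA hc i * v s + b.coefB i * η s) hμ hμ2 hr ht
        (mul_nonneg hA0 hN) (fun s hs => by
          refine (abs_add_le _ _).trans ?_
          rw [abs_mul, abs_mul]
          have h1 := mul_le_mul_of_nonneg_left (hvb s hs) (abs_nonneg (b.coefA hc i))
          have h2 := mul_le_mul_of_nonneg_left (hηb s hs) (abs_nonneg (b.coefB i))
          rw [hA]; linarith)
      have hweq : w i = Real.exp (b.lam i * t) * inner ℝ (b.basis i) y₀ +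
          Real.exp (b.lam i * t) * ∫ s in (0 : ℝ)..t, Real.exp (-b.lam i * s) *
            (b.coefA hc i * v s + b.coefB i * η s) := by
        simp only [hw]
        rw [b.coef_eq_exp_of_isHeatSolution hL hc hη hv hy i ht, mul_add]
      set p := Real.exp (b.lam i * t) * inner ℝ (b.basis i) y₀
      set q := Real.exp (b.lam i * t) * ∫ s in (0 : ℝ)..t, Real.exp (-b.lam i * s) *
            (b.coefA hc i * v s + b.coefB i * η s)
      have hq : (σ - b.lam i) * q ^ 2 ≤ E ^ 2 * (N ^ 2 * (C2 * A ^ 2)) := by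
        have h1 : q ^ 2 ≤ (2 * (A * N) / -b.lam i * E) ^ 2 := by
          rw [← sq_abs q]
          exact pow_le_pow_left₀ (abs_nonneg _) hduh 2
        calc _ ≤ (σ - b.lam i) * (2 * (A * N) / -b.lam i * E) ^ 2 :=
              mul_le_mul_of_nonneg_left h1 hρ.le
          _ = (σ - b.lam i) * (2 / -b.lam i) ^ 2 * (E ^ 2 * (N ^ 2 * A ^ 2)) := by ring
          _ ≤ C2 * (E ^ 2 * (N ^ 2 * A ^ 2)) :=
              mul_le_mul_of_nonneg_right (shift_sub_div_sq_le hσ0.le hμ hr) (by positivity)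
          _ = _ := by ring
      have hA2 : A ^ 2 ≤ 2 * (b.coefA hc i ^ 2 + b.coefB i ^ 2) := by
        have := add_sq_le (a := |b.coefA hc i|) (b := |b.coefB i|)
        rwa [sq_abs, sq_abs] at this
      have h4 : (p + q) ^ 2 ≤ 2 * (p ^ 2 + q ^ 2) := add_sq_le
      have h5 := hg i h0
      have h6 : 0 ≤ if i ∈ S then σ else 0 := by split_ifs <;> linarith
      rw [hweq]
      calc _ ≤ (σ - b.lam i) * (2 * (p ^ 2 + q ^ 2)) := mul_le_mul_of_nonneg_left h4 hρ.le
        _ ≤ E ^ 2 * (2 * g i + N ^ 2 * (2 * C2 * A ^ 2)) := by linarith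
        _ ≤ _ := by
          refine mul_le_mul_of_nonneg_left ?_ (sq_nonneg _)
          have h7 : 2 * C2 * A ^ 2 ≤ 2 * C2 * (2 * (b.coefA hc i ^ 2 + b.coefB i ^ 2)) :=
            mul_le_mul_of_nonneg_left hA2 (by positivity)
          have h8 := mul_le_mul_of_nonneg_left h7 (sq_nonneg N)
          have h9 := mul_nonneg (sq_nonneg N) h6
          linarith
  have hsum : ∀ F : Finset ι, ∑ i ∈ F, (σ - b.lam i) *
      inner ℝ (b.basis i) (y t - v t • xiL L) ^ 2 ≤ (E * (2 * Q + (C3 + 1) * N)) ^ 2 := by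
    intro F
    simp only [hwi]
    refine (Finset.sum_le_sum fun i _ => hmode i).trans ?_
    rw [← Finset.mul_sum, Finset.sum_add_distrib, ← Finset.mul_sum, ← Finset.mul_sum,
      Finset.sum_add_distrib, ← Finset.mul_sum, Finset.sum_add_distrib, mul_pow]
    refine mul_le_mul_of_nonneg_left ?_ (sq_nonneg _)
    have h1 := b.sum_inner_sq_le F (cxiL hc)
    have h2 : ∑ i ∈ F, b.coefB i ^ 2 ≤ ‖xiL L‖ ^ 2 := by
      simpa only [coefB, neg_sq] using b.sum_inner_sq_le F (xiL L)
    have h3 : (∑ i ∈ F, if i ∈ S then σ else 0) ≤ σ * S.card := by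
      rw [← Finset.sum_filter, Finset.sum_const, nsmul_eq_mul, mul_comm]
      refine mul_le_mul_of_nonneg_left ?_ hσ0.le
      exact_mod_cast Finset.card_le_card fun i hi => (Finset.mem_filter.1 hi).2
    have h4 : 4 * C2 * (∑ i ∈ F, b.coefA hc i ^ 2 + ∑ i ∈ F, b.coefB i ^ 2) +
        (∑ i ∈ F, if i ∈ S then σ else 0) ≤ C3 := by
      rw [hC3]
      exact add_le_add (mul_le_mul_of_nonneg_left (add_le_add h1 h2) (by positivity)) h3
    have h5 := mul_le_mul_of_nonneg_left h4 (sq_nonneg N)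
    have h6 := hgsum F
    have h7 : 0 ≤ Q * ((C3 + 1) * N) := by positivity
    have h8 : 0 ≤ (C3 ^ 2 + C3 + 1) * N ^ 2 := by positivity
    nlinarith [sq_nonneg Q]
  obtain ⟨G, hG, hGn⟩ := b.exists_dirichletPrimitive_eq hL hc hsum (by positivity)
  have hb := hC1' G (v t)
  rw [hG, sub_add_cancel] at hb
  refine hb.mono ?_
  rw [mul_assoc, mul_assoc]
  refine mul_le_mul_of_nonneg_left ?_ hC1
  have hvt : |v t| ≤ N * E := (hvb t ⟨ht, le_rfl⟩).trans (mul_le_mul_of_nonneg_left hEt hN)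
  have h9 : 0 ≤ C3 * (E * Q) := by positivity
  linarith

/-- Parabolic smoothing: for times `t ≥ δ` the decay of a stable mode absorbs the weight `σ - r` of
the energy norm. -/
theorem shift_sub_mul_exp_sq_le {σ r μ δ t : ℝ} (hσ : 0 ≤ σ) (hδ : 0 < δ) (ht : δ ≤ t)
    (hμ : 0 < μ) (hr : r ≤ -(2 * μ)) :
    (σ - r) * Real.exp (r * t) ^ 2 ≤ Real.exp (-μ * t) ^ 2 * (σ + 1 / δ) := by
  have h1 : (σ - r) * Real.exp (r * δ) ≤ σ + 1 / δ := by
    have h2 : -r * δ ≤ Real.exp (-r * δ) := by linarith [Real.add_one_le_exp (-r * δ)]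
    have h3 : Real.exp (r * δ) ≤ 1 := Real.exp_le_one_iff.2 (by nlinarith)
    have h4 : Real.exp (-r * δ) * Real.exp (r * δ) = 1 := by
      rw [← Real.exp_add]; simp
    have h5 : -r * Real.exp (r * δ) ≤ 1 / δ := by
      rw [le_div_iff₀ hδ]
      have := mul_le_mul_of_nonneg_right h2 (Real.exp_pos (r * δ)).le
      linarith
    have h6 := mul_le_mul_of_nonneg_left h3 hσ
    linarith
  have h2 : Real.exp (r * t) ^ 2 ≤ Real.exp (r * δ) * Real.exp (-μ * t) ^ 2 := by
    rw [← Real.exp_nat_mul, ← Real.exp_nat_mul, ← Real.exp_add]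
    refine Real.exp_le_exp.2 ?_
    push_cast
    nlinarith
  calc _ ≤ (σ - r) * (Real.exp (r * δ) * Real.exp (-μ * t) ^ 2) :=
        mul_le_mul_of_nonneg_left h2 (by linarith)
    _ = Real.exp (-μ * t) ^ 2 * ((σ - r) * Real.exp (r * δ)) := by ring
    _ ≤ _ := mul_le_mul_of_nonneg_left h1 (sq_nonneg _)

end SpectralBasis

/-! ### Exponential stability of the closed-loop system -/

theorem exists_isUnstableModes {c : ℝ → ℝ} (hL : 0 < L)
    (hc : MemLp c ⊤ (volume.restrict (Ioo (0 : ℝ) L))) :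
    ∃ (n : ℕ) (lam : Fin n → ℝ) (e : Fin n → ℝ → ℝ), IsUnstableModes L c lam e := by
  have hfin := finite_eigenvalues_ge hL hc 0
  set S := hfin.toFinset with hS
  have hmem : ∀ j, S.orderEmbOfFin rfl (Fin.rev j) ∈ {μ | 0 ≤ μ ∧ ∃ v, IsEigenfunction L c μ v} :=
    fun j => hfin.mem_toFinset.1 (S.orderEmbOfFin_mem rfl _)
  choose h0 e he using hmem
  -- The enumeration is reversed because the `lam j` decrease.
  refine ⟨S.card, fun j => S.orderEmbOfFin rfl (Fin.rev j), e, fun i j hij => ?_, h0, he, ?_⟩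
  · exact (S.orderEmbOfFin rfl).strictMono (Fin.rev_lt_rev.2 hij)
  · intro mu v hmu hv
    have h1 : mu ∈ Set.range (S.orderEmbOfFin rfl) := by
      rw [Finset.range_orderEmbOfFin]
      exact hfin.mem_toFinset.2 ⟨hmu, v, hv⟩
    obtain ⟨j, hj⟩ := h1
    exact ⟨Fin.rev j, by rw [Fin.rev_rev, hj]⟩

/-- Each unstable mode is controllable from the boundary. -/
theorem IsUnstableModes.aCoef_add_mul_bCoef_ne_zero {c : ℝ → ℝ} {n : ℕ} {lam : Fin n → ℝ}
    {e : Fin n → ℝ → ℝ} (h : IsUnstableModes L c lam e) (hL : 0 < L)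
    (hc : MemLp c ⊤ (volume.restrict (Ioo (0 : ℝ) L))) (j : Fin n) :
    aCoef L c e j + lam j * bCoef L e j ≠ 0 := by
  obtain ⟨b, idx, -, hidx⟩ := h.exists_spectralBasis hL hc
  obtain ⟨⟨e', e'', he, hae⟩, hn⟩ := b.eigen (idx j)
  rw [← b.coefA_eq_aCoef hL hc (hidx j).2, ← b.coefB_eq_bCoef hL (hidx j).2, ← (hidx j).1,
    b.coefA_add_mul_coefB hL hc _ he hae]
  exact neg_ne_zero.2 (deriv_right_ne_zero hL hc he hae hn)

/-- Exponential stability in `H¹`. The two bounds differ only in the weights `g i` that control the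
contribution of the initial value. -/
theorem IsUnstableModes.exists_decay {c : ℝ → ℝ} {D t₀ : ℝ} {n : ℕ} {lam : Fin n → ℝ}
    {e : Fin n → ℝ → ℝ} {K : Idx n → ℝ} (h : IsUnstableModes L c lam e) (hL : 0 < L)
    (hc : MemLp c ⊤ (volume.restrict (Ioo (0 : ℝ) L))) (hD : 0 ≤ D) (ht₀ : 0 ≤ t₀)
    (hK : IsPoleShiftingGain L c D lam e K) :
    ∃ μ : ℝ, 0 < μ ∧
      (∀ δ : ℝ, 0 < δ → ∃ C : ℝ, ∀ (y₀ : L2 L) (α u : ℝ → ℝ) (y : ℝ → L2 L),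
        IsClosedLoop L c D t₀ lam e K y₀ α u y →
        ∀ t, δ ≤ t → H1Bound L (y t) (u (t - D)) (C * Real.exp (-μ * t) * ‖y₀‖)) ∧
      (∃ C : ℝ, ∀ (y₀ : L2 L) (v v' : ℝ → ℝ), HasWeakDeriv L v v' → v 0 = 0 → v L = 0 →
        (∀ᵐ x ∂(volume.restrict (Set.Ioo (0 : ℝ) L)), y₀ x = v x) →
        ∀ (α u : ℝ → ℝ) (y : ℝ → L2 L),
        IsClosedLoop L c D t₀ lam e K y₀ α u y →
        ∀ t, 0 ≤ t →
          H1Bound L (y t) (u (t - D)) (C * Real.exp (-μ * t) * h1Norm L v v')) := by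
  classical
  obtain ⟨b, idx, hlam, hidx⟩ := h.exists_spectralBasis hL hc
  obtain ⟨μ, hμ, hμ2, hgap⟩ := exists_spectral_gap hL hc
  have hgap' : ∀ i, b.lam i < 0 → b.lam i ≤ -(2 * μ) := fun i => hgap _ _ (b.eigen i)
  have hS : ∀ i, 0 ≤ b.lam i → i ∈ Finset.univ.image idx := by
    intro i hi
    obtain ⟨j, hj⟩ := h.complete _ _ hi (b.eigen i)
    refine Finset.mem_image.2 ⟨j, Finset.mem_univ j, Subtype.ext ?_⟩
    rw [← hlam, ← hlam, (hidx j).1, hj]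
  obtain ⟨C1, hC1, hdec⟩ := b.exists_unstable_decay hL hc hidx hD ht₀ hK
  obtain ⟨C2, hC2, hbd⟩ := b.exists_H1Bound_of_decay hL hc hμ hμ2 hgap' _ hS
  have main : ∀ (y₀ : L2 L) (α u : ℝ → ℝ) (y : ℝ → L2 L),
      IsClosedLoop L c D t₀ lam e K y₀ α u y → ∀ (t Q : ℝ) (g : _ → ℝ), 0 ≤ t → 0 ≤ Q →
      (∀ i, 0 ≤ g i) →
      (∀ i, b.lam i < 0 → (shift L c - b.lam i) *
        (Real.exp (b.lam i * t) * inner ℝ (b.basis i) y₀) ^ 2 ≤ Real.exp (-μ * t) ^ 2 * g i) →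
      (∀ F : Finset _, ∑ i ∈ F, g i ≤ Q ^ 2) →
      H1Bound L (y t) (u (t - D)) (C2 * Real.exp (-μ * t) * (Q + C1 * ‖y₀‖)) := by
    intro y₀ α u y hcl t Q g ht hQ hg0 hg hgs
    refine hbd (fun t => u (t - D)) (fun t => α (t - D)) y₀ y (C1 * ‖y₀‖) Q t g
      (locallyIntegrable_comp_sub hcl.locallyIntegrable D)
      (fun t _ => integral_sub_eq_of_eq_zero_of_neg hcl.locallyIntegrable
        (hcl.eq_zero_of_neg ht₀) hcl.control hD t) hcl.solution ht (by positivity) hQ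
      (fun s hs => ?_) (fun s hs => ?_) (fun i hi _ => ?_) hg0 hg hgs
    · have h1 := (norm_le_pi_norm _ (Sum.inl ())).trans (hdec y₀ α u y hcl s hs.1).2
      rw [mul_right_comm]
      exact h1
    · rw [mul_right_comm]
      exact (hdec y₀ α u y hcl s hs.1).1
    · obtain ⟨j, -, rfl⟩ := Finset.mem_image.1 hi
      have h1 := (norm_le_pi_norm _ (Sum.inr j)).trans (hdec y₀ α u y hcl t ht).2
      rw [b.stateX_inr hL (hidx j).2] at h1
      rw [mul_right_comm]
      exact h1
  refine ⟨μ, hμ, fun δ hδ => ?_, ?_⟩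
  · have hσ := (shift_pos L c).le
    refine ⟨C2 * (Real.sqrt (shift L c + 1 / δ) + C1), fun y₀ α u y hcl t ht => ?_⟩
    refine (main y₀ α u y hcl t (Real.sqrt (shift L c + 1 / δ) * ‖y₀‖)
      (fun i => (shift L c + 1 / δ) * inner ℝ (b.basis i) y₀ ^ 2) (hδ.le.trans ht)
      (by positivity) (fun i => by positivity) (fun i hi => ?_) fun F => ?_).mono ?_
    · have := mul_le_mul_of_nonneg_right
        (SpectralBasis.shift_sub_mul_exp_sq_le hσ hδ ht hμ (hgap' i hi))
        (sq_nonneg (inner ℝ (b.basis i) y₀))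
      rw [mul_pow]
      linarith
    · rw [mul_pow, Real.sq_sqrt (by positivity), ← Finset.mul_sum]
      exact mul_le_mul_of_nonneg_left (b.sum_inner_sq_le F y₀) (by positivity)
    · exact le_of_eq (by ring)
  · refine ⟨C2 * (Real.sqrt ‖formOp hL hc‖ + C1), ?_⟩
    intro y₀ v v' hv hv0 hvL hy₀ α u y hcl t ht
    have hnorm : ‖y₀‖ ≤ h1Norm L v v' := (norm_le_h1Norm hL.le hy₀ (coeFn_toL2 hv.memLp)).1
    refine (main y₀ α u y hcl t (Real.sqrt ‖formOp hL hc‖ * h1Norm L v v')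
      (fun i => (shift L c - b.lam i) * inner ℝ (b.basis i) y₀ ^ 2) ht
      (mul_nonneg (Real.sqrt_nonneg _) (Real.sqrt_nonneg _))
      (fun i => mul_nonneg (b.shift_sub_pos hL hc i).le (sq_nonneg _)) (fun i hi => ?_)
      fun F => ?_).mono ?_
    · rw [mul_pow, mul_left_comm]
      refine mul_le_mul_of_nonneg_right (pow_le_pow_left₀ (Real.exp_pos _).le
        (Real.exp_le_exp.2 ?_) 2) (mul_nonneg (b.shift_sub_pos hL hc i).le (sq_nonneg _))
      have := hgap' i hi
      nlinarith
    · rw [mul_pow, Real.sq_sqrt (norm_nonneg _)]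
      exact b.sum_coef_le hL hc hv hv0 hvL hy₀ F
    · have h1 := mul_le_mul_of_nonneg_left (mul_le_mul_of_nonneg_left hnorm hC1)
        (mul_nonneg hC2 (Real.exp_pos (-μ * t)).le)
      linarith

theorem theorem1 (L : ℝ) (hL : 0 < L) (c : ℝ → ℝ)
    (hc : MemLp c ⊤ (volume.restrict (Set.Ioo (0 : ℝ) L))) (D : ℝ) (hD : 0 ≤ D) :
    (∃ (n : ℕ) (lam : Fin n → ℝ) (e : Fin n → ℝ → ℝ), IsUnstableModes L c lam e) ∧
    ∀ (n : ℕ) (lam : Fin n → ℝ) (e : Fin n → ℝ → ℝ), IsUnstableModes L c lam e →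
      (∃ K : Idx n → ℝ, IsPoleShiftingGain L c D lam e K) ∧
      ∀ K : Idx n → ℝ, IsPoleShiftingGain L c D lam e K → ∀ t₀ : ℝ, 0 ≤ t₀ →
        -- the closed-loop system is well posed for every initial condition in `L²(0,L)`
        (∀ y₀ : L2 L,
          (∃ (α u : ℝ → ℝ) (y : ℝ → L2 L), IsClosedLoop L c D t₀ lam e K y₀ α u y) ∧
          (∀ (α u : ℝ → ℝ) (y : ℝ → L2 L) (α₂ u₂ : ℝ → ℝ) (y₂ : ℝ → L2 L),
            IsClosedLoop L c D t₀ lam e K y₀ α u y →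
            IsClosedLoop L c D t₀ lam e K y₀ α₂ u₂ y₂ →
            α = α₂ ∧ u = u₂ ∧ ∀ t, 0 ≤ t → y t = y₂ t)) ∧
        -- exponential decay of the `H¹(0,L)` norm, with a uniform rate
        ∃ μ : ℝ, 0 < μ ∧
          (∀ δ : ℝ, 0 < δ → ∃ C : ℝ, ∀ (y₀ : L2 L) (α u : ℝ → ℝ) (y : ℝ → L2 L),
            IsClosedLoop L c D t₀ lam e K y₀ α u y →
            ∀ t, δ ≤ t → H1Bound L (y t) (u (t - D)) (C * Real.exp (-μ * t) * ‖y₀‖)) ∧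
          (∃ C : ℝ, ∀ (y₀ : L2 L) (v v' : ℝ → ℝ), HasWeakDeriv L v v' → v 0 = 0 → v L = 0 →
            (∀ᵐ x ∂(volume.restrict (Set.Ioo (0 : ℝ) L)), y₀ x = v x) →
            ∀ (α u : ℝ → ℝ) (y : ℝ → L2 L),
            IsClosedLoop L c D t₀ lam e K y₀ α u y →
            ∀ t, 0 ≤ t →
              H1Bound L (y t) (u (t - D)) (C * Real.exp (-μ * t) * h1Norm L v v')) := by
  refine ⟨exists_isUnstableModes hL hc, fun n lam e h => ⟨exists_isPoleShiftingGain lam D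
    h.strictAnti.injective (h.aCoef_add_mul_bCoef_ne_zero hL hc), fun K hK t₀ ht₀ => ⟨fun y₀ => ?_,
    h.exists_decay hL hc hD ht₀ hK⟩⟩⟩
  obtain ⟨b, idx, -, hidx⟩ := h.exists_spectralBasis hL hc
  exact ⟨b.exists_isClosedLoop hL hc hidx hD ht₀ K y₀, fun α u y α₂ u₂ y₂ h₁ h₂ =>
    h₁.unique h₂ b hL hc hidx hD ht₀⟩
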